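/- **Setting.** A *Hanner polytope* in $\mathbb R^n$ is an $n$-dimensional set $H\subset\mathbb R^n$ obtained from symmetric intervals $[-v,v]$, $v\ne0$, by repeatedly taking $\ell_1$-sums $H_1\oplus_1H_2=\mathrm{conv}(H_1\cup H_2)$ and $\ell_\infty$-sums $H_1\oplus H_2=H_1+H_2$ of sets with $\mathrm{span}(H_1)\cap \mathrm{span}(H_2)=\{0\}$; fix such a representation of $H$. "Face" means a proper non-empty face (intersection with a supporting hyperplane), $\dim$ is the dimension of the affine hull, and $c_F$ is the centroid of $F$. A *flag* of $H$ is a chain of faces $\mathbb F=\{F^0\subset F^1\subset\dots\subset F^{n-1}\}$ with $\dim F^k=k$. For a family $Z=(z_F)$ of points of $\mathbb R^n$ indexed by the faces of $H$ put $$Z_{\mathbb F}=\mathrm{conv}\{0,z_{F^0},\dots,z_{F^{n-1}}\},\qquad V(Z)=\sum_{\mathbb F\text{ flag of }H}|Z_{\mathbb F}|,$$ where $|\cdot|$ is $n$-dimensional volume. Let $C=(c_F)$. The affine subspaces $A_F$ are defined inductively along the representation, for $F$ a face of a set occurring in it. If $H$ is an interval, $A_F=F$. If $H=H_1\oplus_1H_2$,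 then for faces $F_1,F_2$ of $H_1,H_2$ (the faces of $H$ are $F_1$, $F_2$ and $F_1\oplus_1F_2$), $$A_{F_1\oplus_1\varnothing}=A_{F_1}+\mathrm{span}(H_2),\qquad A_{\varnothing\oplus_1F_2}=\mathrm{span}(H_1)+A_{F_2},$$ $$A_{F_1\oplus_1F_2}=\tfrac{\dim F_1+1}{\dim F_1+\dim F_2+2}A_{F_1}+\tfrac{\dim F_2+1}{\dim F_1+\dim F_2+2}A_{F_2}.$$ If $H=H_1\oplus H_2$ (the faces of $H$ are $F_1\oplus H_2$, $H_1\oplus F_2$ and $F_1\oplus F_2$), $$A_{F_1\oplus H_2}=A_{F_1},\qquad A_{H_1\oplus F_2}=A_{F_2},$$ $$A_{F_1\oplus F_2}=A_{F_1}+A_{F_2}+\mathrm{span}\Big\{\tfrac{c_{F_1}}{\dim H_1-\dim F_1}-\tfrac{c_{F_2}}{\dim H_2-\dim F_2}\Big\}.$$ **Theorem.** Let $H$ be a Hanner polytope in $\mathbb R^n$ with a fixed representation. (1) Let $G$ be a face of $H$ and $z\in A_G-A_G$. There is $\varepsilon>0$ such that for all $\xi_1,\dots,\xi_n\in\mathbb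 R$ with $|\xi_k|<\varepsilon$ for every $k$, the family $W=(w_F)$ with $w_F=\xi_{\dim F+1}\,z$ if $F\supseteq G$ or $F\subseteq G$, and $w_F=0$ otherwise, satisfies $$\sum_{\mathbb F\ni G}|(C+W)_{\mathbb F}|=\sum_{\mathbb F\ni G}|C_{\mathbb F}|,$$ where the sums are over all flags of $H$ containing $G$. (2) Consequently, for every family $Z=(z_F)$ with $z_F\in A_F-A_F$ for all faces $F$, the directional derivative of $V$ at $C$ along $Z$ exists and vanishes: $$\langle V'(C),Z\rangle=\lim_{t\to0}\frac{V(C+tZ)-V(C)}{t}=0.$$ -/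

import Mathlib

open scoped Pointwise MeasureTheory

namespace Hanner

/-- The dimension of a (non-empty) set: the dimension of `span (A - A)`. -/
noncomputable def setDim {E : Type*} [AddCommGroup E] [Module ℝ E] (A : Set E) : ℕ :=
  Module.finrank ℝ (vectorSpan ℝ A)

/-- The centroid of a convex set `A` of dimension `k`: the average of `x` over `A` with respect to
the `k`-dimensional (Lebesgue = Hausdorff, up to a constant factor) measure. -/
noncomputable def centroid {E : Type*} [NormedAddCommGroup E] [InnerProductSpace ℝ E]
    [MeasurableSpace E] [BorelSpace E] (A : Set E) : E :=
  ⨍ x in A, x ∂(μH[(setDim A : ℝ)])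

/-- The `ℓ₁`-sum of two convex sets. -/
def lOneSum {E : Type*} [AddCommGroup E] [Module ℝ E] (A B : Set E) : Set E :=
  convexHull ℝ (A ∪ B)

/-- `HannerRep H` is the type of representations of `H` as a Hanner polytope: `H` is obtained from
symmetric intervals by repeatedly taking `ℓ₁`-sums and `ℓ_∞`-sums (Minkowski sums) of sets whose
linear spans meet only at the origin. -/
inductive HannerRep {E : Type*} [AddCommGroup E] [Module ℝ E] : Set E → Type _
  | interval (v : E) (hv : v ≠ 0) : HannerRep (segment ℝ (-v) v)
  | sumOne {H₁ H₂ : Set E} (R₁ : HannerRep H₁) (R₂ : HannerRep H₂)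
      (h : Disjoint (Submodule.span ℝ H₁) (Submodule.span ℝ H₂)) : HannerRep (lOneSum H₁ H₂)
  | sumInf {H₁ H₂ : Set E} (R₁ : HannerRep H₁) (R₂ : HannerRep H₂)
      (h : Disjoint (Submodule.span ℝ H₁) (Submodule.span ℝ H₂)) : HannerRep (H₁ + H₂)

/-- Proper faces of a convex set: the non-empty intersections with a supporting hyperplane which
are not the whole set. -/
def IsFace {E : Type*} [NormedAddCommGroup E] [InnerProductSpace ℝ E] (P F : Set E) : Prop :=
  IsExposed ℝ P F ∧ F.Nonempty ∧ F ≠ P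

/-- The type of proper faces of `P`. -/
def Face {E : Type*} [NormedAddCommGroup E] [InnerProductSpace ℝ E] (P : Set E) : Type _ :=
  {F : Set E // IsFace P F}

/-- The left summand `F₁` of a face `F = F₁ + F₂` of `H₁ + H₂`, where the spans of `H₁`, `H₂` meet
only at the origin. -/
def leftSummand {E : Type*} [AddCommGroup E] (H₁ H₂ F : Set E) : Set E :=
  {x | x ∈ H₁ ∧ ∃ y ∈ H₂, x + y ∈ F}

/-- The right summand `F₂` of a face `F = F₁ + F₂` of `H₁ + H₂`. -/
def rightSummand {E : Type*} [AddCommGroup E] (H₁ H₂ F : Set E) : Set E :=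
  {y | y ∈ H₂ ∧ ∃ x ∈ H₁, x + y ∈ F}

open scoped Classical in
/-- The affine subspace `A_F` associated with a face `F` of a represented Hanner polytope.

A face of the `ℓ₁`-sum of `H₁`, `H₂` is the `ℓ₁`-sum of `F₁ = F ∩ H₁` and `F₂ = F ∩ H₂`, each of
them empty (not both) or a proper face; a face of `H₁ + H₂` is `F₁ + F₂` with `F₁`, `F₂` its left
and right summands, each of them a proper face or (not both) all of `H₁`, `H₂` respectively. -/
noncomputable def affineSpace {E : Type*} [NormedAddCommGroup E] [InnerProductSpace ℝ E]
    [MeasurableSpace E] [BorelSpace E] {H : Set E} (R : HannerRep H) (F : Set E) : Set E :=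
  match R with
  | .interval _ _ => F
  | @HannerRep.sumOne _ _ _ H₁ H₂ R₁ R₂ _ =>
    let F₁ := F ∩ H₁
    let F₂ := F ∩ H₂
    if F₂ = ∅ then affineSpace R₁ F₁ + (Submodule.span ℝ H₂ : Set E)
    else if F₁ = ∅ then (Submodule.span ℝ H₁ : Set E) + affineSpace R₂ F₂
    else
      (((setDim F₁ : ℝ) + 1) / ((setDim F₁ : ℝ) + setDim F₂ + 2)) • affineSpace R₁ F₁
        + (((setDim F₂ : ℝ) + 1) / ((setDim F₁ : ℝ) + setDim F₂ + 2)) • affineSpace R₂ F₂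
  | @HannerRep.sumInf _ _ _ H₁ H₂ R₁ R₂ _ =>
    let F₁ := leftSummand H₁ H₂ F
    let F₂ := rightSummand H₁ H₂ F
    if F₂ = H₂ then affineSpace R₁ F₁
    else if F₁ = H₁ then affineSpace R₂ F₂
    else
      affineSpace R₁ F₁ + affineSpace R₂ F₂
        + (Submodule.span ℝ {((setDim H₁ : ℝ) - setDim F₁)⁻¹ • centroid F₁
            - ((setDim H₂ : ℝ) - setDim F₂)⁻¹ • centroid F₂} : Set E)

/-- A flag `F⁰ ⊂ F¹ ⊂ ⋯ ⊂ Fⁿ⁻¹` of proper faces of `P`, with `Fᵏ` of dimension `k`. -/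
structure FaceFlag {E : Type*} [NormedAddCommGroup E] [InnerProductSpace ℝ E]
    (P : Set E) (n : ℕ) where
  face : Fin n → Face P
  dim_face : ∀ k, setDim (face k).1 = (k : ℕ)
  mono : Monotone fun k => (face k).1

/-- The volume of the simplex with vertices `0` and `z_{F⁰}, …, z_{Fⁿ⁻¹}`. -/
noncomputable def simplexVolume {n : ℕ} {P : Set (EuclideanSpace ℝ (Fin n))}
    (Z : Face P → EuclideanSpace ℝ (Fin n)) (𝔽 : FaceFlag P n) : ℝ :=
  MeasureTheory.volume.real
    (convexHull ℝ (insert (0 : EuclideanSpace ℝ (Fin n)) (Set.range fun k => Z (𝔽.face k))))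

/-- The volume function `V`: the (finite) sum of the volumes of the simplices over all flags. -/
noncomputable def totalVolume {n : ℕ} {P : Set (EuclideanSpace ℝ (Fin n))}
    (Z : Face P → EuclideanSpace ℝ (Fin n)) : ℝ :=
  ∑ᶠ 𝔽 : FaceFlag P n, simplexVolume Z 𝔽

/-- The sum of the volumes of the simplices over all flags that contain the face `G`. -/
noncomputable def volumeThrough {n : ℕ} {P : Set (EuclideanSpace ℝ (Fin n))} (G : Face P)
    (Z : Face P → EuclideanSpace ℝ (Fin n)) : ℝ :=
  ∑ᶠ 𝔽 : {𝔽 : FaceFlag P n // ∃ k, 𝔽.face k = G}, simplexVolume Z 𝔽.1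

/-- The family `C = (c_F)` of the centroids of the faces. -/
noncomputable def centroids {E : Type*} [NormedAddCommGroup E] [InnerProductSpace ℝ E]
    [MeasurableSpace E] [BorelSpace E] (P : Set E) : Face P → E :=
  fun F => centroid F.1

open scoped Classical in
/-- The family `W = (w_F)` with `w_F = ξ_{dim F + 1} z` if `F` is comparable with `G`, and `w_F = 0`
otherwise. -/
noncomputable def perturbation {E : Type*} [NormedAddCommGroup E] [InnerProductSpace ℝ E]
    {P : Set E} (G : Face P) (ξ : ℕ → ℝ) (z : E) : Face P → E :=
  fun F => if G.1 ⊆ F.1 ∨ F.1 ⊆ G.1 then ξ (setDim F.1 + 1) • z else 0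

end Hanner

/-! For a flag `𝔽` the centroids of its faces form a frame, and |C_𝔽| is a constant times the
absolute value of the determinant of that frame. Two facts suffice. First, the frames of any two
flags differ by a matrix of determinant ±1 (`Unimodular`), so all simplices have the same volume.
Second, each z in A_G - A_G is `Balanced`: if z = ∑ x_k(𝔽) c_{F^k} for every flag `𝔽` through G,
these coefficients satisfy ∑_𝔽 x_k(𝔽) = 0 for each k.

Adding ξ_{k+1} z to the k-th row multiplies the determinant by 1 + ∑ ξ_{k+1} x_k(𝔽) (rank-one
update). For small ξ this factor is nonnegative, and by balance its sum over the flags through G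
does not depend on ξ; this is part (1). For part (2), the derivative of |det(1 + tX)| at t = 0 is
the trace of X. Grouping the diagonal entries of all the flags by the face at position k gives
balanced sums, so the total is zero.

Both facts are proved by induction on the representation (`centroidsBalanced`). With the empty face
added, the faces of an ℓ₁-sum form a product order, and (dim F + 1) c_F is additive on it
(`centroid_lOneSum`). With H itself added, the faces of an ℓ_∞-sum form a product order, and c_F is
additive (`centroid_add`). A flag of the sum is therefore a pair of flags and a shuffle, and the
increments of the additive vector along it are the shuffled increments of the two factors. Passing
from centroids to increments is one matrix, the same for all flags (`SameFrames`), and preserves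
both facts. Interleaving preserves them as well (`Unimodular.interleave`, `Balanced.interleave`).

Two further sources of balanced vectors remain. Every vector of span H_i is balanced over all flags
of H_i, by the symmetry F ↦ -F (`balanced_univ_of_unimodular`); this gives the span terms of
ℓ₁-sums. The extra direction of ℓ_∞-sums comes from averaging over shuffles
(`sum_shuffle_tailWeight`, `RankedProduct.balanced_of_lt`). -/

namespace Hanner
open MeasureTheory Measure Module Set

/-! ### Centroids as averages with respect to Haar measure on the direction space. -/

section Measure

set_option linter.unusedSectionVars false

variable {E : Type*} [NormedAddCommGroup E] [InnerProductSpace ℝ E] [FiniteDimensional ℝ E]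
  [MeasurableSpace E] [BorelSpace E]
variable {V : Type*} [NormedAddCommGroup V] [NormedSpace ℝ V] [FiniteDimensional ℝ V]
  [MeasurableSpace V] [BorelSpace V]

theorem isClosedEmbedding_affine (f : V →L[ℝ] E) (hf : Function.Injective f) (p : E) :
    Topology.IsClosedEmbedding (fun x => p + f x) :=
  (Homeomorph.addLeft p).isClosedEmbedding.comp
    (LinearMap.isClosedEmbedding_of_injective (f := (f : V →ₗ[ℝ] E)) (LinearMap.ker_eq_bot.2 hf))

theorem measurableEmbedding_affine (f : V →L[ℝ] E) (hf : Function.Injective f) (p : E) :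
    MeasurableEmbedding (fun x => p + f x) :=
  (isClosedEmbedding_affine f hf p).measurableEmbedding

/-- Finiteness on compact sets follows from the Lipschitz bound, positivity on open sets from the
antilipschitz bound, and invariance from translations of `E` being isometries. Since averages ignore
scalar factors, the centroid can then be computed with any Haar measure on the parameter space. -/
theorem isAddHaarMeasure_comap_hausdorffMeasure (f : V →L[ℝ] E) (hf : Function.Injective f)
    (p : E) : ((μH[(finrank ℝ V : ℝ)] : Measure E).comap (fun x => p + f x)).IsAddHaarMeasure := by
  have hm := measurableEmbedding_affine f hf p
  have hL : LipschitzWith ‖f‖₊ (fun x => p + f x) := by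
    have := (LipschitzWith.const p (α := V)).add f.lipschitz
    simpa using this
  obtain ⟨K, -, hK⟩ := LinearMap.exists_antilipschitzWith (f : V →ₗ[ℝ] E) (LinearMap.ker_eq_bot.2 hf)
  have hA : AntilipschitzWith K (fun x => p + f x) := by
    intro x y
    simpa using hK x y
  have hd : (0 : ℝ) ≤ (finrank ℝ V : ℝ) := Nat.cast_nonneg _
  refine { lt_top_of_isCompact := ?_, map_add_left_eq_self := ?_, open_pos := ?_ }
  · intro S hS
    rw [hm.comap_apply]
    refine (hL.hausdorffMeasure_image_le hd S).trans_lt ?_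
    exact ENNReal.mul_lt_top (by simp) hS.measure_lt_top
  · intro v
    ext S hS
    rw [Measure.map_apply (measurable_const_add v) hS, hm.comap_apply, hm.comap_apply]
    have : (fun x => p + f x) '' S
        = (fun y => f v + y) '' ((fun x => p + f x) '' ((fun x => v + x) ⁻¹' S)) := by
      ext y
      simp only [mem_image, exists_exists_and_eq_and, mem_preimage]
      constructor
      · rintro ⟨x, hx, rfl⟩
        refine ⟨x - v, by simpa using hx, by simp only [map_sub]; abel⟩
      · rintro ⟨x, hx, rfl⟩
        refine ⟨v + x, hx, by simp only [map_add]; abel⟩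
    rw [this]
    exact ((isometry_add_left (f v)).hausdorffMeasure_image (Or.inl hd) _).symm
  · intro U hU hne h0
    rw [hm.comap_apply] at h0
    have h1 := hA.le_hausdorffMeasure_image hd U
    rw [h0, mul_zero] at h1
    exact hU.measure_ne_zero _ hne (le_antisymm h1 bot_le)

theorem setAverage_smul_measure {F : Type*} [NormedAddCommGroup F] [NormedSpace ℝ F]
    (μ : Measure V) (K : Set V) (g : V → F) {c : ENNReal} (h0 : c ≠ 0) (ht : c ≠ ⊤) :
    ⨍ x in K, g x ∂(c • μ) = ⨍ x in K, g x ∂μ := by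
  have hc : c.toReal ≠ 0 := ENNReal.toReal_ne_zero.2 ⟨h0, ht⟩
  rw [setAverage_eq, setAverage_eq, Measure.restrict_smul, integral_smul_measure,
    measureReal_ennreal_smul_apply, smul_smul, mul_inv, mul_assoc, mul_comm _ c.toReal, ← mul_assoc,
    inv_mul_cancel₀ hc, one_mul]

/-- The centroid of a set parametrised by an injective affine map from a space of the same
dimension. -/
theorem centroid_affine_image (f : V →L[ℝ] E) (hf : Function.Injective f) (p : E) (K : Set V)
    (μ : Measure V) [μ.IsAddHaarMeasure]
    (hdim : setDim ((fun x => p + f x) '' K) = finrank ℝ V) :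
    centroid ((fun x => p + f x) '' K) = ⨍ x in K, (p + f x) ∂μ := by
  have hm := measurableEmbedding_affine f hf p
  have hH := isAddHaarMeasure_comap_hausdorffMeasure f hf p
  set ν := (μH[(finrank ℝ V : ℝ)] : Measure E).comap (fun x => p + f x) with hν
  have h1 : centroid ((fun x => p + f x) '' K) = ⨍ x in K, (p + f x) ∂ν := by
    rw [centroid, hdim, setAverage_eq, setAverage_eq]
    have e1 : (μH[(finrank ℝ V : ℝ)] : Measure E).restrict ((fun x => p + f x) '' K)
        = (ν.restrict K).map (fun x => p + f x) := by
      have h2 : ν.map (fun x => p + f x) = μH[(finrank ℝ V : ℝ)].restrict (range fun x => p + f x) :=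
        hm.map_comap _
      have h3 := hm.restrict_map ν ((fun x => p + f x) '' K)
      rw [preimage_image_eq K hm.injective, h2,
        Measure.restrict_restrict_of_subset (image_subset_range _ _)] at h3
      exact h3
    congr 1
    · congr 1
      rw [measureReal_def, measureReal_def, hν, hm.comap_apply]
    · rw [e1, hm.integral_map]
  have hc : ν = ((addHaarScalarFactor ν μ : NNReal) : ENNReal) • μ := isAddLeftInvariant_eq_smul ν μ
  rw [h1, hc, setAverage_smul_measure μ K _ (by
    simpa using (addHaarScalarFactor_pos_of_isAddHaarMeasure ν μ).ne') ENNReal.coe_ne_top]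

theorem setDim_affine_image (f : V →L[ℝ] E) (hf : Function.Injective f) (p : E) (K : Set V) :
    setDim ((fun x => p + f x) '' K) = setDim K := by
  have h : vectorSpan ℝ ((fun x => p + f x) '' K) = (vectorSpan ℝ K).map (f : V →ₗ[ℝ] E) := by
    let φ : V →ᵃ[ℝ] E := ⟨fun x => p + f x, f, fun x v => by simp; abel⟩
    exact (AffineMap.map_vectorSpan φ).symm
  rw [setDim, setDim, h]
  exact (Submodule.equivMapOfInjective (f : V →ₗ[ℝ] E) hf _).finrank_eq.symm

/-- The copy of `A` in its direction space, with `p` as origin. -/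
def translateToDirection (A : Set E) (p : E) : Set (vectorSpan ℝ A) := {x | p + (x : E) ∈ A}

theorem image_translateToDirection {A : Set E} {p : E} (hp : p ∈ A) :
    (fun x => p + (vectorSpan ℝ A).subtypeL x) '' translateToDirection A p = A := by
  ext y
  constructor
  · rintro ⟨x, hx, rfl⟩
    exact hx
  · intro hy
    refine ⟨⟨y - p, vsub_mem_vectorSpan ℝ hy hp⟩, ?_, ?_⟩
    · simpa [translateToDirection] using hy
    · simp

theorem injective_subtypeL (W : Submodule ℝ E) : Function.Injective W.subtypeL :=
  Subtype.val_injective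

theorem isCompact_translateToDirection {A : Set E} (hA : IsCompact A) (p : E) :
    IsCompact (translateToDirection A p) :=
  (isClosedEmbedding_affine _ (injective_subtypeL (vectorSpan ℝ A)) p).isCompact_preimage hA

theorem convex_translateToDirection {A : Set E} (hA : Convex ℝ A) (p : E) :
    Convex ℝ (translateToDirection A p) := by
  have := (hA.translate_preimage_right p).linear_preimage (vectorSpan ℝ A).subtype
  exact this

theorem setDim_translateToDirection {A : Set E} {p : E} (hp : p ∈ A) :
    setDim (translateToDirection A p) = setDim A := by
  have h := setDim_affine_image _ (injective_subtypeL (vectorSpan ℝ A)) p (translateToDirection A p)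
  rw [image_translateToDirection hp] at h
  exact h.symm

/-- A convex set whose affine span is everything has interior points. -/
theorem measure_pos_of_setDim {K : Set V} (hK : Convex ℝ K) (hne : K.Nonempty)
    (hdim : setDim K = finrank ℝ V) (μ : Measure V) [μ.IsAddHaarMeasure] : 0 < μ K := by
  have h1 : vectorSpan ℝ K = ⊤ := Submodule.eq_top_of_finrank_eq hdim
  have h2 := (AffineSubspace.affineSpan_eq_top_iff_vectorSpan_eq_top_of_nonempty ℝ V V hne).2 h1
  exact Measure.measure_pos_of_nonempty_interior _ (hK.interior_nonempty_iff_affineSpan_eq_top.2 h2)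

theorem centroid_eq_average {A : Set E} {p : E} (hp : p ∈ A) (μ : Measure (vectorSpan ℝ A))
    [μ.IsAddHaarMeasure] :
    centroid A = ⨍ x in translateToDirection A p, (p + (x : E)) ∂μ := by
  have h := centroid_affine_image _ (injective_subtypeL (vectorSpan ℝ A)) p
    (translateToDirection A p) μ (by rw [image_translateToDirection hp]; rfl)
  rwa [image_translateToDirection hp] at h

theorem measure_translateToDirection_pos {A : Set E} (hA : Convex ℝ A) {p : E} (hp : p ∈ A)
    (μ : Measure (vectorSpan ℝ A)) [μ.IsAddHaarMeasure] : 0 < μ (translateToDirection A p) :=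
  measure_pos_of_setDim (convex_translateToDirection hA p) ⟨0, by simpa [translateToDirection]⟩
    (setDim_translateToDirection hp) μ

theorem centroid_mem {A : Set E} (hA : Convex ℝ A) (hAc : IsCompact A) (hne : A.Nonempty) :
    centroid A ∈ A := by
  obtain ⟨p, hp⟩ := hne
  let μ : Measure (vectorSpan ℝ A) := Measure.addHaar
  have hK := isCompact_translateToDirection hAc p
  rw [centroid_eq_average hp μ]
  refine hA.set_average_mem hAc.isClosed (measure_translateToDirection_pos hA hp μ).ne'
    hK.measure_lt_top.ne ?_ ?_
  · exact ae_restrict_of_forall_mem hK.measurableSet fun x hx => hx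
  · exact (Continuous.continuousOn (by fun_prop)).integrableOn_compact hK

/-- The first moment of a convex body about its centroid vanishes. -/
theorem setIntegral_translateToDirection_centroid {A : Set E} (hA : Convex ℝ A) (hAc : IsCompact A)
    (hne : A.Nonempty) (μ : Measure (vectorSpan ℝ A)) [μ.IsAddHaarMeasure] :
    ∫ x in translateToDirection A (centroid A), x ∂μ = 0 := by
  have hp := centroid_mem hA hAc hne
  have hK := isCompact_translateToDirection hAc (centroid A)
  have hpos := measure_translateToDirection_pos hA hp μ
  have hreal : μ.real (translateToDirection A (centroid A)) ≠ 0 :=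
    (ENNReal.toReal_pos hpos.ne' hK.measure_lt_top.ne).ne'
  have h := centroid_eq_average hp μ
  have hi : IntegrableOn (fun x : vectorSpan ℝ A => (x : E)) (translateToDirection A (centroid A)) μ :=
    (Continuous.continuousOn (by fun_prop)).integrableOn_compact hK
  have hi' : IntegrableOn (fun x : vectorSpan ℝ A => x) (translateToDirection A (centroid A)) μ :=
    (Continuous.continuousOn (by fun_prop)).integrableOn_compact hK
  rw [setAverage_eq, integral_add (integrableOn_const (C := centroid A)
    hK.measure_lt_top.ne) hi, setIntegral_const,
    smul_add, smul_smul, inv_mul_cancel₀ hreal, one_smul, left_eq_add, smul_eq_zero_iff_right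
    (inv_ne_zero hreal)] at h
  have h2 := (vectorSpan ℝ A).subtypeL.integral_comp_comm hi'
  apply Subtype.val_injective
  simpa using h2.symm.trans h

end Measure
end Hanner

namespace Hanner
open MeasureTheory Measure Module Set

/-! ### Centroids of Minkowski sums and of ℓ₁-sums. -/

section Measure
set_option linter.unusedSectionVars false

variable {E : Type*} [NormedAddCommGroup E] [InnerProductSpace ℝ E] [FiniteDimensional ℝ E]
  [MeasurableSpace E] [BorelSpace E]
variable {V : Type*} [NormedAddCommGroup V] [NormedSpace ℝ V] [FiniteDimensional ℝ V]
  [MeasurableSpace V] [BorelSpace V]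
variable {V' : Type*} [NormedAddCommGroup V'] [NormedSpace ℝ V'] [FiniteDimensional ℝ V']
  [MeasurableSpace V'] [BorelSpace V']

/-- By Fubini each linear term is a multiple of the first moment of one factor, which vanishes; only
the constant `q` survives. -/
theorem setIntegral_prod_of_centered (μ : Measure V) [μ.IsAddHaarMeasure] (ν : Measure V')
    [ν.IsAddHaarMeasure] {P : Set V} {Q : Set V'} (hP : IsCompact P) (hQ : IsCompact Q)
    (hP0 : ∫ x in P, x ∂μ = 0) (hQ0 : ∫ x in Q, x ∂ν = 0) (f : V →L[ℝ] E) (g : V' →L[ℝ] E) (q : E) :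
    ∫ z in P ×ˢ Q, (q + (f z.1 + g z.2)) ∂(μ.prod ν) = (μ.real P * ν.real Q) • q := by
  have hc := hP.prod hQ
  have hf : IntegrableOn (fun z : V × V' => f z.1) (P ×ˢ Q) (μ.prod ν) :=
    (Continuous.continuousOn (by fun_prop)).integrableOn_compact hc
  have hg : IntegrableOn (fun z : V × V' => g z.2) (P ×ˢ Q) (μ.prod ν) :=
    (Continuous.continuousOn (by fun_prop)).integrableOn_compact hc
  have hP1 : IntegrableOn (fun x : V => x) P μ := continuousOn_id.integrableOn_compact hP
  have hQ1 : IntegrableOn (fun x : V' => x) Q ν := continuousOn_id.integrableOn_compact hQ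
  have hfg : IntegrableOn (fun z : V × V' => f z.1 + g z.2) (P ×ˢ Q) (μ.prod ν) := hf.add hg
  rw [integral_add (integrableOn_const (C := q) hc.measure_lt_top.ne) hfg,
    integral_add hf hg, setIntegral_const, ← prod_restrict,
    integral_fun_fst (fun x => f x), integral_fun_snd (fun x => g x),
    f.integral_comp_comm hP1, g.integral_comp_comm hQ1, hP0, hQ0]
  simp [measureReal_prod_prod]

theorem setIntegral_smul_set_of_centered (μ : Measure V) [μ.IsAddHaarMeasure] {P : Set V}
    (hP0 : ∫ x in P, x ∂μ = 0) (s : ℝ) : ∫ x in s • P, x ∂μ = 0 := by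
  rcases eq_or_ne s 0 with rfl | hs
  · rcases P.eq_empty_or_nonempty with rfl | hne
    · simp
    · rw [zero_smul_set hne]
      change ∫ x in ({0} : Set V), x ∂μ = 0
      simp
  · have h := setIntegral_comp_smul μ (fun x : V => x) P hs
    rw [integral_smul, hP0, smul_zero, eq_comm, smul_eq_zero_iff_right] at h
    · exact h
    · exact abs_ne_zero.2 (inv_ne_zero (pow_ne_zero _ hs))

theorem setDim_prod {P : Set V} {Q : Set V'} (hP : P.Nonempty) (hQ : Q.Nonempty)
    (hPd : setDim P = finrank ℝ V) (hQd : setDim Q = finrank ℝ V') :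
    setDim (P ×ˢ Q) = finrank ℝ (V × V') := by
  have h1 : vectorSpan ℝ P = ⊤ := Submodule.eq_top_of_finrank_eq hPd
  have h2 : vectorSpan ℝ Q = ⊤ := Submodule.eq_top_of_finrank_eq hQd
  rw [setDim, vectorSpan_prod_eq hP hQ, h1, h2, Submodule.prod_top, finrank_top]

theorem injective_coprod_subtypeL {W₁ W₂ : Submodule ℝ E} (h : Disjoint W₁ W₂) :
    Function.Injective (W₁.subtypeL.coprod W₂.subtypeL) := by
  refine (injective_iff_map_eq_zero _).2 fun z hz => ?_
  obtain ⟨h1, h2⟩ := Submodule.disjoint_iff_add_eq_zero.1 h z.1.2 z.2.2 (by simpa using hz)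
  exact Prod.ext (Subtype.ext h1) (Subtype.ext h2)

/-- With the centroids as origins, `A + B` is the injective linear image of a product of two centred
bodies, to which `setIntegral_prod_of_centered` applies. -/
theorem centroid_add {A B : Set E} (hA : Convex ℝ A) (hAc : IsCompact A) (hAn : A.Nonempty)
    (hB : Convex ℝ B) (hBc : IsCompact B) (hBn : B.Nonempty)
    (hd : Disjoint (vectorSpan ℝ A) (vectorSpan ℝ B)) :
    centroid (A + B) = centroid A + centroid B := by
  set KA := translateToDirection A (centroid A)
  set KB := translateToDirection B (centroid B)
  have hpA := centroid_mem hA hAc hAn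
  have hpB := centroid_mem hB hBc hBn
  have himA := image_translateToDirection hpA
  have himB := image_translateToDirection hpB
  let μ : Measure (vectorSpan ℝ A) := Measure.addHaar
  let ν : Measure (vectorSpan ℝ B) := Measure.addHaar
  let f := (vectorSpan ℝ A).subtypeL.coprod (vectorSpan ℝ B).subtypeL
  have hf : Function.Injective f := injective_coprod_subtypeL hd
  have him : (fun z => (centroid A + centroid B) + f z) '' (KA ×ˢ KB) = A + B := by
    ext y
    constructor
    · rintro ⟨⟨x, x'⟩, ⟨hx, hx'⟩, rfl⟩
      refine ⟨_, hx, _, hx', ?_⟩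
      simp [f]; abel
    · rintro ⟨a, ha, b, hb, rfl⟩
      rw [← himA] at ha
      rw [← himB] at hb
      obtain ⟨x, hx, rfl⟩ := ha
      obtain ⟨x', hx', rfl⟩ := hb
      refine ⟨(x, x'), ⟨hx, hx'⟩, ?_⟩
      simp [f]; abel
  have hKA := isCompact_translateToDirection hAc (centroid A)
  have hKB := isCompact_translateToDirection hBc (centroid B)
  have hposA := measure_translateToDirection_pos hA hpA μ
  have hposB := measure_translateToDirection_pos hB hpB ν
  have hneA : μ.real KA ≠ 0 := (ENNReal.toReal_pos hposA.ne' hKA.measure_lt_top.ne).ne'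
  have hneB : ν.real KB ≠ 0 := (ENNReal.toReal_pos hposB.ne' hKB.measure_lt_top.ne).ne'
  have hdim : setDim (KA ×ˢ KB) = finrank ℝ (vectorSpan ℝ A × vectorSpan ℝ B) := by
    refine setDim_prod ?_ ?_ (setDim_translateToDirection hpA) (setDim_translateToDirection hpB)
    · exact ⟨0, by simpa [KA, translateToDirection]⟩
    · exact ⟨0, by simpa [KB, translateToDirection]⟩
  have h := centroid_affine_image f hf (centroid A + centroid B) (KA ×ˢ KB) (μ.prod ν)
    (by rw [setDim_affine_image f hf, hdim])
  rw [him] at h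
  rw [h, setAverage_eq]
  have h2 := setIntegral_prod_of_centered μ ν hKA hKB
    (setIntegral_translateToDirection_centroid hA hAc hAn μ)
    (setIntegral_translateToDirection_centroid hB hBc hBn ν)
    (vectorSpan ℝ A).subtypeL (vectorSpan ℝ B).subtypeL (centroid A + centroid B)
  have h3 : ∫ z in KA ×ˢ KB, (centroid A + centroid B + f z) ∂(μ.prod ν)
    = (μ.real KA * ν.real KB) • (centroid A + centroid B) := h2
  rw [h3, measureReal_prod_prod, smul_smul, inv_mul_cancel₀ (mul_ne_zero hneA hneB), one_smul]

theorem integral_pow_mul_pow_pos (i j : ℕ) :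
    0 < ∫ t in (0 : ℝ)..1, (1 - t) ^ i * t ^ j := by
  refine intervalIntegral.intervalIntegral_pos_of_pos_on
    (Continuous.intervalIntegrable (by fun_prop) _ _) (fun t ht => ?_) one_pos
  have h1 : 0 < 1 - t := by linarith [ht.2]
  have h2 : 0 < t := ht.1
  positivity

/-- The function (1 - t)^(i+1) t^(j+1) vanishes at both ends, so its derivative integrates to 0.
Together with `integral_pow_mul_pow_split` this gives the ratios of the Beta integrals needed for
ℓ₁-sums, without their values. -/
theorem integral_pow_succ_mul_pow (i j : ℕ) :
    ((j : ℝ) + 1) * ∫ t in (0 : ℝ)..1, (1 - t) ^ (i + 1) * t ^ j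
      = ((i : ℝ) + 1) * ∫ t in (0 : ℝ)..1, (1 - t) ^ i * t ^ (j + 1) := by
  have hd : ∀ t : ℝ, HasDerivAt (fun t : ℝ => (1 - t) ^ (i + 1) * t ^ (j + 1))
      (((j : ℝ) + 1) * ((1 - t) ^ (i + 1) * t ^ j) - ((i : ℝ) + 1) * ((1 - t) ^ i * t ^ (j + 1)))
      t := by
    intro t
    have h1 := ((hasDerivAt_id t).const_sub 1).pow (i + 1)
    have h2 := (hasDerivAt_id t).pow (j + 1)
    refine (h1.mul h2).congr_deriv ?_
    simp
    ring
  have h := intervalIntegral.integral_eq_sub_of_hasDerivAt (a := 0) (b := 1) (fun t _ => hd t)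
    (Continuous.intervalIntegrable (by fun_prop) _ _)
  rw [intervalIntegral.integral_sub (Continuous.intervalIntegrable (by fun_prop) _ _)
    (Continuous.intervalIntegrable (by fun_prop) _ _), intervalIntegral.integral_const_mul,
    intervalIntegral.integral_const_mul] at h
  simp at h
  linarith

theorem integral_pow_mul_pow_split (i j : ℕ) :
    (∫ t in (0 : ℝ)..1, (1 - t) ^ (i + 1) * t ^ j) + ∫ t in (0 : ℝ)..1, (1 - t) ^ i * t ^ (j + 1)
      = ∫ t in (0 : ℝ)..1, (1 - t) ^ i * t ^ j := by
  rw [← intervalIntegral.integral_add (Continuous.intervalIntegrable (by fun_prop) _ _)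
    (Continuous.intervalIntegrable (by fun_prop) _ _)]
  congr 1
  ext t
  ring

theorem vectorSpan_le_ker {A : Set E} {l : E →L[ℝ] ℝ} {m : ℝ} (hl : ∀ x ∈ A, l x = m) :
    vectorSpan ℝ A ≤ LinearMap.ker (l : E →ₗ[ℝ] ℝ) := by
  rw [vectorSpan_def, Submodule.span_le]
  rintro _ ⟨x, hx, y, hy, rfl⟩
  simp [hl x hx, hl y hy]

theorem vectorSpan_le_span (A : Set E) : vectorSpan ℝ A ≤ Submodule.span ℝ A := by
  rw [vectorSpan_def, Submodule.span_le]
  rintro _ ⟨x, hx, y, hy, rfl⟩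
  exact sub_mem (Submodule.subset_span hx) (Submodule.subset_span hy)

/-- The hyperplane `l = 1` misses the origin, so the span is the direct sum of the direction space
and the line through one point of `A`. -/
theorem finrank_span_eq_setDim_add_one {A : Set E} (hne : A.Nonempty) {l : E →L[ℝ] ℝ}
    (hl : ∀ x ∈ A, l x = 1) : finrank ℝ (Submodule.span ℝ A) = setDim A + 1 := by
  obtain ⟨p, hp⟩ := hne
  have hp0 : p ≠ 0 := by
    rintro rfl
    simpa using hl 0 hp
  have h1 : Submodule.span ℝ A = vectorSpan ℝ A ⊔ Submodule.span ℝ {p} := by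
    refine le_antisymm (Submodule.span_le.2 fun x hx => ?_)
      (sup_le (vectorSpan_le_span A) (Submodule.span_mono (by simpa)))
    have : x = (x - p) + p := by abel
    rw [this]
    exact Submodule.add_mem_sup (vsub_mem_vectorSpan ℝ hx hp) (Submodule.mem_span_singleton_self p)
  have h2 : vectorSpan ℝ A ⊓ Submodule.span ℝ {p} = ⊥ := by
    rw [Submodule.eq_bot_iff]
    rintro x ⟨hx1, hx2⟩
    obtain ⟨t, rfl⟩ := Submodule.mem_span_singleton.1 hx2
    have := vectorSpan_le_ker hl hx1
    simp [hl p hp] at this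
    simp [this]
  have h3 := Submodule.finrank_sup_add_finrank_inf_eq (vectorSpan ℝ A) (Submodule.span ℝ {p})
  rw [h2, finrank_bot, finrank_span_singleton hp0, ← h1] at h3
  exact h3

theorem finrank_sup_of_disjoint {W₁ W₂ : Submodule ℝ E} (h : Disjoint W₁ W₂) :
    finrank ℝ (W₁ ⊔ W₂ : Submodule ℝ E) = finrank ℝ W₁ + finrank ℝ W₂ := by
  have h3 := Submodule.finrank_sup_add_finrank_inf_eq W₁ W₂
  rwa [h.eq_bot, finrank_bot, add_zero] at h3

theorem span_lOneSum (A B : Set E) :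
    Submodule.span ℝ (lOneSum A B) = Submodule.span ℝ A ⊔ Submodule.span ℝ B := by
  rw [lOneSum, ← Submodule.span_union]
  refine le_antisymm (Submodule.span_le.2 ?_) (Submodule.span_mono (subset_convexHull ℝ _))
  exact convexHull_min Submodule.subset_span (Submodule.convex _)

theorem mem_lOneSum_iff {A B : Set E} (hA : Convex ℝ A) (hAn : A.Nonempty)
    (hB : Convex ℝ B) (hBn : B.Nonempty) {x : E} :
    x ∈ lOneSum A B ↔ ∃ a ∈ A, ∃ b ∈ B, ∃ t ∈ Icc (0 : ℝ) 1, (1 - t) • a + t • b = x := by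
  rw [lOneSum, convexHull_union hAn hBn, hA.convexHull_eq, hB.convexHull_eq, mem_convexJoin]
  simp only [segment_eq_image, mem_image]

theorem apply_eq_one_of_mem_lOneSum {A B : Set E} {l : E →L[ℝ] ℝ} (hlA : ∀ x ∈ A, l x = 1)
    (hlB : ∀ x ∈ B, l x = 1) : ∀ x ∈ lOneSum A B, l x = 1 := by
  have hc : Convex ℝ {x | l x = 1} := convex_hyperplane (l : E →ₗ[ℝ] ℝ).isLinear 1
  exact fun x hx => convexHull_min (union_subset hlA hlB) hc hx

theorem setDim_lOneSum {A B : Set E} (hAn : A.Nonempty) (hBn : B.Nonempty)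
    (hd : Disjoint (Submodule.span ℝ A) (Submodule.span ℝ B)) {l : E →L[ℝ] ℝ}
    (hlA : ∀ x ∈ A, l x = 1) (hlB : ∀ x ∈ B, l x = 1) :
    setDim (lOneSum A B) = 1 + (setDim A + setDim B) := by
  have hn : (lOneSum A B).Nonempty := (hAn.mono subset_union_left).convexHull
  have h1 := finrank_span_eq_setDim_add_one hn (apply_eq_one_of_mem_lOneSum hlA hlB)
  rw [span_lOneSum, finrank_sup_of_disjoint hd, finrank_span_eq_setDim_add_one hAn hlA,
    finrank_span_eq_setDim_add_one hBn hlB] at h1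
  omega

theorem setIntegral_eq_integral_sections {G : Type*} [NormedAddCommGroup G] [NormedSpace ℝ G]
    (μ : Measure V) [SigmaFinite μ] {K : Set (ℝ × V)} (hK : MeasurableSet K)
    (hsec : ∀ t ∉ Icc (0 : ℝ) 1, Prod.mk t ⁻¹' K = ∅) {F : ℝ × V → G}
    (hF : IntegrableOn F K ((volume : Measure ℝ).prod μ)) :
    ∫ z in K, F z ∂((volume : Measure ℝ).prod μ)
      = ∫ t in (0 : ℝ)..1, ∫ z in Prod.mk t ⁻¹' K, F (t, z) ∂μ := by
  rw [← integral_indicator hK, integral_prod _ ((integrable_indicator_iff hK).2 hF),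
    intervalIntegral.integral_of_le zero_le_one, ← integral_Icc_eq_integral_Ioc,
    ← integral_indicator measurableSet_Icc]
  congr 1
  ext t
  have e : (fun y => K.indicator F (t, y)) = (Prod.mk t ⁻¹' K).indicator (fun z => F (t, z)) :=
    rfl
  rw [e, integral_indicator (measurable_prodMk_left hK)]
  by_cases ht : t ∈ Icc (0 : ℝ) 1
  · rw [indicator_of_mem ht]
  · rw [indicator_of_notMem ht, hsec t ht, setIntegral_empty]

/-- Slice the join at height t. The slice is a product of the copies of `A` and `B` scaled by 1 - t
and t, so its volume is proportional to (1 - t)^i t^j, with i, j the dimensions of `A`, `B`, and its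
centroid is (1 - t) c_A + t c_B. Integrating over t weights c_A and c_B by Beta integrals in the
ratio (i + 1) : (j + 1). -/
theorem centroid_lOneSum {A B : Set E} (hA : Convex ℝ A) (hAc : IsCompact A) (hAn : A.Nonempty)
    (hB : Convex ℝ B) (hBc : IsCompact B) (hBn : B.Nonempty)
    (hd : Disjoint (Submodule.span ℝ A) (Submodule.span ℝ B)) {l : E →L[ℝ] ℝ}
    (hlA : ∀ x ∈ A, l x = 1) (hlB : ∀ x ∈ B, l x = 1) :
    ((setDim A : ℝ) + setDim B + 2) • centroid (lOneSum A B)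
      = ((setDim A : ℝ) + 1) • centroid A + ((setDim B : ℝ) + 1) • centroid B := by
  set KA := translateToDirection A (centroid A)
  set KB := translateToDirection B (centroid B)
  have hpA := centroid_mem hA hAc hAn
  have hpB := centroid_mem hB hBc hBn
  have himA := image_translateToDirection hpA
  have himB := image_translateToDirection hpB
  let μ : Measure (vectorSpan ℝ A) := Measure.addHaar
  let ν : Measure (vectorSpan ℝ B) := Measure.addHaar
  have hdv : Disjoint (vectorSpan ℝ A) (vectorSpan ℝ B) :=
    hd.mono (vectorSpan_le_span A) (vectorSpan_le_span B)
  let g := (vectorSpan ℝ A).subtypeL.coprod (vectorSpan ℝ B).subtypeL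
  have hg : Function.Injective g := injective_coprod_subtypeL hdv
  let d := centroid B - centroid A
  let f : ℝ × (vectorSpan ℝ A × vectorSpan ℝ B) →L[ℝ] E :=
    (ContinuousLinearMap.toSpanSingleton ℝ d).coprod g
  have hfa : ∀ (t : ℝ) (x : vectorSpan ℝ A) (y : vectorSpan ℝ B),
      f (t, x, y) = t • (centroid B - centroid A) + ((x : E) + (y : E)) := fun t x y => rfl
  have hf : Function.Injective f := by
    refine (injective_iff_map_eq_zero _).2 ?_
    rintro ⟨t, x, y⟩ hz
    rw [hfa] at hz
    -- Regroup into a vector of `span A` and a vector of `span B`; both must vanish. Since `l` is 0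
    -- on directions and 1 on the centroid, this forces t = 0.
    have h1 : ((x : E) - t • centroid A) + ((y : E) + t • centroid B) = 0 := by
      rw [← hz, smul_sub]; abel
    have hxs := vectorSpan_le_span A x.2
    have hys := vectorSpan_le_span B y.2
    obtain ⟨h2, h3⟩ := Submodule.disjoint_iff_add_eq_zero.1 hd
      (sub_mem hxs (Submodule.smul_mem _ t (Submodule.subset_span hpA)))
      (add_mem hys (Submodule.smul_mem _ t (Submodule.subset_span hpB))) h1
    have ht : t = 0 := by
      have h4 : l x = 0 := vectorSpan_le_ker hlA x.2
      have h5 := congrArg l h2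
      simpa [h4, hlA _ hpA] using h5
    subst ht
    simp at h2 h3
    simp [h2, h3]
  -- `K` is the join in the coordinates (height, direction of `A`, direction of `B`); its section at
  -- height t is (1 - t) KA × t KB.
  let K : Set (ℝ × (vectorSpan ℝ A × vectorSpan ℝ B)) :=
    (fun p : ℝ × (vectorSpan ℝ A × vectorSpan ℝ B) => (p.1, (1 - p.1) • p.2.1, p.1 • p.2.2)) ''
      (Icc (0 : ℝ) 1 ×ˢ (KA ×ˢ KB))
  have hKA := isCompact_translateToDirection hAc (centroid A)
  have hKB := isCompact_translateToDirection hBc (centroid B)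
  have hK : IsCompact K := (isCompact_Icc.prod (hKA.prod hKB)).image (by fun_prop)
  have him : (fun z => centroid A + f z) '' K = lOneSum A B := by
    ext y
    rw [mem_lOneSum_iff hA hAn hB hBn]
    constructor
    · rintro ⟨_, ⟨⟨t, x, x'⟩, ⟨ht, hx, hx'⟩, rfl⟩, rfl⟩
      refine ⟨_, hx, _, hx', t, ht, ?_⟩
      simp only [hfa, Submodule.coe_smul]
      module
    · rintro ⟨a, ha, b, hb, t, ht, rfl⟩
      rw [← himA] at ha
      rw [← himB] at hb
      obtain ⟨x, hx, rfl⟩ := ha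
      obtain ⟨x', hx', rfl⟩ := hb
      refine ⟨_, ⟨(t, x, x'), ⟨ht, hx, hx'⟩, rfl⟩, ?_⟩
      simp only [hfa, Submodule.coe_smul, Submodule.subtypeL_apply]
      module
  have hposA := measure_translateToDirection_pos hA hpA μ
  have hposB := measure_translateToDirection_pos hB hpB ν
  have hneA : 0 < μ.real KA := ENNReal.toReal_pos hposA.ne' hKA.measure_lt_top.ne
  have hneB : 0 < ν.real KB := ENNReal.toReal_pos hposB.ne' hKB.measure_lt_top.ne
  have := prod.instIsAddHaarMeasure μ ν
  have := prod.instIsAddHaarMeasure (volume : Measure ℝ) (μ.prod ν)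
  have h := centroid_affine_image f hf (centroid A) K ((volume : Measure ℝ).prod (μ.prod ν))
    (by
      rw [him, setDim_lOneSum hAn hBn hd hlA hlB, finrank_prod, finrank_prod, finrank_self]
      rfl)
  rw [him] at h
  have hsec : ∀ t ∈ Icc (0 : ℝ) 1, Prod.mk t ⁻¹' K = ((1 - t) • KA) ×ˢ (t • KB) := by
    intro t ht
    ext ⟨x, y⟩
    constructor
    · rintro ⟨⟨s, u, v⟩, ⟨-, hu, hv⟩, he⟩
      simp only [Prod.mk.injEq] at he
      obtain ⟨rfl, rfl, rfl⟩ := he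
      exact ⟨smul_mem_smul_set hu, smul_mem_smul_set hv⟩
    · rintro ⟨⟨u, hu, rfl⟩, ⟨v, hv, rfl⟩⟩
      exact ⟨(t, u, v), ⟨ht, hu, hv⟩, rfl⟩
  have hsec' : ∀ t ∉ Icc (0 : ℝ) 1, Prod.mk t ⁻¹' K = ∅ := by
    intro t ht
    rw [eq_empty_iff_forall_notMem]
    rintro ⟨x, y⟩ ⟨⟨s, u, v⟩, ⟨hs, -, -⟩, he⟩
    simp only [Prod.mk.injEq] at he
    exact ht (he.1 ▸ hs)
  set α := μ.real KA
  set β := ν.real KB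
  have e1 : ∀ t ∈ Icc (0 : ℝ) 1, μ.real ((1 - t) • KA) = (1 - t) ^ setDim A * α := by
    intro t ht
    rw [measureReal_def, addHaar_smul_of_nonneg μ (by linarith [ht.2]), ENNReal.toReal_mul,
      ENNReal.toReal_ofReal (pow_nonneg (by linarith [ht.2]) _)]
    rfl
  have e2 : ∀ t ∈ Icc (0 : ℝ) 1, ν.real (t • KB) = t ^ setDim B * β := by
    intro t ht
    rw [measureReal_def, addHaar_smul_of_nonneg ν ht.1, ENNReal.toReal_mul,
      ENNReal.toReal_ofReal (pow_nonneg ht.1 _)]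
    rfl
  have hinner : ∀ t ∈ Icc (0 : ℝ) 1,
      ∫ z in Prod.mk t ⁻¹' K, (centroid A + f (t, z)) ∂(μ.prod ν)
        = ((1 - t) ^ setDim A * t ^ setDim B * (α * β)) • (centroid A + t • d) := by
    intro t ht
    rw [hsec t ht]
    have h2 := setIntegral_prod_of_centered μ ν (hKA.smul (1 - t)) (hKB.smul t)
      (setIntegral_smul_set_of_centered μ (setIntegral_translateToDirection_centroid hA hAc hAn μ) _)
      (setIntegral_smul_set_of_centered ν (setIntegral_translateToDirection_centroid hB hBc hBn ν) _)
      (vectorSpan ℝ A).subtypeL (vectorSpan ℝ B).subtypeL (centroid A + t • d)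
    have e3 : ∀ z : vectorSpan ℝ A × vectorSpan ℝ B, centroid A + f (t, z)
        = centroid A + t • d + ((vectorSpan ℝ A).subtypeL z.1 + (vectorSpan ℝ B).subtypeL z.2) := by
      intro z
      rw [hfa, add_assoc]; rfl
    refine (integral_congr_ae (ae_of_all _ e3)).trans (h2.trans ?_)
    rw [e1 t ht, e2 t ht]
    congr 1
    ring
  have hint : IntegrableOn (fun z => centroid A + f z) K ((volume : Measure ℝ).prod (μ.prod ν)) :=
    (Continuous.continuousOn (by fun_prop)).integrableOn_compact hK
  have hint1 : IntegrableOn (fun _ => (1 : ℝ)) K ((volume : Measure ℝ).prod (μ.prod ν)) :=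
    integrableOn_const hK.measure_lt_top.ne
  set i := setDim A
  set j := setDim B
  have hN := setIntegral_eq_integral_sections (μ.prod ν) hK.measurableSet hsec' hint
  have hM := setIntegral_eq_integral_sections (μ.prod ν) hK.measurableSet hsec' hint1
  have hN' : ∫ z in K, (centroid A + f z) ∂((volume : Measure ℝ).prod (μ.prod ν))
      = (α * β) • ((∫ t in (0 : ℝ)..1, (1 - t) ^ (i + 1) * t ^ j) • centroid A
        + (∫ t in (0 : ℝ)..1, (1 - t) ^ i * t ^ (j + 1)) • centroid B) := by
    rw [hN, ← intervalIntegral.integral_smul_const, ← intervalIntegral.integral_smul_const,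
      ← intervalIntegral.integral_add (Continuous.intervalIntegrable (by fun_prop) _ _)
      (Continuous.intervalIntegrable (by fun_prop) _ _), ← intervalIntegral.integral_smul]
    refine intervalIntegral.integral_congr fun t ht => ?_
    rw [uIcc_of_le zero_le_one] at ht
    refine (hinner t ht).trans ?_
    simp only [d]
    module
  have hM' : ((volume : Measure ℝ).prod (μ.prod ν)).real K
      = (α * β) * ∫ t in (0 : ℝ)..1, (1 - t) ^ i * t ^ j := by
    rw [setIntegral_const, smul_eq_mul, mul_one] at hM
    rw [hM, ← intervalIntegral.integral_const_mul]
    refine intervalIntegral.integral_congr fun t ht => ?_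
    rw [uIcc_of_le zero_le_one] at ht
    simp only [setIntegral_const, smul_eq_mul, mul_one]
    rw [hsec t ht, measureReal_prod_prod, e1 t ht, e2 t ht]
    ring
  rw [h, setAverage_eq, hN', hM']
  have hpos := integral_pow_mul_pow_pos i j
  have hs1 := integral_pow_succ_mul_pow i j
  have hs2 := integral_pow_mul_pow_split i j
  set P := ∫ t in (0 : ℝ)..1, (1 - t) ^ (i + 1) * t ^ j
  set Q := ∫ t in (0 : ℝ)..1, (1 - t) ^ i * t ^ (j + 1)
  set T := ∫ t in (0 : ℝ)..1, (1 - t) ^ i * t ^ j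
  have hαβ : α * β ≠ 0 := (mul_pos hneA hneB).ne'
  have hij : (0 : ℝ) < (i : ℝ) + j + 2 := by positivity
  have hP : P = (i + 1) / (i + j + 2) * T := by
    field_simp
    rw [← hs2]
    linarith
  have hQ : Q = (j + 1) / (i + j + 2) * T := by
    field_simp
    rw [← hs2]
    linarith
  rw [hP, hQ]
  simp only [smul_add, smul_smul]
  congr 2 <;> field_simp

theorem centroid_singleton (x : E) : centroid ({x} : Set E) = x :=
  centroid_mem (convex_singleton x) isCompact_singleton (singleton_nonempty x)

theorem image_neg_translateToDirection {A : Set E} {p : E} (hp : p ∈ A) :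
    (fun x => -p + (-(vectorSpan ℝ A).subtypeL) x) '' translateToDirection A p = -A := by
  rw [← image_neg_eq_neg, ← congrArg (fun s => Neg.neg '' s) (image_translateToDirection hp),
    image_image]
  refine image_congr fun x _ => ?_
  simp [add_comm]

theorem centroid_neg {A : Set E} (hne : A.Nonempty) : centroid (-A) = -centroid A := by
  obtain ⟨p, hp⟩ := hne
  have hinj : Function.Injective (-(vectorSpan ℝ A).subtypeL) :=
    neg_injective.comp (injective_subtypeL (vectorSpan ℝ A))
  let μ : Measure (vectorSpan ℝ A) := Measure.addHaar
  have h := centroid_affine_image _ hinj (-p) (translateToDirection A p) μ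
    (by rw [setDim_affine_image _ hinj, setDim_translateToDirection hp]; rfl)
  rw [image_neg_translateToDirection hp] at h
  rw [h, centroid_eq_average hp μ, setAverage_eq, setAverage_eq, ← smul_neg, ← integral_neg]
  congr 2
  ext x
  simp [add_comm]

theorem setDim_neg {A : Set E} : setDim (-A) = setDim A := by
  have hinj : Function.Injective (-(ContinuousLinearMap.id ℝ E)) := neg_injective
  have h := setDim_affine_image _ hinj 0 A
  simpa using h

end Measure
end Hanner

namespace Hanner

/-! ### Balanced vectors and unimodular families of frames. -/

section Frames

variable {E : Type*} [AddCommGroup E] [Module ℝ E] {ι : Type*} {n : ℕ}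

/-- The vector `z` has coefficients in the frames `w c`, `c ∈ I`, whose sum over `c ∈ I`
vanishes. -/
def Balanced (w : ι → Fin n → E) (I : Set ι) (z : E) : Prop :=
  ∃ x : ι → Fin n → ℝ, (∀ c ∈ I, ∑ k, x c k • w c k = z) ∧ (∀ c ∉ I, x c = 0) ∧
    ∀ k, ∑ᶠ c, x c k = 0

/-- The frames `w c` all span `V`, and the transition matrices between them have
determinant `±1`. -/
structure Unimodular (w : ι → Fin n → E) (V : Submodule ℝ E) : Prop where
  span_eq : ∀ c, Submodule.span ℝ (Set.range (w c)) = V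
  transition : ∀ c c', ∃ M : Matrix (Fin n) (Fin n) ℝ, |M.det| = 1 ∧
    ∀ k, w c' k = ∑ l, M k l • w c l

theorem Balanced.zero (w : ι → Fin n → E) (I : Set ι) : Balanced w I 0 :=
  ⟨0, by simp, by simp, by simp⟩

theorem Balanced.add [Finite ι] {w : ι → Fin n → E} {I : Set ι} {y z : E} (hy : Balanced w I y)
    (hz : Balanced w I z) : Balanced w I (y + z) := by
  obtain ⟨a, ha, ha', ha0⟩ := hy
  obtain ⟨b, hb, hb', hb0⟩ := hz
  refine ⟨a + b, fun c hc => ?_, fun c hc => ?_, fun k => ?_⟩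
  · simp [add_smul, Finset.sum_add_distrib, ha c hc, hb c hc]
  · simp [ha' c hc, hb' c hc]
  · simp only [Pi.add_apply]
    rw [finsum_add_distrib (Set.toFinite _) (Set.toFinite _), ha0, hb0, add_zero]

theorem Balanced.smul {w : ι → Fin n → E} {I : Set ι} {z : E} (hz : Balanced w I z)
    (r : ℝ) : Balanced w I (r • z) := by
  obtain ⟨b, hb, hb', hb0⟩ := hz
  refine ⟨r • b, fun c hc => ?_, fun c hc => ?_, fun k => ?_⟩
  · simp [mul_smul, ← Finset.smul_sum, hb c hc]
  · simp [hb' c hc]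
  · simp only [Pi.smul_apply]
    rw [← smul_finsum, hb0, smul_zero]

theorem sum_matrix_mul_smul (A B : Matrix (Fin n) (Fin n) ℝ) (v : Fin n → E) (k : Fin n) :
    ∑ l, A k l • ∑ m, B l m • v m = ∑ m, (A * B) k m • v m := by
  simp only [Matrix.mul_apply, Finset.smul_sum, Finset.sum_smul, smul_smul]
  exact Finset.sum_comm

/-- The new coefficients are x c · B with the same `B` for every c, so their sums over c are linear
images of the old vanishing sums. -/
theorem Balanced.transfer [Finite ι] {w w' : ι → Fin n → E} (B : Matrix (Fin n) (Fin n) ℝ)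
    (hB : ∀ c k, w c k = ∑ l, B k l • w' c l) {I : Set ι} {z : E} (h : Balanced w I z) :
    Balanced w' I z := by
  cases nonempty_fintype ι
  obtain ⟨x, hx, hx', hx0⟩ := h
  refine ⟨fun c l => ∑ k, x c k * B k l, fun c hc => ?_, fun c hc => ?_, fun l => ?_⟩
  · rw [← hx c hc]
    simp only [hB, Finset.smul_sum, Finset.sum_smul, smul_smul]
    exact Finset.sum_comm
  · ext l
    simp [hx' c hc]
  · simp only [finsum_eq_sum_of_fintype] at hx0 ⊢
    rw [Finset.sum_comm]
    simp [← Finset.sum_mul, hx0]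

/-- A transition matrix M becomes A M B, and det A · det B = 1. -/
theorem Unimodular.transfer {w w' : ι → Fin n → E} {V : Submodule ℝ E}
    (A B : Matrix (Fin n) (Fin n) ℝ) (hdet : A.det * B.det = 1)
    (hA : ∀ c k, w' c k = ∑ l, A k l • w c l)
    (hB : ∀ c k, w c k = ∑ l, B k l • w' c l) (h : Unimodular w V) : Unimodular w' V := by
  refine ⟨fun c => ?_, fun c c' => ?_⟩
  · rw [← h.span_eq c]
    refine le_antisymm (Submodule.span_le.2 ?_) (Submodule.span_le.2 ?_)
    · rintro _ ⟨k, rfl⟩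
      rw [hA]
      exact Submodule.sum_mem _ fun l _ => Submodule.smul_mem _ _ (Submodule.subset_span ⟨l, rfl⟩)
    · rintro _ ⟨k, rfl⟩
      rw [hB]
      exact Submodule.sum_mem _ fun l _ => Submodule.smul_mem _ _ (Submodule.subset_span ⟨l, rfl⟩)
  · obtain ⟨M, hM, hw⟩ := h.transition c c'
    refine ⟨A * M * B, ?_, fun k => ?_⟩
    · rw [Matrix.det_mul, Matrix.det_mul, mul_right_comm, hdet, one_mul, hM]
    · rw [hA, ← sum_matrix_mul_smul]
      simp only [← hB, hw]
      rw [sum_matrix_mul_smul]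

theorem Balanced.reindex {κ : Type*} (e : κ ≃ ι) {w : ι → Fin n → E} {I : Set ι} {z : E}
    (h : Balanced w I z) : Balanced (fun c => w (e c)) (e ⁻¹' I) z := by
  obtain ⟨x, hx, hx', hx0⟩ := h
  refine ⟨fun c => x (e c), fun c hc => hx _ hc, fun c hc => hx' _ hc, fun k => ?_⟩
  rw [← hx0 k]
  exact finsum_comp_equiv e (f := fun c => x c k)

theorem Unimodular.reindex {κ : Type*} (e : κ → ι) {w : ι → Fin n → E} {V : Submodule ℝ E}
    (h : Unimodular w V) : Unimodular (fun c => w (e c)) V :=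
  ⟨fun _ => h.span_eq _, fun _ _ => h.transition _ _⟩

/-! ### Interleaving two families of frames. -/

section Prod

variable {ι₁ ι₂ J : Type*} {n₁ n₂ : ℕ} {w₁ : ι₁ → Fin n₁ → E} {w₂ : ι₂ → Fin n₂ → E}
  (τ : J → (Fin n ≃ Fin n₁ ⊕ Fin n₂))

/-- The frames obtained by interleaving two families of frames. -/
def interleave (w₁ : ι₁ → Fin n₁ → E) (w₂ : ι₂ → Fin n₂ → E) (c : ι₁ × ι₂ × J) (k : Fin n) : E :=
  Sum.elim (w₁ c.1) (w₂ c.2.1) (τ c.2.2 k)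

/-- The transition matrix is block diagonal up to a permutation of the rows and another one of the
columns. These may change the sign of the determinant, hence the absolute value in `Unimodular`. -/
theorem Unimodular.interleave {V₁ V₂ : Submodule ℝ E} (h₁ : Unimodular w₁ V₁)
    (h₂ : Unimodular w₂ V₂) : Unimodular (interleave τ w₁ w₂) (V₁ ⊔ V₂) := by
  refine ⟨fun c => ?_, fun c c' => ?_⟩
  · have : Set.range (Hanner.interleave τ w₁ w₂ c) = Set.range (w₁ c.1) ∪ Set.range (w₂ c.2.1) := by
      rw [← Set.Sum.elim_range]
      exact (τ c.2.2).surjective.range_comp _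
    rw [this, Submodule.span_union, h₁.span_eq, h₂.span_eq]
  · obtain ⟨M₁, hM₁, hw₁⟩ := h₁.transition c.1 c'.1
    obtain ⟨M₂, hM₂, hw₂⟩ := h₂.transition c.2.1 c'.2.1
    refine ⟨(Matrix.fromBlocks M₁ 0 0 M₂).submatrix (τ c'.2.2) (τ c.2.2), ?_, fun k => ?_⟩
    · rw [Matrix.abs_det_submatrix_equiv_equiv, Matrix.det_fromBlocks_zero₂₁, abs_mul, hM₁, hM₂,
        one_mul]
    · simp only [Hanner.interleave, Matrix.submatrix_apply]
      rw [(τ c.2.2).sum_comp (fun s => Matrix.fromBlocks M₁ 0 0 M₂ (τ c'.2.2 k) s •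
        Sum.elim (w₁ c.1) (w₂ c.2.1) s), Fintype.sum_sum_type]
      rcases τ c'.2.2 k with i | i <;> simp [hw₁, hw₂]

-- For a fixed element of `T`, slot k always carries the same slot i of the same family. Summing
-- over the index of that family gives zero, whatever the index of the other family.
open scoped Classical in
theorem Balanced.interleave [Finite ι₁] [Finite ι₂] [Finite J] {I₁ : Set ι₁} {I₂ : Set ι₂}
    (T : Set J) {z₁ z₂ : E} (h₁ : Balanced w₁ I₁ z₁) (h₂ : Balanced w₂ I₂ z₂) :
    Balanced (interleave τ w₁ w₂) {c | c.1 ∈ I₁ ∧ c.2.1 ∈ I₂ ∧ c.2.2 ∈ T} (z₁ + z₂) := by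
  cases nonempty_fintype ι₁
  cases nonempty_fintype ι₂
  cases nonempty_fintype J
  obtain ⟨x, hx, hx', hx0⟩ := h₁
  obtain ⟨y, hy, hy', hy0⟩ := h₂
  simp only [finsum_eq_sum_of_fintype] at hx0 hy0
  refine ⟨fun c k => if c.1 ∈ I₁ ∧ c.2.1 ∈ I₂ ∧ c.2.2 ∈ T then
    Sum.elim (x c.1) (y c.2.1) (τ c.2.2 k) else 0, fun c hc => ?_, fun c hc => ?_, fun k => ?_⟩
  · have hc' : c.1 ∈ I₁ ∧ c.2.1 ∈ I₂ ∧ c.2.2 ∈ T := hc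
    simp only [if_pos hc', Hanner.interleave]
    rw [(τ c.2.2).sum_comp (fun s => Sum.elim (x c.1) (y c.2.1) s •
        Sum.elim (w₁ c.1) (w₂ c.2.1) s), Fintype.sum_sum_type]
    simp [hx _ hc'.1, hy _ hc'.2.1]
  · ext k
    exact if_neg hc
  · rw [finsum_eq_sum_of_fintype]
    simp only [Fintype.sum_prod_type]
    -- The sum over `J` is moved outermost, so that the source of slot k is fixed in the inner sums.
    rw [Finset.sum_congr rfl fun a _ => Finset.sum_comm, Finset.sum_comm]
    refine Finset.sum_eq_zero fun S _ => ?_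
    by_cases hS : S ∈ T
    · rcases hk : τ S k with i | i
      · rw [Finset.sum_comm]
        refine Finset.sum_eq_zero fun b _ => ?_
        by_cases hb : b ∈ I₂
        · rw [← hx0 i]
          refine Finset.sum_congr rfl fun a _ => ?_
          by_cases ha : a ∈ I₁ <;> simp [*]
        · simp [hb]
      · refine Finset.sum_eq_zero fun a _ => ?_
        by_cases ha : a ∈ I₁
        · rw [← hy0 i]
          refine Finset.sum_congr rfl fun b _ => ?_
          by_cases hb : b ∈ I₂ <;> simp [*]
        · simp [ha]
    · simp [hS]

end Prod

end Frames
end Hanner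

namespace Hanner

/-! ### Shuffles and the averaging of tail weights over them. -/

section Shuffles

/-- A shuffle of `n₁` steps of the first kind and `n₂` steps of the second kind, given by the
positions of the steps of the first kind. -/
abbrev Shuffle (n₁ n₂ : ℕ) : Type :=
  {S : Finset ℕ // S ⊆ Finset.range (n₁ + n₂) ∧ S.card = n₁}

variable {n₁ n₂ : ℕ}

instance : Finite (Shuffle n₁ n₂) :=
  Set.Finite.to_subtype (Set.Finite.subset (Finset.finite_toSet (Finset.range (n₁ + n₂)).powerset)
    fun _ hS => Finset.mem_coe.2 (Finset.mem_powerset.2 hS.1))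

/-- The number of steps of the first kind among the first `k` ones. -/
def Shuffle.fst (S : Shuffle n₁ n₂) (k : ℕ) : ℕ := Nat.count (· ∈ S.1) k

/-- The number of steps of the second kind among the first `k` ones. -/
def Shuffle.snd (S : Shuffle n₁ n₂) (k : ℕ) : ℕ := Nat.count (· ∉ S.1) k

theorem Shuffle.fst_add_snd (S : Shuffle n₁ n₂) (k : ℕ) : S.fst k + S.snd k = k := by
  induction k with
  | zero => simp [Shuffle.fst, Shuffle.snd]
  | succ k ih =>
    simp only [Shuffle.fst, Shuffle.snd, Nat.count_succ] at ih ⊢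
    by_cases h : k ∈ S.1 <;> simp [h] <;> omega

theorem Shuffle.fst_succ_of_mem {S : Shuffle n₁ n₂} {k : ℕ} (h : k ∈ S.1) :
    S.fst (k + 1) = S.fst k + 1 := by
  simp [Shuffle.fst, Nat.count_succ, h]

theorem Shuffle.fst_succ_of_notMem {S : Shuffle n₁ n₂} {k : ℕ} (h : k ∉ S.1) :
    S.fst (k + 1) = S.fst k := by
  simp [Shuffle.fst, Nat.count_succ, h]

theorem Shuffle.snd_succ_of_mem {S : Shuffle n₁ n₂} {k : ℕ} (h : k ∈ S.1) :
    S.snd (k + 1) = S.snd k := by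
  simp [Shuffle.snd, Nat.count_succ, h]

theorem Shuffle.snd_succ_of_notMem {S : Shuffle n₁ n₂} {k : ℕ} (h : k ∉ S.1) :
    S.snd (k + 1) = S.snd k + 1 := by
  simp [Shuffle.snd, Nat.count_succ, h]

theorem Shuffle.fst_eq_of_le (S : Shuffle n₁ n₂) {k : ℕ} (hk : n₁ + n₂ ≤ k) : S.fst k = n₁ := by
  rw [Shuffle.fst, Nat.count_eq_card_filter_range]
  conv_rhs => rw [← S.2.2]
  congr 1
  ext i
  simp only [Finset.mem_filter, Finset.mem_range, and_iff_right_iff_imp]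
  intro hi
  have := Finset.mem_range.1 (S.2.1 hi)
  omega

theorem Shuffle.fst_mono (S : Shuffle n₁ n₂) : Monotone S.fst := Nat.count_monotone _

theorem Shuffle.snd_mono (S : Shuffle n₁ n₂) : Monotone S.snd := Nat.count_monotone _

theorem Shuffle.fst_le (S : Shuffle n₁ n₂) (k : ℕ) : S.fst k ≤ n₁ := by
  rcases le_total (n₁ + n₂) k with h | h
  · exact (S.fst_eq_of_le h).le
  · exact (S.fst_mono h).trans (S.fst_eq_of_le le_rfl).le

theorem Shuffle.snd_eq (S : Shuffle n₁ n₂) : S.snd (n₁ + n₂) = n₂ := by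
  have h1 := S.fst_add_snd (n₁ + n₂)
  have h2 := S.fst_eq_of_le le_rfl
  omega

/-- The bound on `k` matters: positions from n₁ + n₂ on do not belong to `S.1`, so `Shuffle.snd`
counts them as steps of the second kind. -/
theorem Shuffle.snd_le (S : Shuffle n₁ n₂) {k : ℕ} (hk : k ≤ n₁ + n₂) : S.snd k ≤ n₂ :=
  (S.snd_mono hk).trans S.snd_eq.le

theorem Shuffle.fst_lt {S : Shuffle n₁ n₂} {k : ℕ} (h : k ∈ S.1) : S.fst k < n₁ := by
  have := S.fst_le (k + 1)
  rw [Shuffle.fst_succ_of_mem h] at this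
  omega

theorem Shuffle.snd_lt {S : Shuffle n₁ n₂} {k : ℕ} (hk : k < n₁ + n₂) (h : k ∉ S.1) :
    S.snd k < n₂ := by
  have := S.snd_le (k := k + 1) hk
  rw [Shuffle.snd_succ_of_notMem h] at this
  omega

/-- The step `k` of the shuffle, as a step of one of the two sequences. -/
def Shuffle.step (S : Shuffle n₁ n₂) (k : Fin (n₁ + n₂)) : Fin n₁ ⊕ Fin n₂ :=
  if h : (k : ℕ) ∈ S.1 then .inl ⟨S.fst k, Shuffle.fst_lt h⟩
  else .inr ⟨S.snd k, Shuffle.snd_lt k.2 h⟩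

theorem Shuffle.step_injective (S : Shuffle n₁ n₂) : Function.Injective S.step := by
  intro k l hkl
  by_cases hk : (k : ℕ) ∈ S.1 <;> by_cases hl : (l : ℕ) ∈ S.1 <;>
    simp only [Shuffle.step, hk, hl, dif_pos, dif_neg, not_false_eq_true, Sum.inl.injEq,
      Sum.inr.injEq, Fin.mk.injEq, reduceCtorEq] at hkl
  · exact Fin.ext (Nat.count_injective (p := (· ∈ S.1)) hk hl hkl)
  · exact Fin.ext (Nat.count_injective (p := (· ∉ S.1)) hk hl hkl)

/-- `Shuffle.step` as an equivalence. -/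
noncomputable def Shuffle.equiv (S : Shuffle n₁ n₂) : Fin (n₁ + n₂) ≃ Fin n₁ ⊕ Fin n₂ :=
  Equiv.ofBijective S.step
    ((Fintype.bijective_iff_injective_and_card _).2 ⟨S.step_injective, by simp⟩)

theorem Shuffle.equiv_apply (S : Shuffle n₁ n₂) (k : Fin (n₁ + n₂)) : S.equiv k = S.step k := rfl

theorem Shuffle.ext_fst {S T : Shuffle n₁ n₂} (h : ∀ k ≤ n₁ + n₂, S.fst k = T.fst k) : S = T := by
  refine Subtype.ext (Finset.ext fun k => ?_)
  by_cases hk : k < n₁ + n₂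
  · have h1 := h k hk.le
    have h2 := h (k + 1) hk
    by_cases hS : k ∈ S.1 <;> by_cases hT : k ∈ T.1
    · simp [hS, hT]
    · rw [Shuffle.fst_succ_of_mem hS, Shuffle.fst_succ_of_notMem hT] at h2
      omega
    · rw [Shuffle.fst_succ_of_notMem hS, Shuffle.fst_succ_of_mem hT] at h2
      omega
    · simp [hS, hT]
  · constructor <;> intro h'
    · exact absurd (Finset.mem_range.1 (S.2.1 h')) hk
    · exact absurd (Finset.mem_range.1 (T.2.1 h')) hk

/-- The shuffle is the set of positions at which `a` increases. -/
theorem Shuffle.exists_fst_eq (a : ℕ → ℕ) (h0 : a 0 = 0)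
    (hs : ∀ k, a (k + 1) = a k ∨ a (k + 1) = a k + 1) (hn : ∀ k, n₁ + n₂ ≤ k → a k = n₁) :
    ∃ S : Shuffle n₁ n₂, ∀ k, S.fst k = a k := by
  let S : Finset ℕ := (Finset.range (n₁ + n₂)).filter fun k => a (k + 1) = a k + 1
  have hS : ∀ k, Nat.count (· ∈ S) k = a k := by
    intro k
    induction k with
    | zero => simp [h0]
    | succ k ih =>
      rw [Nat.count_succ, ih]
      by_cases hk : k < n₁ + n₂
      · rcases hs k with h | h <;> simp [S, hk, h]
      · simp [S, hk, hn k (by omega), hn (k + 1) (by omega)]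
  refine ⟨⟨S, Finset.filter_subset _ _, ?_⟩, hS⟩
  have h := hS (n₁ + n₂)
  rw [hn _ le_rfl, Nat.count_eq_card_filter_range] at h
  rw [← h]
  congr 1
  ext i
  simp only [S, Finset.mem_filter, Finset.mem_range]
  tauto

/-- Interchanging two steps of a shuffle. -/
def Shuffle.swap (S : Shuffle n₁ n₂) (k l : Fin (n₁ + n₂)) : Shuffle n₁ n₂ :=
  ⟨S.1.map (Equiv.swap (k : ℕ) l).toEmbedding, fun i hi => by
    rw [Finset.mem_map_equiv, Equiv.symm_swap] at hi
    have h := Finset.mem_range.1 (S.2.1 hi)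
    rw [Equiv.swap_apply_def] at h
    rw [Finset.mem_range]
    split_ifs at h <;> omega, by rw [Finset.card_map, S.2.2]⟩

theorem Shuffle.mem_swap {S : Shuffle n₁ n₂} {k l : Fin (n₁ + n₂)} {i : ℕ} :
    i ∈ (S.swap k l).1 ↔ Equiv.swap (k : ℕ) l i ∈ S.1 := by
  rw [Shuffle.swap, Finset.mem_map_equiv, Equiv.symm_swap]

theorem Shuffle.swap_swap (S : Shuffle n₁ n₂) (k l : Fin (n₁ + n₂)) : (S.swap k l).swap k l = S :=
  Subtype.ext (Finset.ext fun i => by simp [Shuffle.mem_swap])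

theorem Shuffle.fst_swap (S : Shuffle n₁ n₂) {k l : Fin (n₁ + n₂)} {m : ℕ} (hk : m ≤ k)
    (hl : m ≤ l) : (S.swap k l).fst m = S.fst m := by
  rw [Shuffle.fst, Shuffle.fst, Nat.count_eq_card_filter_range, Nat.count_eq_card_filter_range]
  refine congrArg _ (Finset.filter_congr fun i hi => ?_)
  have hi := Finset.mem_range.1 hi
  rw [Shuffle.mem_swap, Equiv.swap_apply_of_ne_of_ne (by omega) (by omega)]

/-- Weights on the steps of a shuffle: `0` up to position `i` of the first and position `j` of the
second sequence, then constants. -/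
def tailWeight (i j : ℕ) (a b : ℝ) : Fin n₁ ⊕ Fin n₂ → ℝ :=
  Sum.elim (fun k => if (k : ℕ) < i then 0 else a) (fun k => if (k : ℕ) < j then 0 else b)

/-- The hypothesis says that the first i + j steps are exactly the first i and the first j steps of
the two sequences. The weight thus depends only on the position of a step relative to i + j and on
its kind. -/
theorem Shuffle.tailWeight_step {S : Shuffle n₁ n₂} {i j : ℕ} (hS : S.fst (i + j) = i) (a b : ℝ)
    (k : Fin (n₁ + n₂)) : tailWeight i j a b (S.equiv k)
      = if (k : ℕ) < i + j then 0 else if (k : ℕ) ∈ S.1 then a else b := by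
  have hS' : S.snd (i + j) = j := by have := S.fst_add_snd (i + j); omega
  rw [Shuffle.equiv_apply, Shuffle.step]
  by_cases hk : (k : ℕ) < i + j
  · by_cases h : (k : ℕ) ∈ S.1
    · have h1 := S.fst_mono (Nat.succ_le_of_lt hk)
      rw [Nat.succ_eq_add_one, Shuffle.fst_succ_of_mem h] at h1
      simp [tailWeight, h, hk]
      omega
    · have h1 := S.snd_mono (Nat.succ_le_of_lt hk)
      rw [Nat.succ_eq_add_one, Shuffle.snd_succ_of_notMem h] at h1
      simp [tailWeight, h, hk]
      omega
  · by_cases h : (k : ℕ) ∈ S.1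
    · have h1 := S.fst_mono (not_lt.1 hk)
      simp [tailWeight, h, hk]
      omega
    · have h1 := S.snd_mono (not_lt.1 hk)
      simp [tailWeight, h, hk]
      omega

theorem sum_fin_ite_lt {n i : ℕ} (hi : i ≤ n) (a : ℝ) :
    ∑ k : Fin n, (if (k : ℕ) < i then 0 else a) = ((n : ℝ) - i) * a := by
  rw [Fin.sum_univ_eq_sum_range (fun k => if k < i then 0 else a), Finset.sum_ite,
    Finset.sum_const_zero, zero_add, Finset.sum_const, nsmul_eq_mul]
  congr 1
  rw [← Nat.cast_sub hi]
  congr 1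
  have : (Finset.range n).filter (fun x => ¬ x < i) = Finset.Ico i n := by
    ext x; simp; omega
  rw [this, Nat.card_Ico]

-- Interchanging two positions from i + j on permutes the shuffles considered, so the sums at all
-- these positions agree. The weights of a single shuffle add up to (n₁ - i)/(n₁ - i) - (n₂ - j)/(n₂
-- - j) = 0, hence the common value is zero. At earlier positions all weights are zero.
open scoped Classical in
theorem sum_shuffle_tailWeight [Fintype (Shuffle n₁ n₂)] {i j : ℕ} (hi : i < n₁) (hj : j < n₂)
    (k : Fin (n₁ + n₂)) :
    ∑ S : Shuffle n₁ n₂, (if S.fst (i + j) = i then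
      tailWeight i j (((n₁ : ℝ) - i)⁻¹) (-((n₂ : ℝ) - j)⁻¹) (S.equiv k) else 0) = 0 := by
  set a := ((n₁ : ℝ) - i)⁻¹
  set b := -((n₂ : ℝ) - j)⁻¹
  let y : Fin (n₁ + n₂) → ℝ := fun k => ∑ S : Shuffle n₁ n₂, (if S.fst (i + j) = i then
      tailWeight i j a b (S.equiv k) else 0)
  have hy0 : ∀ k : Fin (n₁ + n₂), (k : ℕ) < i + j → y k = 0 := by
    intro k hk
    refine Finset.sum_eq_zero fun S _ => ?_
    split_ifs with hS
    · rw [Shuffle.tailWeight_step hS, if_pos hk]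
    · rfl
  have hyc : ∀ k l : Fin (n₁ + n₂), i + j ≤ k → i + j ≤ l → y k = y l := by
    intro k l hk hl
    refine Finset.sum_bij' (fun S _ => S.swap k l) (fun S _ => S.swap k l) (by simp) (by simp)
      (fun S _ => S.swap_swap k l) (fun S _ => S.swap_swap k l) fun S _ => ?_
    rw [S.fst_swap hk hl]
    by_cases hS : S.fst (i + j) = i
    · have hS' : (S.swap k l).fst (i + j) = i := by rw [S.fst_swap hk hl, hS]
      rw [if_pos hS, if_pos hS, Shuffle.tailWeight_step hS, Shuffle.tailWeight_step hS',
        if_neg (not_lt.2 hk), if_neg (not_lt.2 hl)]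
      simp [Shuffle.mem_swap]
    · rw [if_neg hS, if_neg hS]
  have hsum : ∑ k, y k = 0 := by
    simp only [y]
    rw [Finset.sum_comm]
    refine Finset.sum_eq_zero fun S _ => ?_
    by_cases hS : S.fst (i + j) = i
    · simp only [if_pos hS]
      rw [S.equiv.sum_comp (fun s => tailWeight i j a b s), Fintype.sum_sum_type]
      simp only [tailWeight, Sum.elim_inl, Sum.elim_inr]
      rw [sum_fin_ite_lt hi.le, sum_fin_ite_lt hj.le]
      have h1 : (n₁ : ℝ) - i ≠ 0 := sub_ne_zero.2 (by exact_mod_cast hi.ne')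
      have h2 : (n₂ : ℝ) - j ≠ 0 := sub_ne_zero.2 (by exact_mod_cast hj.ne')
      simp only [a, b]
      field_simp
      ring
    · simp [if_neg hS]
  change y k = 0
  by_cases hk : (k : ℕ) < i + j
  · exact hy0 k hk
  · have h1 : ∀ l : Fin (n₁ + n₂), y l = if (l : ℕ) < i + j then 0 else y k := by
      intro l
      split_ifs with hl
      · exact hy0 l hl
      · exact hyc l k (not_lt.1 hl) (not_lt.1 hk)
    rw [Finset.sum_congr rfl fun l _ => h1 l, sum_fin_ite_lt (by omega)] at hsum
    refine (mul_eq_zero.1 hsum).resolve_left (sub_ne_zero.2 ?_)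
    exact_mod_cast (by omega : n₁ + n₂ ≠ i + j)

end Shuffles

/-! ### Maximal chains in a product of ranked orders are pairs of chains with a shuffle. -/

section Chains

variable {P P₁ P₂ : Type*} [PartialOrder P] [PartialOrder P₁] [PartialOrder P₂]

/-- Chains with one element of each rank `0, …, n`, continued by a constant. -/
abbrev RankedChain (r : P → ℕ) (n : ℕ) : Type _ :=
  {c : ℕ → P // Monotone c ∧ ∀ k, r (c k) = min k n}

theorem eq_of_rank_eq {r : P → ℕ} (hr : StrictMono r) {c : ℕ → P} (hc : Monotone c) {k l : ℕ}
    (h : r (c k) = r (c l)) : c k = c l := by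
  rcases le_total k l with hkl | hkl
  · exact (hc hkl).eq_of_not_lt fun hlt => (hr hlt).ne h
  · exact ((hc hkl).eq_of_not_lt fun hlt => (hr hlt).ne h.symm).symm

theorem exists_eq_of_step {a : ℕ → ℕ} (h0 : a 0 = 0) (hs : ∀ k, a (k + 1) ≤ a k + 1) {N i : ℕ}
    (hi : i ≤ a N) : ∃ k, a k = i := by
  induction N with
  | zero => exact ⟨0, by omega⟩
  | succ N ih =>
    by_cases h : i ≤ a N
    · exact ih h
    · exact ⟨N + 1, by have := hs N; omega⟩

/-- The projection of a chain to one factor stalls while the other factor moves; this removes the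
repetitions. Ranks start at 0 and grow by at most 1, so no rank is skipped. -/
theorem exists_rankedChain {r : P → ℕ} (hr : StrictMono r) {n N : ℕ} {x : ℕ → P} (hx : Monotone x)
    (h0 : r (x 0) = 0) (hs : ∀ k, r (x (k + 1)) ≤ r (x k) + 1) (hN : r (x N) = n) : ∃ X : RankedChain r n, ∀ k i, min i n = r (x k) → X.1 i = x k := by
  have hex : ∀ i, ∃ k, r (x k) = min i n := fun i =>
    exists_eq_of_step (a := fun k => r (x k)) h0 hs (N := N) (by simp [hN])
  choose f hf using hex
  refine ⟨⟨fun i => x (f i), fun i j hij => ?_, hf⟩, fun k i hi =>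
    eq_of_rank_eq hr hx (by rw [hf, hi])⟩
  rcases le_total (f i) (f j) with h | h
  · exact hx h
  · refine (eq_of_rank_eq hr hx (le_antisymm ?_ (hr.monotone (hx h)))).le
    rw [hf, hf]
    exact min_le_min_right _ hij

variable {r : P → ℕ} {r₁ : P₁ → ℕ} {r₂ : P₂ → ℕ} {n₁ n₂ : ℕ}

/-- The chain in a product of ranked orders given by two chains and a shuffle. -/
def mergeChains (e : P ≃o P₁ × P₂) (he : ∀ p, r p = r₁ (e p).1 + r₂ (e p).2)
    (c : RankedChain r₁ n₁ × RankedChain r₂ n₂ × Shuffle n₁ n₂) : RankedChain r (n₁ + n₂) :=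
  ⟨fun k => e.symm (c.1.1 (c.2.2.fst k), c.2.1.1 (c.2.2.snd k)), fun k l hkl =>
    e.symm.monotone ⟨c.1.2.1 (c.2.2.fst_mono hkl), c.2.1.2.1 (c.2.2.snd_mono hkl)⟩, fun k => by
    rw [he, e.apply_symm_apply, c.1.2.2, c.2.1.2.2]
    have h1 := c.2.2.fst_add_snd k
    have h2 := c.2.2.fst_le k
    rcases le_total k (n₁ + n₂) with h | h
    · have h3 := c.2.2.snd_le h
      omega
    · have h3 := c.2.2.fst_eq_of_le h
      omega⟩

/-- The ranks of the first coordinates determine the shuffle. Every rank of either factor is then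
attained at some position, which recovers both chains. -/
theorem mergeChains_injective (hr₁ : StrictMono r₁) (hr₂ : StrictMono r₂) (e : P ≃o P₁ × P₂)
    (he : ∀ p, r p = r₁ (e p).1 + r₂ (e p).2) :
    Function.Injective (mergeChains (n₁ := n₁) (n₂ := n₂) e he) := by
  rintro ⟨X, Y, S⟩ ⟨X', Y', S'⟩ h
  have h1 : ∀ k, (X.1 (S.fst k), Y.1 (S.snd k)) = (X'.1 (S'.fst k), Y'.1 (S'.snd k)) := fun k =>
    e.symm.injective (congrFun (congrArg Subtype.val h) k)
  have hS : S = S' := by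
    refine Shuffle.ext_fst fun k _ => ?_
    have := congrArg (fun p => r₁ p.1) (h1 k)
    simp only [X.2.2, X'.2.2] at this
    rwa [min_eq_left (S.fst_le k), min_eq_left (S'.fst_le k)] at this
  subst hS
  have hX : X = X' := by
    refine Subtype.ext (funext fun i => ?_)
    obtain ⟨k, hk⟩ := exists_eq_of_step (a := S.fst) (by simp [Shuffle.fst])
      (fun k => by by_cases h : k ∈ S.1 <;> simp [Shuffle.fst_succ_of_mem, Shuffle.fst_succ_of_notMem, h])
      (N := n₁ + n₂) (i := min i n₁) (by rw [S.fst_eq_of_le le_rfl]; exact min_le_right _ _)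
    have e1 := (Prod.ext_iff.1 (h1 k)).1
    simp only [hk] at e1
    rw [eq_of_rank_eq hr₁ X.2.1 (k := i) (l := min i n₁) (by rw [X.2.2, X.2.2]; simp),
      eq_of_rank_eq hr₁ X'.2.1 (k := i) (l := min i n₁) (by rw [X'.2.2, X'.2.2]; simp), e1]
  have hY : Y = Y' := by
    refine Subtype.ext (funext fun i => ?_)
    obtain ⟨k, hk⟩ := exists_eq_of_step (a := S.snd) (by simp [Shuffle.snd])
      (fun k => by by_cases h : k ∈ S.1 <;> simp [Shuffle.snd_succ_of_mem, Shuffle.snd_succ_of_notMem, h])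
      (N := n₁ + n₂) (i := min i n₂) (by rw [S.snd_eq]; exact min_le_right _ _)
    have e1 := (Prod.ext_iff.1 (h1 k)).2
    simp only [hk] at e1
    rw [eq_of_rank_eq hr₂ Y.2.1 (k := i) (l := min i n₂) (by rw [Y.2.2, Y.2.2]; simp),
      eq_of_rank_eq hr₂ Y'.2.1 (k := i) (l := min i n₂) (by rw [Y'.2.2, Y'.2.2]; simp), e1]
  rw [hX, hY]

/-- Below the top, each step raises the total rank by one, hence exactly one of the two ranks. The
shuffle records which one, and the projections without repetitions are the two chains. -/
theorem mergeChains_surjective (hr₁ : StrictMono r₁) (hr₂ : StrictMono r₂) (e : P ≃o P₁ × P₂)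
    (he : ∀ p, r p = r₁ (e p).1 + r₂ (e p).2) (hn₁ : ∀ p, r₁ p ≤ n₁) (hn₂ : ∀ p, r₂ p ≤ n₂) :
    Function.Surjective (mergeChains (n₁ := n₁) (n₂ := n₂) e he) := by
  intro c
  have hx : Monotone fun k => (e (c.1 k)).1 := fun k l h => (e.monotone (c.2.1 h)).1
  have hy : Monotone fun k => (e (c.1 k)).2 := fun k l h => (e.monotone (c.2.1 h)).2
  have hsum : ∀ k, r₁ (e (c.1 k)).1 + r₂ (e (c.1 k)).2 = min k (n₁ + n₂) := fun k => by
    rw [← he, c.2.2]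
  have ha : ∀ k, r₁ (e (c.1 k)).1 ≤ r₁ (e (c.1 (k + 1))).1 := fun k =>
    hr₁.monotone (hx k.le_succ)
  have hb : ∀ k, r₂ (e (c.1 k)).2 ≤ r₂ (e (c.1 (k + 1))).2 := fun k =>
    hr₂.monotone (hy k.le_succ)
  -- The total rank is n₁ + n₂ and each rank is bounded by its own n_i, so both bounds are attained.
  have htop : ∀ k, n₁ + n₂ ≤ k → r₁ (e (c.1 k)).1 = n₁ ∧ r₂ (e (c.1 k)).2 = n₂ := by
    intro k hk
    have h1 := hsum k
    have h2 := hn₁ (e (c.1 k)).1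
    have h3 := hn₂ (e (c.1 k)).2
    omega
  obtain ⟨X, hX⟩ := exists_rankedChain hr₁ hx (n := n₁) (N := n₁ + n₂)
    (by have := hsum 0; omega)
    (fun k => by have := hsum k; have := hsum (k + 1); have := hb k; omega)
    (htop _ le_rfl).1
  obtain ⟨Y, hY⟩ := exists_rankedChain hr₂ hy (n := n₂) (N := n₁ + n₂)
    (by have := hsum 0; omega)
    (fun k => by have := hsum k; have := hsum (k + 1); have := ha k; omega)
    (htop _ le_rfl).2
  obtain ⟨S, hS⟩ := Shuffle.exists_fst_eq (n₁ := n₁) (n₂ := n₂) (fun k => r₁ (e (c.1 k)).1)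
    (by have := hsum 0; omega)
    (fun k => by have := hsum k; have := hsum (k + 1); have := hb k; have := ha k; omega)
    (fun k hk => (htop k hk).1)
  refine ⟨(X, Y, S), Subtype.ext (funext fun k => ?_)⟩
  refine (e.symm_apply_eq).2 (Prod.ext ?_ ?_)
  · exact hX k _ (by rw [hS]; exact min_eq_left (hn₁ _))
  · refine hY k _ ?_
    have h1 := S.fst_add_snd k
    have h2 := hsum k
    have h3 := hn₂ (e (c.1 k)).2
    have h4 := hn₁ (e (c.1 k)).1
    have h5 := hS k
    simp only at h5 ⊢
    omega

/-- Chains in a product of ranked orders are given by pairs of chains and shuffles. -/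
noncomputable def mergeEquiv (hr₁ : StrictMono r₁) (hr₂ : StrictMono r₂) (e : P ≃o P₁ × P₂)
    (he : ∀ p, r p = r₁ (e p).1 + r₂ (e p).2) (hn₁ : ∀ p, r₁ p ≤ n₁) (hn₂ : ∀ p, r₂ p ≤ n₂) :
    RankedChain r₁ n₁ × RankedChain r₂ n₂ × Shuffle n₁ n₂ ≃ RankedChain r (n₁ + n₂) :=
  Equiv.ofBijective (mergeChains e he)
    ⟨mergeChains_injective hr₁ hr₂ e he, mergeChains_surjective hr₁ hr₂ e he hn₁ hn₂⟩

/-! ### Frames of increments along chains, and their behaviour under products. -/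

section Frame

variable {E : Type*} [AddCommGroup E] {v : P → E} {v₁ : P₁ → E} {v₂ : P₂ → E} {n : ℕ}

/-- The increments of a vector valued function along a chain. -/
def chainFrame (v : P → E) (c : RankedChain r n) (k : Fin n) : E := v (c.1 (k + 1)) - v (c.1 k)

/-- The chains that contain a given element. -/
def through (g : P) : Set (RankedChain r n) := {c | c.1 (r g) = g}

/-- Each step moves only one coordinate, and `v` is additive, so its increment is an increment in
one factor. -/
theorem chainFrame_mergeChains (e : P ≃o P₁ × P₂) (he : ∀ p, r p = r₁ (e p).1 + r₂ (e p).2)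
    (hv : ∀ p, v p = v₁ (e p).1 + v₂ (e p).2)
    (c : RankedChain r₁ n₁ × RankedChain r₂ n₂ × Shuffle n₁ n₂) :
    chainFrame v (mergeChains e he c)
      = interleave Shuffle.equiv (chainFrame v₁) (chainFrame v₂) c := by
  ext k
  have h : ∀ k, v ((mergeChains e he c).1 k)
      = v₁ (c.1.1 (c.2.2.fst k)) + v₂ (c.2.1.1 (c.2.2.snd k)) := fun k => by
    rw [hv]; simp [mergeChains]
  rw [chainFrame, interleave, h, h, Shuffle.equiv_apply, Shuffle.step]
  by_cases hk : (k : ℕ) ∈ c.2.2.1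
  · simp [hk, Shuffle.fst_succ_of_mem, Shuffle.snd_succ_of_mem, chainFrame]
  · simp [hk, Shuffle.fst_succ_of_notMem, Shuffle.snd_succ_of_notMem, chainFrame]

/-- A chain can meet `g` only at position r g, where the shuffle must have made r₁ steps in the
first factor. The resulting index set has the product form required by `Balanced.interleave`. -/
theorem mergeChains_mem_through (e : P ≃o P₁ × P₂) (he : ∀ p, r p = r₁ (e p).1 + r₂ (e p).2)
    (c : RankedChain r₁ n₁ × RankedChain r₂ n₂ × Shuffle n₁ n₂) (g : P) :
    mergeChains e he c ∈ through g ↔ c.1 ∈ through (e g).1 ∧ c.2.1 ∈ through (e g).2 ∧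
      c.2.2 ∈ {S : Shuffle n₁ n₂ | S.fst (r g) = r₁ (e g).1} := by
  have h1 : mergeChains e he c ∈ through g ↔
      c.1.1 (c.2.2.fst (r g)) = (e g).1 ∧ c.2.1.1 (c.2.2.snd (r g)) = (e g).2 := by
    change e.symm _ = g ↔ _
    rw [e.symm_apply_eq, Prod.ext_iff]
  have h2 := c.2.2.fst_add_snd (r g)
  have h3 := he g
  rw [h1]
  constructor
  · rintro ⟨ha, hb⟩
    have h4 : c.2.2.fst (r g) = r₁ (e g).1 := by
      rw [← ha, c.1.2.2, min_eq_left (c.2.2.fst_le _)]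
    have h5 : c.2.2.snd (r g) = r₂ (e g).2 := by omega
    rw [h4] at ha
    rw [h5] at hb
    exact ⟨ha, hb, h4⟩
  · rintro ⟨ha, hb, h4⟩
    have h4 : c.2.2.fst (r g) = r₁ (e g).1 := h4
    have h5 : c.2.2.snd (r g) = r₂ (e g).2 := by omega
    rw [h4, h5]
    exact ⟨ha, hb⟩

/-- A ranked order with a vector valued function, as a product of two such orders. -/
structure RankedProduct (r : P → ℕ) (v : P → E) (r₁ : P₁ → ℕ) (v₁ : P₁ → E) (n₁ : ℕ)
    (r₂ : P₂ → ℕ) (v₂ : P₂ → E) (n₂ : ℕ) where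
  e : P ≃o P₁ × P₂
  rank_eq : ∀ p, r p = r₁ (e p).1 + r₂ (e p).2
  vector_eq : ∀ p, v p = v₁ (e p).1 + v₂ (e p).2
  strictMono₁ : StrictMono r₁
  strictMono₂ : StrictMono r₂
  rank_le₁ : ∀ p, r₁ p ≤ n₁
  rank_le₂ : ∀ p, r₂ p ≤ n₂

variable (D : RankedProduct r v r₁ v₁ n₁ r₂ v₂ n₂)

/-- Chains in a product are given by pairs of chains and shuffles. -/
noncomputable def RankedProduct.equiv :
    RankedChain r₁ n₁ × RankedChain r₂ n₂ × Shuffle n₁ n₂ ≃ RankedChain r (n₁ + n₂) :=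
  mergeEquiv D.strictMono₁ D.strictMono₂ D.e D.rank_eq D.rank_le₁ D.rank_le₂

theorem RankedProduct.finite (D : RankedProduct r v r₁ v₁ n₁ r₂ v₂ n₂)
    [Finite (RankedChain r₁ n₁)] [Finite (RankedChain r₂ n₂)] :
    Finite (RankedChain r (n₁ + n₂)) :=
  Finite.of_equiv _ D.equiv

theorem RankedProduct.chainFrame_eq (c : RankedChain r (n₁ + n₂)) :
    chainFrame v c = interleave Shuffle.equiv (chainFrame v₁) (chainFrame v₂) (D.equiv.symm c) := by
  have := chainFrame_mergeChains D.e D.rank_eq D.vector_eq (D.equiv.symm c)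
  rw [← this]
  congr 1
  exact (D.equiv.apply_symm_apply c).symm

theorem RankedProduct.through_eq (g : P) : (through g : Set (RankedChain r (n₁ + n₂)))
    = D.equiv.symm ⁻¹' {c | c.1 ∈ through (D.e g).1 ∧ c.2.1 ∈ through (D.e g).2 ∧
      c.2.2 ∈ {S : Shuffle n₁ n₂ | S.fst (r g) = r₁ (D.e g).1}} := by
  ext c
  have := mergeChains_mem_through D.e D.rank_eq (D.equiv.symm c) g
  refine Iff.trans (Eq.to_iff ?_) this
  congr 1
  exact (D.equiv.apply_symm_apply c).symm

variable [Module ℝ E]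

theorem RankedProduct.unimodular (D : RankedProduct r v r₁ v₁ n₁ r₂ v₂ n₂)
    {V₁ V₂ : Submodule ℝ E}
    (h₁ : Unimodular (chainFrame v₁ : RankedChain r₁ n₁ → Fin n₁ → E) V₁)
    (h₂ : Unimodular (chainFrame v₂ : RankedChain r₂ n₂ → Fin n₂ → E) V₂) :
    Unimodular (chainFrame v : RankedChain r (n₁ + n₂) → Fin (n₁ + n₂) → E) (V₁ ⊔ V₂) := by
  have := (h₁.interleave Shuffle.equiv h₂).reindex D.equiv.symm
  simpa only [← D.chainFrame_eq] using this

theorem RankedProduct.balanced [Finite (RankedChain r₁ n₁)] [Finite (RankedChain r₂ n₂)] (g : P)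
    {z₁ z₂ : E}
    (h₁ : Balanced (chainFrame v₁ : RankedChain r₁ n₁ → Fin n₁ → E) (through (D.e g).1) z₁)
    (h₂ : Balanced (chainFrame v₂ : RankedChain r₂ n₂ → Fin n₂ → E) (through (D.e g).2) z₂) :
    Balanced (chainFrame v : RankedChain r (n₁ + n₂) → Fin (n₁ + n₂) → E) (through g)
      (z₁ + z₂) := by
  have := (h₁.interleave Shuffle.equiv {S : Shuffle n₁ n₂ | S.fst (r g) = r₁ (D.e g).1} h₂).reindex
    D.equiv.symm
  rw [← D.through_eq] at this
  simpa only [← D.chainFrame_eq] using this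

/-- The increments from `g` upwards telescope to v(top) - v g, and `v` vanishes at the top. -/
theorem sum_tail_chainFrame {c : RankedChain r n} {g : P} (hc : c ∈ through g) (hg : r g ≤ n)
    (hv : ∀ p, r p = n → v p = 0) (t : ℝ) :
    ∑ k : Fin n, (if (k : ℕ) < r g then 0 else t) • chainFrame v c k = -(t • v g) := by
  -- The `max` freezes the sequence below position r g, so that the truncated sum telescopes over
  -- the full range.
  let u : ℕ → E := fun j => t • v (c.1 (max j (r g)))
  have h1 : ∀ k : Fin n, (if (k : ℕ) < r g then 0 else t) • chainFrame v c k
      = u ((k : ℕ) + 1) - u k := by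
    intro k
    simp only [u, chainFrame]
    split_ifs with hk
    · rw [max_eq_right hk.le, max_eq_right (Nat.succ_le_of_lt hk)]
      simp
    · rw [max_eq_left (by omega), max_eq_left (by omega), smul_sub]
  have hc' : c.1 (r g) = g := hc
  rw [Finset.sum_congr rfl fun k _ => h1 k, Fin.sum_univ_eq_sum_range (fun k => u (k + 1) - u k),
    Finset.sum_range_sub]
  simp only [u, max_eq_left hg, max_eq_right (Nat.zero_le _), hc']
  rw [hv _ (by rw [c.2.2, min_self])]
  simp

-- The coefficients are the tail weights of the shuffle. By `sum_tail_chainFrame` they represent, up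
-- to sign, the stated combination on every chain through `g`. For each fixed pair of chains their
-- sum over the shuffles vanishes by `sum_shuffle_tailWeight`.
open scoped Classical in
theorem RankedProduct.balanced_of_lt [Finite (RankedChain r₁ n₁)] [Finite (RankedChain r₂ n₂)]
    (hv₁ : ∀ p, r₁ p = n₁ → v₁ p = 0) (hv₂ : ∀ p, r₂ p = n₂ → v₂ p = 0) (g : P)
    (hg₁ : r₁ (D.e g).1 < n₁) (hg₂ : r₂ (D.e g).2 < n₂) :
    Balanced (chainFrame v : RankedChain r (n₁ + n₂) → Fin (n₁ + n₂) → E) (through g)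
      (((n₁ : ℝ) - r₁ (D.e g).1)⁻¹ • v₁ (D.e g).1 - ((n₂ : ℝ) - r₂ (D.e g).2)⁻¹ • v₂ (D.e g).2) := by
  cases nonempty_fintype (RankedChain r₁ n₁)
  cases nonempty_fintype (RankedChain r₂ n₂)
  cases nonempty_fintype (Shuffle n₁ n₂)
  set i := r₁ (D.e g).1 with hi
  set j := r₂ (D.e g).2 with hj
  set a := ((n₁ : ℝ) - i)⁻¹ with ha
  set b := -((n₂ : ℝ) - j)⁻¹ with hb
  set I : Set (RankedChain r₁ n₁ × RankedChain r₂ n₂ × Shuffle n₁ n₂) := {c | c.1 ∈ through (D.e g).1 ∧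
    c.2.1 ∈ through (D.e g).2 ∧ c.2.2 ∈ {S : Shuffle n₁ n₂ | S.fst (r g) = i}}
  have hrg : r g = i + j := D.rank_eq g
  have key : Balanced (interleave Shuffle.equiv (chainFrame v₁ : RankedChain r₁ n₁ → Fin n₁ → E)
      (chainFrame v₂ : RankedChain r₂ n₂ → Fin n₂ → E)) I
      (-(a • v₁ (D.e g).1) + -(b • v₂ (D.e g).2)) := by
    refine ⟨fun c k => if c ∈ I then tailWeight i j a b (c.2.2.equiv k) else 0, fun c hc => ?_,
      fun c hc => ?_, fun k => ?_⟩
    · simp only [if_pos hc, interleave]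
      rw [c.2.2.equiv.sum_comp (fun s => tailWeight i j a b s •
        Sum.elim (chainFrame v₁ c.1) (chainFrame v₂ c.2.1) s), Fintype.sum_sum_type]
      simp only [tailWeight, Sum.elim_inl, Sum.elim_inr]
      rw [sum_tail_chainFrame hc.1 hg₁.le hv₁, sum_tail_chainFrame hc.2.1 hg₂.le hv₂]
    · ext k
      exact if_neg hc
    · rw [finsum_eq_sum_of_fintype]
      simp only [Fintype.sum_prod_type]
      refine Finset.sum_eq_zero fun X _ => Finset.sum_eq_zero fun Y _ => ?_
      by_cases h : X ∈ through (D.e g).1 ∧ Y ∈ through (D.e g).2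
      · refine (Finset.sum_congr rfl fun S _ => if_congr ?_ rfl rfl).trans
          (sum_shuffle_tailWeight hg₁ hg₂ k)
        simp [I, h.1, h.2, hrg]
      · refine Finset.sum_eq_zero fun S _ => if_neg fun hS => h ⟨hS.1, hS.2.1⟩
  -- The factor -1 undoes the sign produced by telescoping from `g` to the top.
  have := (key.smul (-1)).reindex D.equiv.symm
  rw [← D.through_eq] at this
  simp only [← D.chainFrame_eq] at this
  convert this using 1
  rw [hb]
  module

end Frame

end Chains
end Hanner

namespace Hanner
open Module Set

/-! ### Symmetric bodies and the face orders of their sums. -/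

section Geometry
set_option linter.unusedSectionVars false

variable {E : Type*} [NormedAddCommGroup E] [InnerProductSpace ℝ E] [FiniteDimensional ℝ E]
  [MeasurableSpace E] [BorelSpace E]

/-- Symmetric compact convex non-empty sets. -/
structure IsSymmBody (H : Set E) : Prop where
  convex : Convex ℝ H
  isCompact : IsCompact H
  nonempty : H.Nonempty
  neg_eq : -H = H

theorem IsSymmBody.neg_mem {H : Set E} (hH : IsSymmBody H) {x : E} (hx : x ∈ H) : -x ∈ H := by
  rw [← hH.neg_eq]
  simpa using hx

theorem IsSymmBody.zero_mem {H : Set E} (hH : IsSymmBody H) : (0 : E) ∈ H := by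
  obtain ⟨x, hx⟩ := hH.nonempty
  have := hH.convex.midpoint_mem hx (hH.neg_mem hx)
  simpa using this

theorem isCompact_lOneSum {A B : Set E} (hA : Convex ℝ A) (hAc : IsCompact A) (hAn : A.Nonempty)
    (hB : Convex ℝ B) (hBc : IsCompact B) (hBn : B.Nonempty) : IsCompact (lOneSum A B) := by
  have : lOneSum A B = (fun p : ℝ × E × E => (1 - p.1) • p.2.1 + p.1 • p.2.2) ''
      (Icc (0 : ℝ) 1 ×ˢ A ×ˢ B) := by
    ext x
    rw [mem_lOneSum_iff hA hAn hB hBn]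
    constructor
    · rintro ⟨a, ha, b, hb, t, ht, rfl⟩
      exact ⟨(t, a, b), ⟨ht, ha, hb⟩, rfl⟩
    · rintro ⟨⟨t, a, b⟩, ⟨ht, ha, hb⟩, rfl⟩
      exact ⟨a, ha, b, hb, t, ht, rfl⟩
  rw [this]
  exact (isCompact_Icc.prod (hAc.prod hBc)).image (by fun_prop)

theorem IsSymmBody.segment (v : E) : IsSymmBody (segment ℝ (-v) v) where
  convex := convex_segment _ _
  isCompact := by
    rw [segment_eq_image]
    exact isCompact_Icc.image (by fun_prop)
  nonempty := ⟨_, left_mem_segment ℝ _ _⟩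
  neg_eq := by
    rw [← convexHull_pair, ← convexHull_neg, neg_insert, neg_singleton, neg_neg, pair_comm]

theorem IsSymmBody.lOneSum {A B : Set E} (hA : IsSymmBody A) (hB : IsSymmBody B) :
    IsSymmBody (lOneSum A B) where
  convex := convex_convexHull ℝ _
  isCompact := isCompact_lOneSum hA.convex hA.isCompact hA.nonempty hB.convex hB.isCompact
    hB.nonempty
  nonempty := (hA.nonempty.mono subset_union_left).convexHull
  neg_eq := by
    rw [Hanner.lOneSum, ← convexHull_neg, union_neg, hA.neg_eq, hB.neg_eq]

theorem IsSymmBody.add {A B : Set E} (hA : IsSymmBody A) (hB : IsSymmBody B) :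
    IsSymmBody (A + B) where
  convex := hA.convex.add hB.convex
  isCompact := hA.isCompact.add hB.isCompact
  nonempty := hA.nonempty.add hB.nonempty
  neg_eq := by rw [neg_add, hA.neg_eq, hB.neg_eq]

theorem HannerRep.isSymmBody {H : Set E} (R : HannerRep H) : IsSymmBody H := by
  induction R with
  | interval v hv => exact IsSymmBody.segment v
  | sumOne R₁ R₂ h ih₁ ih₂ => exact ih₁.lOneSum ih₂
  | sumInf R₁ R₂ h ih₁ ih₂ => exact ih₁.add ih₂

/-- By symmetry, a functional whose maximum on `H` is 0 vanishes on `H` and exposes all of `H`. A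
proper face therefore has a functional with positive maximum, which can be normalised to 1. -/
theorem isFace_iff {H F : Set E} (hH : IsSymmBody H) :
    IsFace H F ↔ F.Nonempty ∧ ∃ l : E →L[ℝ] ℝ, (∀ x ∈ H, l x ≤ 1) ∧ F = {x ∈ H | l x = 1} := by
  constructor
  · rintro ⟨hex, hne, hF⟩
    refine ⟨hne, ?_⟩
    obtain ⟨l, hl⟩ := hex hne
    obtain ⟨p, hp⟩ := hne
    have hp' : p ∈ H ∧ ∀ y ∈ H, l y ≤ l p := by rw [hl] at hp; exact hp
    have hpos : 0 < l p := by
      have h0 : 0 ≤ l p := by simpa using hp'.2 0 hH.zero_mem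
      refine lt_of_le_of_ne h0 fun h => hF ?_
      have h1 : ∀ x ∈ H, l x = 0 := fun x hx => by
        have h2 := hp'.2 x hx
        have h3 := hp'.2 _ (hH.neg_mem hx)
        rw [map_neg] at h3
        linarith
      rw [hl]
      ext x
      simp only [mem_ofPred_eq, and_iff_left_iff_imp]
      intro hx y hy
      rw [h1 x hx, h1 y hy]
    refine ⟨(l p)⁻¹ • l, fun x hx => ?_, ?_⟩
    · rw [_root_.smul_apply, smul_eq_mul, inv_mul_le_iff₀ hpos, mul_one]
      exact hp'.2 x hx
    · rw [hl]
      ext x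
      simp only [mem_ofPred_eq, _root_.smul_apply, smul_eq_mul, and_congr_right_iff]
      intro hx
      rw [inv_mul_eq_one₀ hpos.ne']
      exact ⟨fun h => le_antisymm (h p hp'.1) (hp'.2 x hx), fun h y hy => h ▸ hp'.2 y hy⟩
  · rintro ⟨hne, l, hl, rfl⟩
    refine ⟨fun _ => ⟨l, ?_⟩, hne, fun h => ?_⟩
    · obtain ⟨p, hp, hp1⟩ := hne
      ext x
      simp only [mem_ofPred_eq, and_congr_right_iff]
      exact fun hx => ⟨fun h y hy => h ▸ hl y hy, fun h => le_antisymm (hl x hx) (hp1 ▸ h p hp)⟩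
    · have := hH.zero_mem
      rw [← h] at this
      simpa using this.2

/-- The proper faces of `H` and the empty set. -/
abbrev LoFace (H : Set E) : Type _ :=
  {F : Set E // ∃ l : E →L[ℝ] ℝ, (∀ x ∈ H, l x ≤ 1) ∧ F = {x ∈ H | l x = 1}}

/-- The proper faces of `H` and `H` itself. -/
abbrev UpFace (H : Set E) : Type _ :=
  {F : Set E // ∃ l : E →L[ℝ] ℝ, F = {x ∈ H | ∀ y ∈ H, l y ≤ l x}}

/-- This lets supporting functionals be prescribed independently on the two summands. -/
theorem exists_functional {V₁ V₂ : Submodule ℝ E} (h : Disjoint V₁ V₂) (l₁ l₂ : E →L[ℝ] ℝ) :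
    ∃ l : E →L[ℝ] ℝ, (∀ x ∈ V₁, l x = l₁ x) ∧ ∀ x ∈ V₂, l x = l₂ x := by
  let f : V₁ × V₂ →ₗ[ℝ] E := (V₁.subtypeL.coprod V₂.subtypeL : V₁ × V₂ →L[ℝ] E)
  obtain ⟨g, hg⟩ := f.exists_leftInverse_of_injective
    (LinearMap.ker_eq_bot.2 (injective_coprod_subtypeL h))
  let l : E →ₗ[ℝ] ℝ :=
    (((l₁ : E →ₗ[ℝ] ℝ) ∘ₗ V₁.subtype).coprod ((l₂ : E →ₗ[ℝ] ℝ) ∘ₗ V₂.subtype)) ∘ₗ g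
  have hgf : ∀ z, g (f z) = z := fun z => LinearMap.congr_fun hg z
  refine ⟨LinearMap.toContinuousLinearMap l, fun x hx => ?_, fun x hx => ?_⟩
  · have h1 : f (⟨x, hx⟩, 0) = x := by simp [f]
    have h2 := hgf (⟨x, hx⟩, 0)
    rw [h1] at h2
    simp [l, h2]
  · have h1 : f (0, ⟨x, hx⟩) = x := by simp [f]
    have h2 := hgf (0, ⟨x, hx⟩)
    rw [h1] at h2
    simp [l, h2]

section SumOne

variable {H₁ H₂ : Set E}

/-- If (1 - t) l a + t l b = 1 with both values at most 1, each point of positive weight has value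
1. -/
theorem face_lOneSum (h₁ : IsSymmBody H₁) (h₂ : IsSymmBody H₂) {l : E →L[ℝ] ℝ}
    (hl₁ : ∀ x ∈ H₁, l x ≤ 1) (hl₂ : ∀ x ∈ H₂, l x ≤ 1) :
    {x ∈ lOneSum H₁ H₂ | l x = 1} = lOneSum {x ∈ H₁ | l x = 1} {x ∈ H₂ | l x = 1} := by
  apply Subset.antisymm
  · rintro x ⟨hx, hx1⟩
    obtain ⟨a, ha, b, hb, t, ht, rfl⟩ :=
      (mem_lOneSum_iff h₁.convex h₁.nonempty h₂.convex h₂.nonempty).1 hx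
    simp only [map_add, map_smul, smul_eq_mul] at hx1
    have hla := hl₁ a ha
    have hlb := hl₂ b hb
    -- At t = 0 or t = 1 the point of weight zero need not lie on the face, so these cases are
    -- separate.
    rcases eq_or_lt_of_le ht.1 with h0 | h0
    · subst h0
      refine subset_convexHull ℝ _ (Or.inl ?_)
      simp only [sub_zero, one_smul, zero_smul, add_zero, mem_ofPred_eq, ha, true_and]
      linarith
    rcases eq_or_lt_of_le ht.2 with h1 | h1
    · subst h1
      refine subset_convexHull ℝ _ (Or.inr ?_)
      simp only [sub_self, one_smul, zero_smul, zero_add, mem_ofPred_eq, hb, true_and]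
      linarith
    have e1 : l a = 1 := by nlinarith
    have e2 : l b = 1 := by nlinarith
    have hC : Convex ℝ (lOneSum {x ∈ H₁ | l x = 1} {x ∈ H₂ | l x = 1}) := convex_convexHull ℝ _
    have m1 : a ∈ lOneSum {x ∈ H₁ | l x = 1} {x ∈ H₂ | l x = 1} :=
      subset_convexHull ℝ _ (Or.inl ⟨ha, e1⟩)
    have m2 : b ∈ lOneSum {x ∈ H₁ | l x = 1} {x ∈ H₂ | l x = 1} :=
      subset_convexHull ℝ _ (Or.inr ⟨hb, e2⟩)
    exact hC m1 m2 (by linarith) ht.1 (by ring)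
  · have hc : Convex ℝ {x ∈ lOneSum H₁ H₂ | l x = 1} :=
      (convex_convexHull ℝ _).inter (convex_hyperplane (l : E →ₗ[ℝ] ℝ).isLinear 1)
    refine convexHull_min (union_subset ?_ ?_) hc
    · exact fun x hx => ⟨subset_convexHull ℝ _ (Or.inl hx.1), hx.2⟩
    · exact fun x hx => ⟨subset_convexHull ℝ _ (Or.inr hx.1), hx.2⟩

theorem subset_lOneSum_left : H₁ ⊆ lOneSum H₁ H₂ :=
  subset_union_left.trans (subset_convexHull ℝ _)

theorem subset_lOneSum_right : H₂ ⊆ lOneSum H₁ H₂ :=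
  subset_union_right.trans (subset_convexHull ℝ _)

theorem sep_inter_of_subset {H H' : Set E} (h : H' ⊆ H) (p : E → Prop) :
    {x ∈ H | p x} ∩ H' = {x ∈ H' | p x} := by
  ext x
  exact ⟨fun hx => ⟨hx.2, hx.1.2⟩, fun hx => ⟨⟨h hx.1, hx.2⟩, hx.1⟩⟩

/-- The faces of an `ℓ₁`-sum, with the empty set, are the `ℓ₁`-sums of faces. -/
noncomputable def loFaceEquiv (h₁ : IsSymmBody H₁) (h₂ : IsSymmBody H₂)
    (hd : Disjoint (Submodule.span ℝ H₁) (Submodule.span ℝ H₂)) :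
    LoFace (lOneSum H₁ H₂) ≃o LoFace H₁ × LoFace H₂ :=
  have key : ∀ F₁ : LoFace H₁, ∀ F₂ : LoFace H₂, ∃ l : E →L[ℝ] ℝ,
      ((∀ x ∈ H₁, l x ≤ 1) ∧ F₁.1 = {x ∈ H₁ | l x = 1}) ∧
      ((∀ x ∈ H₂, l x ≤ 1) ∧ F₂.1 = {x ∈ H₂ | l x = 1}) := by
    rintro ⟨_, l₁, hl₁, rfl⟩ ⟨_, l₂, hl₂, rfl⟩
    obtain ⟨l, hla, hlb⟩ := exists_functional hd l₁ l₂
    have ha : ∀ x ∈ H₁, l x = l₁ x := fun x hx => hla x (Submodule.subset_span hx)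
    have hb : ∀ x ∈ H₂, l x = l₂ x := fun x hx => hlb x (Submodule.subset_span hx)
    refine ⟨l, ⟨fun x hx => by rw [ha x hx]; exact hl₁ x hx, ?_⟩,
      ⟨fun x hx => by rw [hb x hx]; exact hl₂ x hx, ?_⟩⟩
    · ext x
      simp +contextual [ha]
    · ext x
      simp +contextual [hb]
  have hle : ∀ l : E →L[ℝ] ℝ, (∀ x ∈ H₁, l x ≤ 1) → (∀ x ∈ H₂, l x ≤ 1) →
      ∀ x ∈ lOneSum H₁ H₂, l x ≤ 1 := fun l h1 h2 x hx =>
    convexHull_min (union_subset h1 h2) (convex_halfSpace_le (l : E →ₗ[ℝ] ℝ).isLinear 1) hx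
  { toFun F := (⟨F.1 ∩ H₁, by
        obtain ⟨l, hl, hF⟩ := F.2
        exact ⟨l, fun x hx => hl x (subset_lOneSum_left hx), by
          rw [hF, sep_inter_of_subset subset_lOneSum_left]⟩⟩,
      ⟨F.1 ∩ H₂, by
        obtain ⟨l, hl, hF⟩ := F.2
        exact ⟨l, fun x hx => hl x (subset_lOneSum_right hx), by
          rw [hF, sep_inter_of_subset subset_lOneSum_right]⟩⟩)
    invFun F := ⟨lOneSum F.1.1 F.2.1, by
      obtain ⟨l, ⟨hl₁, hF₁⟩, hl₂, hF₂⟩ := key F.1 F.2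
      exact ⟨l, hle l hl₁ hl₂, by rw [face_lOneSum h₁ h₂ hl₁ hl₂, hF₁, hF₂]⟩⟩
    left_inv F := by
      obtain ⟨F, l, hl, rfl⟩ := F
      apply Subtype.ext
      simp only
      rw [sep_inter_of_subset subset_lOneSum_left, sep_inter_of_subset subset_lOneSum_right,
        face_lOneSum h₁ h₂ (fun x hx => hl x (subset_lOneSum_left hx))
          (fun x hx => hl x (subset_lOneSum_right hx))]
    right_inv F := by
      obtain ⟨l, ⟨hl₁, hF₁⟩, hl₂, hF₂⟩ := key F.1 F.2
      have h : lOneSum F.1.1 F.2.1 = {x ∈ lOneSum H₁ H₂ | l x = 1} := by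
        rw [face_lOneSum h₁ h₂ hl₁ hl₂, hF₁, hF₂]
      refine Prod.ext (Subtype.ext ?_) (Subtype.ext ?_)
      · simp only [h]
        rw [sep_inter_of_subset subset_lOneSum_left, hF₁]
      · simp only [h]
        rw [sep_inter_of_subset subset_lOneSum_right, hF₂]
    map_rel_iff' := by
      rintro ⟨F, l, hl, rfl⟩ ⟨F', l', hl', rfl⟩
      refine ⟨fun h => ?_, fun h => ⟨inter_subset_inter_left _ h, inter_subset_inter_left _ h⟩⟩
      have h1 : {x ∈ lOneSum H₁ H₂ | l x = 1} ∩ H₁ ⊆ {x ∈ lOneSum H₁ H₂ | l' x = 1} ∩ H₁ := h.1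
      have h2 : {x ∈ lOneSum H₁ H₂ | l x = 1} ∩ H₂ ⊆ {x ∈ lOneSum H₁ H₂ | l' x = 1} ∩ H₂ := h.2
      rw [sep_inter_of_subset subset_lOneSum_left, sep_inter_of_subset subset_lOneSum_left] at h1
      rw [sep_inter_of_subset subset_lOneSum_right, sep_inter_of_subset subset_lOneSum_right] at h2
      change {x ∈ lOneSum H₁ H₂ | l x = 1} ⊆ {x ∈ lOneSum H₁ H₂ | l' x = 1}
      rw [face_lOneSum h₁ h₂ (fun x hx => hl x (subset_lOneSum_left hx))
          (fun x hx => hl x (subset_lOneSum_right hx)),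
        face_lOneSum h₁ h₂ (fun x hx => hl' x (subset_lOneSum_left hx))
          (fun x hx => hl' x (subset_lOneSum_right hx))]
      exact convexHull_mono (union_subset_union h1 h2) }

end SumOne

section SumInf

variable {H₁ H₂ : Set E}

/-- Maximising a linear functional on a sum amounts to maximising it on each summand. -/
theorem face_add (l : E →L[ℝ] ℝ) :
    {x ∈ H₁ + H₂ | ∀ y ∈ H₁ + H₂, l y ≤ l x}
      = {x ∈ H₁ | ∀ y ∈ H₁, l y ≤ l x} + {x ∈ H₂ | ∀ y ∈ H₂, l y ≤ l x} := by
  ext x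
  constructor
  · rintro ⟨⟨a, ha, b, hb, rfl⟩, hx⟩
    refine ⟨a, ⟨ha, fun y hy => ?_⟩, b, ⟨hb, fun y hy => ?_⟩, rfl⟩
    · simpa using hx _ (add_mem_add hy hb)
    · simpa using hx _ (add_mem_add ha hy)
  · rintro ⟨a, ⟨ha, ha'⟩, b, ⟨hb, hb'⟩, rfl⟩
    refine ⟨add_mem_add ha hb, ?_⟩
    rintro _ ⟨y, hy, z, hz, rfl⟩
    simpa using add_le_add (ha' y hy) (hb' z hz)

theorem eq_and_eq_of_add_eq_add {V₁ V₂ : Submodule ℝ E} (h : Disjoint V₁ V₂) {a x b y : E}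
    (ha : a ∈ V₁) (hx : x ∈ V₁) (hb : b ∈ V₂) (hy : y ∈ V₂) (he : x + y = a + b) :
    x = a ∧ y = b := by
  obtain ⟨h1, h2⟩ := Submodule.disjoint_iff_add_eq_zero.1 h (sub_mem hx ha) (sub_mem hy hb) (by
    rw [sub_add_sub_comm, he, sub_self])
  exact ⟨sub_eq_zero.1 h1, sub_eq_zero.1 h2⟩

theorem leftSummand_add (hd : Disjoint (Submodule.span ℝ H₁) (Submodule.span ℝ H₂))
    {F₁ F₂ : Set E} (hF₁ : F₁ ⊆ H₁) (hF₂ : F₂ ⊆ H₂) (hne : F₂.Nonempty) :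
    leftSummand H₁ H₂ (F₁ + F₂) = F₁ := by
  ext x
  constructor
  · rintro ⟨hx, y, hy, a, ha, b, hb, he⟩
    have := eq_and_eq_of_add_eq_add hd (Submodule.subset_span (hF₁ ha)) (Submodule.subset_span hx)
      (Submodule.subset_span (hF₂ hb)) (Submodule.subset_span hy) he.symm
    rwa [this.1]
  · intro hx
    obtain ⟨y, hy⟩ := hne
    exact ⟨hF₁ hx, y, hF₂ hy, add_mem_add hx hy⟩

theorem rightSummand_add (hd : Disjoint (Submodule.span ℝ H₁) (Submodule.span ℝ H₂))
    {F₁ F₂ : Set E} (hF₁ : F₁ ⊆ H₁) (hF₂ : F₂ ⊆ H₂) (hne : F₁.Nonempty) :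
    rightSummand H₁ H₂ (F₁ + F₂) = F₂ := by
  ext x
  constructor
  · rintro ⟨hx, y, hy, a, ha, b, hb, he⟩
    have := eq_and_eq_of_add_eq_add hd (Submodule.subset_span (hF₁ ha)) (Submodule.subset_span hy)
      (Submodule.subset_span (hF₂ hb)) (Submodule.subset_span hx) he.symm
    rwa [this.2]
  · intro hx
    obtain ⟨y, hy⟩ := hne
    exact ⟨hF₂ hx, y, hF₁ hy, add_mem_add hy hx⟩

theorem maxSet_nonempty {H : Set E} (hH : IsSymmBody H) (l : E →L[ℝ] ℝ) :
    {x ∈ H | ∀ y ∈ H, l y ≤ l x}.Nonempty := by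
  obtain ⟨x, hx, hmax⟩ := hH.isCompact.exists_isMaxOn hH.nonempty l.continuous.continuousOn
  exact ⟨x, hx, hmax⟩

theorem UpFace.nonempty {H : Set E} (hH : IsSymmBody H) (F : UpFace H) : F.1.Nonempty := by
  obtain ⟨_, l, rfl⟩ := F
  exact maxSet_nonempty hH l

theorem UpFace.subset {H : Set E} (F : UpFace H) : F.1 ⊆ H := by
  obtain ⟨_, l, rfl⟩ := F
  exact sep_subset _ _

theorem LoFace.subset {H : Set E} (F : LoFace H) : F.1 ⊆ H := by
  obtain ⟨_, l, -, rfl⟩ := F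
  exact sep_subset _ _

/-- The faces of an `ℓ_∞`-sum, with the sum itself, are the sums of faces. -/
noncomputable def upFaceEquiv (h₁ : IsSymmBody H₁) (h₂ : IsSymmBody H₂)
    (hd : Disjoint (Submodule.span ℝ H₁) (Submodule.span ℝ H₂)) :
    UpFace (H₁ + H₂) ≃o UpFace H₁ × UpFace H₂ :=
  have key : ∀ F₁ : UpFace H₁, ∀ F₂ : UpFace H₂, ∃ l : E →L[ℝ] ℝ,
      F₁.1 + F₂.1 = {x ∈ H₁ + H₂ | ∀ y ∈ H₁ + H₂, l y ≤ l x} := by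
    rintro ⟨_, l₁, rfl⟩ ⟨_, l₂, rfl⟩
    obtain ⟨l, hla, hlb⟩ := exists_functional hd l₁ l₂
    have ha : ∀ x ∈ H₁, l x = l₁ x := fun x hx => hla x (Submodule.subset_span hx)
    have hb : ∀ x ∈ H₂, l x = l₂ x := fun x hx => hlb x (Submodule.subset_span hx)
    refine ⟨l, ?_⟩
    rw [face_add]
    congr 1
    · ext x
      simp +contextual [ha]
    · ext x
      simp +contextual [hb]
  have key2 : ∀ l : E →L[ℝ] ℝ,
      leftSummand H₁ H₂ {x ∈ H₁ + H₂ | ∀ y ∈ H₁ + H₂, l y ≤ l x} = {x ∈ H₁ | ∀ y ∈ H₁, l y ≤ l x} ∧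
      rightSummand H₁ H₂ {x ∈ H₁ + H₂ | ∀ y ∈ H₁ + H₂, l y ≤ l x}
        = {x ∈ H₂ | ∀ y ∈ H₂, l y ≤ l x} := fun l => by
    rw [face_add]
    exact ⟨leftSummand_add hd (sep_subset _ _) (sep_subset _ _) (maxSet_nonempty h₂ l),
      rightSummand_add hd (sep_subset _ _) (sep_subset _ _) (maxSet_nonempty h₁ l)⟩
  { toFun F := (⟨leftSummand H₁ H₂ F.1, by
        obtain ⟨l, hF⟩ := F.2
        exact ⟨l, by rw [hF]; exact (key2 l).1⟩⟩,
      ⟨rightSummand H₁ H₂ F.1, by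
        obtain ⟨l, hF⟩ := F.2
        exact ⟨l, by rw [hF]; exact (key2 l).2⟩⟩)
    invFun F := ⟨F.1.1 + F.2.1, key F.1 F.2⟩
    left_inv F := by
      obtain ⟨F, l, rfl⟩ := F
      apply Subtype.ext
      simp only [(key2 l).1, (key2 l).2]
      rw [face_add]
    right_inv F := by
      refine Prod.ext (Subtype.ext ?_) (Subtype.ext ?_)
      · exact leftSummand_add hd F.1.subset F.2.subset (F.2.nonempty h₂)
      · exact rightSummand_add hd F.1.subset F.2.subset (F.1.nonempty h₁)
    map_rel_iff' := by
      rintro ⟨F, l, rfl⟩ ⟨F', l', rfl⟩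
      constructor
      · intro h
        have h1 : leftSummand H₁ H₂ _ ⊆ leftSummand H₁ H₂ _ := h.1
        have h2 : rightSummand H₁ H₂ _ ⊆ rightSummand H₁ H₂ _ := h.2
        rw [(key2 l).1, (key2 l').1] at h1
        rw [(key2 l).2, (key2 l').2] at h2
        change {x ∈ H₁ + H₂ | ∀ y ∈ H₁ + H₂, l y ≤ l x} ⊆ {x ∈ H₁ + H₂ | ∀ y ∈ H₁ + H₂, l' y ≤ l' x}
        rw [face_add, face_add]
        exact add_subset_add h1 h2
      · intro h
        exact ⟨fun x hx => ⟨hx.1, hx.2.imp fun y hy => ⟨hy.1, h hy.2⟩⟩,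
          fun x hx => ⟨hx.1, hx.2.imp fun y hy => ⟨hy.1, h hy.2⟩⟩⟩ }

end SumInf

end Geometry
end Hanner

namespace Hanner
open Module Set

/-! ### Ranks and additive centroid vectors on the two face orders. -/

section Rank
set_option linter.unusedSectionVars false

variable {E : Type*} [NormedAddCommGroup E] [InnerProductSpace ℝ E] [FiniteDimensional ℝ E]
  [MeasurableSpace E] [BorelSpace E]
variable {H H₁ H₂ : Set E}

/-- The rank of a face in the order of proper faces with the empty set: its dimension plus one. -/
noncomputable def loRank (F : LoFace H) : ℕ := finrank ℝ (Submodule.span ℝ F.1)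

/-- The rank of a face in the order of non-empty faces: its dimension. -/
noncomputable def upRank (F : UpFace H) : ℕ := setDim F.1

/-- The vectors whose increments along flags are multiplicative for `ℓ₁`-sums. -/
noncomputable def loVec (F : LoFace H) : E := (loRank F : ℝ) • centroid F.1

/-- The vectors whose increments along flags are multiplicative for `ℓ_∞`-sums. -/
noncomputable def upVec (F : UpFace H) : E := centroid F.1

/-- If both faces had the same span, the two functionals would agree on it, since they agree on the
smaller face; the larger face would then satisfy the equation of the smaller one. -/
theorem loRank_strictMono : StrictMono (loRank : LoFace H → ℕ) := by
  rintro ⟨F, l, hl, rfl⟩ ⟨F', l', hl', rfl⟩ hlt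
  have hsub : {x ∈ H | l x = 1} ⊆ {x ∈ H | l' x = 1} := hlt.le
  have hle := Submodule.span_mono (R := ℝ) hsub
  refine lt_of_le_of_ne (Submodule.finrank_mono hle) fun heq => hlt.not_ge ?_
  have hs := Submodule.eq_of_le_of_finrank_eq hle heq
  have h0 : Submodule.span ℝ {x ∈ H | l x = 1} ≤ LinearMap.ker ((l - l' : E →L[ℝ] ℝ) : E →ₗ[ℝ] ℝ) :=
    Submodule.span_le.2 fun x hx => by simp [hx.2, (hsub hx).2]
  intro x hx
  have h1 := h0 (hs ▸ Submodule.subset_span hx)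
  have h2 : l x - l' x = 0 := h1
  exact ⟨hx.1, by rw [sub_eq_zero.1 h2, hx.2]⟩

/-- If the direction spaces coincided, the functional of the smaller face would be constant on the
larger one, which would then consist of its maximisers. -/
theorem upRank_strictMono (hH : IsSymmBody H) : StrictMono (upRank : UpFace H → ℕ) := by
  rintro ⟨F, l, rfl⟩ ⟨F', l', rfl⟩ hlt
  have hsub : {x ∈ H | ∀ y ∈ H, l y ≤ l x} ⊆ {x ∈ H | ∀ y ∈ H, l' y ≤ l' x} := hlt.le
  have hle := vectorSpan_mono ℝ hsub
  refine lt_of_le_of_ne (Submodule.finrank_mono hle) fun heq => hlt.not_ge ?_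
  have hs := Submodule.eq_of_le_of_finrank_eq hle heq
  obtain ⟨p, hp⟩ := maxSet_nonempty hH l
  have h0 := vectorSpan_le_ker (A := {x ∈ H | ∀ y ∈ H, l y ≤ l x}) (l := l) (m := l p)
    fun x hx => le_antisymm (hp.2 x hx.1) (hx.2 p hp.1)
  intro x hx
  have h1 : l (x - p) = 0 := h0 (hs ▸ vsub_mem_vectorSpan ℝ hx (hsub hp))
  rw [map_sub, sub_eq_zero] at h1
  exact ⟨hx.1, fun y hy => h1 ▸ hp.2 y hy⟩

theorem loRank_le (F : LoFace H) : loRank F ≤ finrank ℝ (Submodule.span ℝ H) :=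
  Submodule.finrank_mono (Submodule.span_mono F.subset)

theorem upRank_le (F : UpFace H) : upRank F ≤ finrank ℝ (Submodule.span ℝ H) :=
  Submodule.finrank_mono ((vectorSpan_mono ℝ F.subset).trans (vectorSpan_le_span H))

theorem setDim_eq (hH : IsSymmBody H) : setDim H = finrank ℝ (Submodule.span ℝ H) := by
  have h : (fun x : E => x -ᵥ (0 : E)) '' H = H := by simp
  rw [setDim, vectorSpan_eq_span_vsub_set_right ℝ hH.zero_mem, h]

theorem centroid_eq_zero (hH : IsSymmBody H) : centroid H = 0 := by
  have h := centroid_neg hH.nonempty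
  rw [hH.neg_eq] at h
  have h2 : (2 : ℝ) • centroid H = 0 := by
    rw [two_smul]
    nth_rewrite 1 [h]
    simp
  exact (smul_eq_zero_iff_right two_ne_zero).1 h2

/-- `H` as a face of itself. -/
def UpFace.top (H : Set E) : UpFace H := ⟨H, 0, by simp⟩

/-- The empty face. -/
def LoFace.bot (H : Set E) : LoFace H := ⟨∅, 0, by simp, by simp⟩

theorem finrank_span_empty : finrank ℝ (Submodule.span ℝ (∅ : Set E)) = 0 := by
  rw [Submodule.span_empty, finrank_bot]

theorem loRank_bot : loRank (LoFace.bot H) = 0 := finrank_span_empty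

theorem loRank_eq_zero {F : LoFace H} (h : loRank F = 0) : F.1 = ∅ := by
  have hle : LoFace.bot H ≤ F := empty_subset _
  have := hle.eq_of_not_lt fun hlt => by
    have := loRank_strictMono hlt
    omega
  rw [← this]
  rfl

theorem upRank_top (hH : IsSymmBody H) : upRank (UpFace.top H) = finrank ℝ (Submodule.span ℝ H) :=
  setDim_eq hH

theorem upRank_eq_top (hH : IsSymmBody H) {F : UpFace H}
    (h : upRank F = finrank ℝ (Submodule.span ℝ H)) : F.1 = H := by
  have hle : F ≤ UpFace.top H := F.subset
  have := hle.eq_of_not_lt fun hlt => by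
    have := upRank_strictMono hH hlt
    rw [h, upRank_top hH] at this
    omega
  rw [this]
  rfl

/-- Only `H` itself has full rank, and its centroid is 0 by symmetry. This is the vanishing at the
top that telescoping needs. -/
theorem upVec_eq_zero (hH : IsSymmBody H) (F : UpFace H)
    (h : upRank F = finrank ℝ (Submodule.span ℝ H)) : upVec F = 0 := by
  rw [upVec, upRank_eq_top hH h, centroid_eq_zero hH]

theorem LoFace.convex (hH : IsSymmBody H) (F : LoFace H) : Convex ℝ F.1 := by
  obtain ⟨_, l, -, rfl⟩ := F
  exact hH.convex.inter (convex_hyperplane (l : E →ₗ[ℝ] ℝ).isLinear 1)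

theorem LoFace.isCompact (hH : IsSymmBody H) (F : LoFace H) : IsCompact F.1 := by
  obtain ⟨_, l, -, rfl⟩ := F
  exact hH.isCompact.inter_right (isClosed_eq l.continuous continuous_const)

theorem UpFace.convex (hH : IsSymmBody H) (F : UpFace H) : Convex ℝ F.1 := by
  obtain ⟨_, l, rfl⟩ := F
  exact IsExposed.convex (fun _ => ⟨l, rfl⟩) hH.convex

theorem UpFace.isCompact (hH : IsSymmBody H) (F : UpFace H) : IsCompact F.1 := by
  obtain ⟨_, l, rfl⟩ := F
  exact IsExposed.isCompact (fun _ => ⟨l, rfl⟩) hH.isCompact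

theorem LoFace.eq_lOneSum (h₁ : IsSymmBody H₁) (h₂ : IsSymmBody H₂)
    (hd : Disjoint (Submodule.span ℝ H₁) (Submodule.span ℝ H₂)) (F : LoFace (lOneSum H₁ H₂)) :
    F.1 = lOneSum (loFaceEquiv h₁ h₂ hd F).1.1 (loFaceEquiv h₁ h₂ hd F).2.1 :=
  congrArg Subtype.val ((loFaceEquiv h₁ h₂ hd).symm_apply_apply F).symm

theorem UpFace.eq_add (h₁ : IsSymmBody H₁) (h₂ : IsSymmBody H₂)
    (hd : Disjoint (Submodule.span ℝ H₁) (Submodule.span ℝ H₂)) (F : UpFace (H₁ + H₂)) :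
    F.1 = (upFaceEquiv h₁ h₂ hd F).1.1 + (upFaceEquiv h₁ h₂ hd F).2.1 :=
  congrArg Subtype.val ((upFaceEquiv h₁ h₂ hd).symm_apply_apply F).symm

theorem vectorSpan_add {A B : Set E} (hA : A.Nonempty) (hB : B.Nonempty) :
    vectorSpan ℝ (A + B) = vectorSpan ℝ A ⊔ vectorSpan ℝ B := by
  apply le_antisymm
  · rw [vectorSpan_def, Submodule.span_le]
    rintro _ ⟨_, ⟨a, ha, b, hb, rfl⟩, _, ⟨a', ha', b', hb', rfl⟩, rfl⟩
    have : (a + b) -ᵥ (a' + b') = (a -ᵥ a') + (b -ᵥ b') := by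
      simp only [vsub_eq_sub]; abel
    simp only [SetLike.mem_coe, this]
    exact Submodule.add_mem_sup (vsub_mem_vectorSpan ℝ ha ha') (vsub_mem_vectorSpan ℝ hb hb')
  · obtain ⟨a₀, ha₀⟩ := hA
    obtain ⟨b₀, hb₀⟩ := hB
    refine sup_le ?_ ?_
    · rw [vectorSpan_def, Submodule.span_le]
      rintro _ ⟨a, ha, a', ha', rfl⟩
      have := vsub_mem_vectorSpan ℝ (add_mem_add ha hb₀) (add_mem_add ha' hb₀)
      simpa using this
    · rw [vectorSpan_def, Submodule.span_le]
      rintro _ ⟨a, ha, a', ha', rfl⟩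
      have := vsub_mem_vectorSpan ℝ (add_mem_add ha₀ ha) (add_mem_add ha₀ ha')
      simpa using this

theorem span_add (h₁ : IsSymmBody H₁) (h₂ : IsSymmBody H₂) :
    Submodule.span ℝ (H₁ + H₂) = Submodule.span ℝ H₁ ⊔ Submodule.span ℝ H₂ := by
  apply le_antisymm
  · refine Submodule.span_le.2 ?_
    rintro _ ⟨a, ha, b, hb, rfl⟩
    exact Submodule.add_mem_sup (Submodule.subset_span ha) (Submodule.subset_span hb)
  · refine sup_le (Submodule.span_mono fun x hx => ?_) (Submodule.span_mono fun x hx => ?_)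
    · simpa using add_mem_add hx h₂.zero_mem
    · simpa using add_mem_add h₁.zero_mem hx

theorem lOneSum_empty_right {A : Set E} (hA : Convex ℝ A) : lOneSum A ∅ = A := by
  rw [lOneSum, union_empty, hA.convexHull_eq]

theorem lOneSum_empty_left {A : Set E} (hA : Convex ℝ A) : lOneSum ∅ A = A := by
  rw [lOneSum, empty_union, hA.convexHull_eq]

/-- The faces of an `ℓ₁`-sum as a product of ranked orders. -/
noncomputable def loProduct (h₁ : IsSymmBody H₁) (h₂ : IsSymmBody H₂)
    (hd : Disjoint (Submodule.span ℝ H₁) (Submodule.span ℝ H₂)) :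
    RankedProduct (loRank : LoFace (lOneSum H₁ H₂) → ℕ) loVec
      (loRank : LoFace H₁ → ℕ) loVec (finrank ℝ (Submodule.span ℝ H₁))
      (loRank : LoFace H₂ → ℕ) loVec (finrank ℝ (Submodule.span ℝ H₂)) where
  e := loFaceEquiv h₁ h₂ hd
  rank_eq F := by
    rw [loRank, F.eq_lOneSum h₁ h₂ hd, span_lOneSum, finrank_sup_of_disjoint]
    · rfl
    · exact hd.mono (Submodule.span_mono (LoFace.subset _)) (Submodule.span_mono (LoFace.subset _))
  vector_eq F := by
    have hF := F.eq_lOneSum h₁ h₂ hd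
    set F₁ := (loFaceEquiv h₁ h₂ hd F).1
    set F₂ := (loFaceEquiv h₁ h₂ hd F).2
    obtain ⟨l, -, hl⟩ := F.2
    have hd' : Disjoint (Submodule.span ℝ F₁.1) (Submodule.span ℝ F₂.1) :=
      hd.mono (Submodule.span_mono F₁.subset) (Submodule.span_mono F₂.subset)
    have hl₁ : ∀ x ∈ F₁.1, l x = 1 := fun x hx => by
      have : x ∈ F.1 := by rw [hF]; exact subset_lOneSum_left hx
      rw [hl] at this
      exact this.2
    have hl₂ : ∀ x ∈ F₂.1, l x = 1 := fun x hx => by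
      have : x ∈ F.1 := by rw [hF]; exact subset_lOneSum_right hx
      rw [hl] at this
      exact this.2
    -- The empty face has rank 0, so its centroid contributes nothing, whatever its default value.
    rcases F₁.1.eq_empty_or_nonempty with he₁ | hn₁
    · simp only [loVec, loRank]
      rw [hF, he₁, lOneSum_empty_left (F₂.convex h₂), finrank_span_empty]
      simp
    rcases F₂.1.eq_empty_or_nonempty with he₂ | hn₂
    · simp only [loVec, loRank]
      rw [hF, he₂, lOneSum_empty_right (F₁.convex h₁), finrank_span_empty]
      simp
    have h := centroid_lOneSum (F₁.convex h₁) (F₁.isCompact h₁) hn₁ (F₂.convex h₂)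
      (F₂.isCompact h₂) hn₂ hd' hl₁ hl₂
    simp only [loVec, loRank]
    rw [hF, span_lOneSum, finrank_sup_of_disjoint hd', finrank_span_eq_setDim_add_one hn₁ hl₁,
      finrank_span_eq_setDim_add_one hn₂ hl₂]
    push_cast
    rw [← h]
    congr 1
    ring
  strictMono₁ := loRank_strictMono
  strictMono₂ := loRank_strictMono
  rank_le₁ := loRank_le
  rank_le₂ := loRank_le

/-- The faces of an `ℓ_∞`-sum as a product of ranked orders. -/
noncomputable def upProduct (h₁ : IsSymmBody H₁) (h₂ : IsSymmBody H₂)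
    (hd : Disjoint (Submodule.span ℝ H₁) (Submodule.span ℝ H₂)) :
    RankedProduct (upRank : UpFace (H₁ + H₂) → ℕ) upVec
      (upRank : UpFace H₁ → ℕ) upVec (finrank ℝ (Submodule.span ℝ H₁))
      (upRank : UpFace H₂ → ℕ) upVec (finrank ℝ (Submodule.span ℝ H₂)) where
  e := upFaceEquiv h₁ h₂ hd
  rank_eq F := by
    rw [upRank, F.eq_add h₁ h₂ hd, setDim,
      vectorSpan_add (UpFace.nonempty h₁ _) (UpFace.nonempty h₂ _), finrank_sup_of_disjoint]
    · rfl
    · exact hd.mono ((vectorSpan_le_span _).trans (Submodule.span_mono (UpFace.subset _)))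
        ((vectorSpan_le_span _).trans (Submodule.span_mono (UpFace.subset _)))
  vector_eq F := by
    rw [upVec, F.eq_add h₁ h₂ hd, centroid_add (UpFace.convex h₁ _) (UpFace.isCompact h₁ _)
      (UpFace.nonempty h₁ _) (UpFace.convex h₂ _) (UpFace.isCompact h₂ _) (UpFace.nonempty h₂ _)]
    · rfl
    · exact hd.mono ((vectorSpan_le_span _).trans (Submodule.span_mono (UpFace.subset _)))
        ((vectorSpan_le_span _).trans (Submodule.span_mono (UpFace.subset _)))
  strictMono₁ := upRank_strictMono h₁
  strictMono₂ := upRank_strictMono h₂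
  rank_le₁ := upRank_le
  rank_le₂ := upRank_le

end Rank
end Hanner

namespace Hanner
open Module Set

/-! ### Passing from centroids to increments by matrices independent of the flag. -/

section FrameChange

variable {E : Type*} [AddCommGroup E] [Module ℝ E] {ι : Type*} {n : ℕ}

/-- Two families of frames related by a fixed pair of matrices. -/
def SameFrames (w w' : ι → Fin n → E) : Prop :=
  ∃ A B : Matrix (Fin n) (Fin n) ℝ, A.det * B.det = 1 ∧ (∀ c k, w' c k = ∑ l, A k l • w c l) ∧
    ∀ c k, w c k = ∑ l, B k l • w' c l

theorem SameFrames.symm {w w' : ι → Fin n → E} (h : SameFrames w w') : SameFrames w' w := by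
  obtain ⟨A, B, h1, h2, h3⟩ := h
  exact ⟨B, A, by rw [mul_comm, h1], h3, h2⟩

theorem SameFrames.unimodular {w w' : ι → Fin n → E} (h : SameFrames w w') {V : Submodule ℝ E}
    (hw : Unimodular w V) : Unimodular w' V := by
  obtain ⟨A, B, h1, h2, h3⟩ := h
  exact hw.transfer A B h1 h2 h3

theorem SameFrames.balanced [Finite ι] {w w' : ι → Fin n → E} (h : SameFrames w w') {I : Set ι}
    {z : E} (hw : Balanced w I z) : Balanced w' I z := by
  obtain ⟨A, B, h1, h2, h3⟩ := h
  exact hw.transfer B h3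

/-- Form used for ℓ₁-sums: the sequence starts at 0 (the empty face), so the increments are a lower
triangular transform of the frame. The diagonal entries are k + 1, and those of the inverse
transform (k + 1)⁻¹. -/
theorem sameFrames_smul_increments (C : ι → Fin n → E) (s : ι → ℕ → E) (h0 : ∀ c, s c 0 = 0)
    (h : ∀ c (k : Fin n), s c (k + 1) = ((k : ℝ) + 1) • C c k) :
    SameFrames C (fun c k => s c (k + 1) - s c k) := by
  refine ⟨Matrix.of fun k l => if l = k then (k : ℝ) + 1 else if (l : ℕ) + 1 = k then -(k : ℝ) else 0,
    Matrix.of fun k l => if l ≤ k then ((k : ℝ) + 1)⁻¹ else 0, ?_, fun c k => ?_, fun c k => ?_⟩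
  · rw [Matrix.det_of_isLowerTriangular, Matrix.det_of_isLowerTriangular, ← Finset.prod_mul_distrib]
    · refine Finset.prod_eq_one fun k _ => ?_
      have : (k : ℝ) + 1 ≠ 0 := by positivity
      simp [this]
    · intro k l hkl
      have hkl : k < l := hkl
      simp [not_le.2 hkl]
    · intro k l hkl
      have hkl : k < l := hkl
      have h1 : l ≠ k := hkl.ne'
      have h2 : ¬ (l : ℕ) + 1 = k := by have : (k : ℕ) < l := hkl; omega
      simp [h1, h2]
  · simp only [Matrix.of_apply]
    rcases k with ⟨k, hk⟩
    rcases k with _ | m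
    · rw [Finset.sum_eq_single ⟨0, hk⟩ (fun l _ hl => by simp [hl]) (by simp)]
      simp [h0, h c ⟨0, hk⟩]
    · have h1 := h c ⟨m + 1, hk⟩
      have h2 := h c ⟨m, by omega⟩
      simp only at h1 h2
      simp only [h1, h2]
      have hne : (⟨m + 1, hk⟩ : Fin n) ≠ ⟨m, by omega⟩ := by simp
      rw [Finset.sum_eq_add ⟨m + 1, hk⟩ ⟨m, by omega⟩ hne]
      · simp
        module
      · rintro l - ⟨hl1, hl2⟩
        have : ¬ (l : ℕ) = m := fun h => hl2 (Fin.ext h)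
        simp [hl1, this]
      · simp
      · simp
  -- The `min` freezes the sequence after position k + 1, so that the partial sum telescopes over
  -- the full range.
  · let u : ℕ → E := fun j => ((k : ℝ) + 1)⁻¹ • s c (min j (k + 1))
    have h1 : ∀ l : Fin n, (if l ≤ k then ((k : ℝ) + 1)⁻¹ else 0) • (s c (l + 1) - s c l)
        = u ((l : ℕ) + 1) - u l := by
      intro l
      simp only [u]
      split_ifs with hl
      · have hl : (l : ℕ) ≤ k := hl
        rw [min_eq_left (by omega), min_eq_left (by omega), smul_sub]
      · have hl : ¬ (l : ℕ) ≤ k := hl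
        rw [min_eq_right (by omega), min_eq_right (by omega)]
        simp
    simp only [Matrix.of_apply]
    rw [Finset.sum_congr rfl fun l _ => h1 l, Fin.sum_univ_eq_sum_range (fun k => u (k + 1) - u k),
      Finset.sum_range_sub]
    have hk : (k : ℝ) + 1 ≠ 0 := by positivity
    simp only [u]
    rw [min_eq_right (by omega), min_eq_left (by omega), h0, h, smul_smul, inv_mul_cancel₀ hk]
    simp

/-- Form used for ℓ_∞-sums: the sequence ends at 0 (the centroid of `H`), so the frame is recovered
from the tails of the increments. Both transforms are upper triangular with diagonal -1. -/
theorem sameFrames_increments (C : ι → Fin n → E) (s : ι → ℕ → E) (h0 : ∀ c, s c n = 0)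
    (h : ∀ c (k : Fin n), s c k = C c k) :
    SameFrames C (fun c k => s c (k + 1) - s c k) := by
  refine ⟨Matrix.of fun k l => if l = k then -1 else if (l : ℕ) = k + 1 then 1 else 0,
    Matrix.of fun k l => if l < k then 0 else -1, ?_, fun c k => ?_, fun c k => ?_⟩
  · rw [Matrix.det_of_isUpperTriangular, Matrix.det_of_isUpperTriangular,
      ← Finset.prod_mul_distrib]
    · exact Finset.prod_eq_one fun k _ => by simp
    · intro k l hkl
      have hkl : l < k := hkl
      simp [hkl]
    · intro k l hkl
      have hkl : l < k := hkl
      have h1 : l ≠ k := hkl.ne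
      have h2 : ¬ (l : ℕ) = k + 1 := by have : (l : ℕ) < k := hkl; omega
      simp [h1, h2]
  · simp only [Matrix.of_apply]
    by_cases hk : (k : ℕ) + 1 < n
    · have h2 := h c ⟨k + 1, hk⟩
      simp only at h2
      have hne : k ≠ ⟨k + 1, hk⟩ := fun h => by have := congrArg Fin.val h; simp at this
      rw [h, h2, Finset.sum_eq_add k ⟨k + 1, hk⟩ hne]
      · simp [hne.symm, sub_eq_add_neg]
        abel
      · rintro l - ⟨hl1, hl2⟩
        have : ¬ (l : ℕ) = k + 1 := fun h => hl2 (Fin.ext h)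
        simp [hl1, this]
      · simp
      · simp
    · have hk' : (k : ℕ) + 1 = n := by omega
      rw [Finset.sum_eq_single k (fun l _ hl => by
        have : ¬ (l : ℕ) = k + 1 := by omega
        simp [hl, this]) (by simp)]
      rw [hk', h0, h]
      simp
  · let u : ℕ → E := fun j => -s c (max j k)
    have h1 : ∀ l : Fin n, (if l < k then 0 else (-1 : ℝ)) • (s c (l + 1) - s c l)
        = u ((l : ℕ) + 1) - u l := by
      intro l
      simp only [u]
      split_ifs with hl
      · have hl : (l : ℕ) < k := hl
        rw [max_eq_right (by omega), max_eq_right (by omega)]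
        simp
      · have hl : ¬ (l : ℕ) < k := hl
        rw [max_eq_left (by omega), max_eq_left (by omega)]
        module
    simp only [Matrix.of_apply]
    rw [Finset.sum_congr rfl fun l _ => h1 l, Fin.sum_univ_eq_sum_range (fun k => u (k + 1) - u k),
      Finset.sum_range_sub]
    simp only [u]
    rw [max_eq_left (by omega), max_eq_right (by omega), h0, h]
    simp

end FrameChange

/-! ### Flags of faces as ranked chains in the two face orders. -/

section Flags
set_option linter.unusedSectionVars false

variable {E : Type*} [NormedAddCommGroup E] [InnerProductSpace ℝ E] [FiniteDimensional ℝ E]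
  [MeasurableSpace E] [BorelSpace E]
variable {H : Set E} {n : ℕ}

/-- A face as an element of the order of proper faces with the empty set. -/
def Face.lo (hH : IsSymmBody H) (F : Face H) : LoFace H := ⟨F.1, ((isFace_iff hH).1 F.2).2⟩

/-- A face as an element of the order of all non-empty faces. -/
def Face.up (F : Face H) : UpFace H := ⟨F.1, F.2.1 F.2.2.1⟩

theorem loRank_lo (hH : IsSymmBody H) (F : Face H) : loRank (F.lo hH) = setDim F.1 + 1 := by
  obtain ⟨hne, l, -, hl⟩ := (isFace_iff hH).1 F.2
  exact finrank_span_eq_setDim_add_one hne (l := l) fun x hx => by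
    have : x ∈ F.1 := hx
    rw [hl] at this
    exact this.2

theorem isFace_of_loRank_pos (hH : IsSymmBody H) (F : LoFace H) (h : 0 < loRank F) :
    IsFace H F.1 := by
  refine (isFace_iff hH).2 ⟨nonempty_iff_ne_empty.2 fun he => ?_, F.2⟩
  rw [loRank, he, finrank_span_empty] at h
  omega

theorem isFace_of_upRank_lt (hH : IsSymmBody H) (F : UpFace H)
    (h : upRank F < finrank ℝ (Submodule.span ℝ H)) : IsFace H F.1 := by
  refine ⟨fun _ => F.2, F.nonempty hH, fun he => ?_⟩
  rw [upRank, he, setDim_eq hH] at h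
  omega

theorem FaceFlag.ext_face {𝔽 𝔾 : FaceFlag H n} (h : ∀ k, (𝔽.face k).1 = (𝔾.face k).1) : 𝔽 = 𝔾 := by
  obtain ⟨f, _, _⟩ := 𝔽
  obtain ⟨g, _, _⟩ := 𝔾
  have : f = g := funext fun k => Subtype.ext (h k)
  subst this
  rfl

/-- Flags as chains in the order of proper faces with the empty set. -/
noncomputable def loFlagEquiv (hH : IsSymmBody H) (n : ℕ) :
    FaceFlag H n ≃ RankedChain (loRank : LoFace H → ℕ) n where
  -- Rank k in this order means dimension k - 1, so the indices shift by one: the empty face comes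
  -- first, and the last face is repeated after rank n.
  toFun 𝔽 := ⟨fun k => if h : min k n = 0 then LoFace.bot H
      else (𝔽.face ⟨min k n - 1, by omega⟩).lo hH, fun k l hkl => by
    by_cases hk : min k n = 0
    · simp only [hk, dif_pos]
      exact empty_subset _
    · have hl : ¬ min l n = 0 := by omega
      simp only [hk, hl, dif_neg, not_false_eq_true]
      exact 𝔽.mono (by simp only [Fin.mk_le_mk]; omega), fun k => by
    by_cases hk : min k n = 0
    · simp only [hk, dif_pos, loRank_bot]
    · simp only [hk, dif_neg, not_false_eq_true, loRank_lo, 𝔽.dim_face]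
      omega⟩
  invFun c :=
    { face k := ⟨(c.1 (k + 1)).1, isFace_of_loRank_pos hH _ (by rw [c.2.2]; omega)⟩
      dim_face k := by
        have h := loRank_lo hH
          ⟨(c.1 (k + 1)).1, isFace_of_loRank_pos hH _ (by rw [c.2.2]; omega)⟩
        have h' := c.2.2 (k + 1)
        have e : loRank (c.1 (k + 1)) = setDim (c.1 (k + 1)).1 + 1 := h
        simp only
        omega
      mono k l hkl := c.2.1 (by simpa using hkl) }
  left_inv 𝔽 := by
    refine FaceFlag.ext_face fun k => ?_
    have h1 : ¬ min ((k : ℕ) + 1) n = 0 := by omega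
    simp only [h1, dif_neg, not_false_eq_true, Face.lo]
    congr 3
    omega
  right_inv c := by
    refine Subtype.ext (funext fun k => ?_)
    by_cases hk : min k n = 0
    · simp only [hk, dif_pos]
      exact Subtype.ext (loRank_eq_zero (by rw [c.2.2, hk])).symm
    · simp only [hk, dif_neg, not_false_eq_true, Face.lo]
      have h2 : min k n - 1 + 1 = min k n := by omega
      simp only [h2]
      exact eq_of_rank_eq loRank_strictMono c.2.1 (by rw [c.2.2, c.2.2]; omega)

/-- Flags as chains in the order of all non-empty faces. -/
noncomputable def upFlagEquiv (hH : IsSymmBody H) (hn : finrank ℝ (Submodule.span ℝ H) = n) :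
    FaceFlag H n ≃ RankedChain (upRank : UpFace H → ℕ) n where
  -- Here rank equals dimension, without a shift; `H` itself is appended from index n on.
  toFun 𝔽 := ⟨fun k => if h : k < n then (𝔽.face ⟨k, h⟩).up else UpFace.top H, fun k l hkl => by
    by_cases hl : l < n
    · have hk : k < n := by omega
      simp only [hk, hl, dif_pos]
      exact 𝔽.mono (by simpa using hkl)
    · simp only [hl, dif_neg, not_false_eq_true]
      exact UpFace.subset _, fun k => by
    by_cases hk : k < n
    · simp only [hk, dif_pos]
      rw [min_eq_left hk.le]
      exact 𝔽.dim_face ⟨k, hk⟩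
    · simp only [hk, dif_neg, not_false_eq_true, upRank_top hH, hn]
      omega⟩
  invFun c :=
    { face k := ⟨(c.1 k).1, isFace_of_upRank_lt hH _ (by rw [c.2.2, hn]; omega)⟩
      dim_face k := by
        have h' : setDim (c.1 k).1 = min (k : ℕ) n := c.2.2 k
        simp only [h']
        omega
      mono k l hkl := c.2.1 (by simpa using hkl) }
  left_inv 𝔽 := by
    refine FaceFlag.ext_face fun k => ?_
    simp [Face.up]
  right_inv c := by
    refine Subtype.ext (funext fun k => ?_)
    by_cases hk : k < n
    · simp only [hk, dif_pos, Face.up]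
    · simp only [hk, dif_neg, not_false_eq_true]
      exact Subtype.ext (upRank_eq_top hH (by rw [c.2.2, hn]; omega)).symm

/-- The frames of the centroids of the faces in the flags. -/
noncomputable def centroidFrame (𝔽 : FaceFlag H n) (k : Fin n) : E := centroid (𝔽.face k).1

/-- The flags that contain a given face. -/
def flagsThrough (n : ℕ) (G : Face H) : Set (FaceFlag H n) := {𝔽 | ∃ k, 𝔽.face k = G}

/-- The position of a face in a flag is its dimension. -/
theorem mem_flagsThrough_iff {G : Face H} {𝔽 : FaceFlag H n} :
    𝔽 ∈ flagsThrough n G ↔ ∃ h : setDim G.1 < n, 𝔽.face ⟨setDim G.1, h⟩ = G := by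
  constructor
  · rintro ⟨k, rfl⟩
    have h := 𝔽.dim_face k
    refine ⟨by rw [h]; exact k.2, ?_⟩
    congr 1
    exact Fin.ext h
  · rintro ⟨h, h'⟩
    exact ⟨_, h'⟩

theorem loFlagEquiv_succ (hH : IsSymmBody H) (𝔽 : FaceFlag H n) (k : Fin n) :
    (loFlagEquiv hH n 𝔽).1 (k + 1) = (𝔽.face k).lo hH := by
  have h := loFlagEquiv hH n |>.symm_apply_apply 𝔽
  have h2 := congrArg (fun 𝔽 => (FaceFlag.face 𝔽 k).1) h
  exact Subtype.ext h2

theorem upFlagEquiv_apply (hH : IsSymmBody H) (hn : finrank ℝ (Submodule.span ℝ H) = n)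
    (𝔽 : FaceFlag H n) (k : Fin n) : (upFlagEquiv hH hn 𝔽).1 k = (𝔽.face k).up := by
  have h := upFlagEquiv hH hn |>.symm_apply_apply 𝔽
  have h2 := congrArg (fun 𝔽 => (FaceFlag.face 𝔽 k).1) h
  exact Subtype.ext h2

theorem flagsThrough_eq_lo (hH : IsSymmBody H) (hn : finrank ℝ (Submodule.span ℝ H) = n)
    (G : Face H) : flagsThrough n G = loFlagEquiv hH n ⁻¹' through (G.lo hH) := by
  ext 𝔽
  have hd : setDim G.1 < n := by
    have := loRank_le (G.lo hH)
    rw [loRank_lo] at this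
    omega
  have h := loFlagEquiv_succ hH 𝔽 ⟨_, hd⟩
  rw [mem_flagsThrough_iff, mem_preimage, through, mem_ofPred_eq, loRank_lo]
  simp only at h
  rw [h]
  constructor
  · rintro ⟨_, h'⟩
    rw [h']
  · intro h'
    exact ⟨hd, Subtype.ext (congrArg (fun F : LoFace H => F.1) h')⟩

theorem flagsThrough_eq_up (hH : IsSymmBody H) (hn : finrank ℝ (Submodule.span ℝ H) = n)
    (G : Face H) : flagsThrough n G = upFlagEquiv hH hn ⁻¹' through G.up := by
  ext 𝔽
  have hd : setDim G.1 < n := by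
    have := loRank_le (G.lo hH)
    rw [loRank_lo] at this
    omega
  have h := upFlagEquiv_apply hH hn 𝔽 ⟨_, hd⟩
  rw [mem_flagsThrough_iff, mem_preimage, through, mem_ofPred_eq]
  change _ ↔ (upFlagEquiv hH hn 𝔽).1 (setDim G.1) = _
  simp only at h
  rw [h]
  constructor
  · rintro ⟨_, h'⟩
    rw [h']
  · intro h'
    exact ⟨hd, Subtype.ext (congrArg (fun F : UpFace H => F.1) h')⟩

theorem sameFrames_lo (hH : IsSymmBody H) (n : ℕ) :
    SameFrames (centroidFrame : FaceFlag H n → Fin n → E)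
      (fun 𝔽 => chainFrame loVec (loFlagEquiv hH n 𝔽)) := by
  refine sameFrames_smul_increments _ (fun 𝔽 k => loVec ((loFlagEquiv hH n 𝔽).1 k)) (fun 𝔽 => ?_)
    fun 𝔽 k => ?_
  · rw [loVec, (loFlagEquiv hH n 𝔽).2.2]
    simp
  · rw [loVec, loFlagEquiv_succ, loRank_lo, 𝔽.dim_face]
    push_cast
    rfl

theorem sameFrames_up (hH : IsSymmBody H) (hn : finrank ℝ (Submodule.span ℝ H) = n) :
    SameFrames (centroidFrame : FaceFlag H n → Fin n → E)
      (fun 𝔽 => chainFrame upVec (upFlagEquiv hH hn 𝔽)) := by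
  refine sameFrames_increments _ (fun 𝔽 k => upVec ((upFlagEquiv hH hn 𝔽).1 k)) (fun 𝔽 => ?_)
    fun 𝔽 k => ?_
  · exact upVec_eq_zero hH _ (by rw [(upFlagEquiv hH hn 𝔽).2.2, hn, min_self])
  · simp only [upFlagEquiv_apply]
    rfl

end Flags
end Hanner

namespace Hanner
open Module Set

/-! ### Induction on the representation. -/

section Induction
set_option linter.unusedSectionVars false

variable {E : Type*} [NormedAddCommGroup E] [InnerProductSpace ℝ E] [FiniteDimensional ℝ E]
  [MeasurableSpace E] [BorelSpace E]
variable {H : Set E} {n : ℕ}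

theorem SameFrames.balanced_iff {ι κ : Type*} [Finite ι] {w : ι → Fin n → E} {w' : κ → Fin n → E}
    (e : ι ≃ κ) (h : SameFrames w fun i => w' (e i)) (I : Set κ) (z : E) :
    Balanced w (e ⁻¹' I) z ↔ Balanced w' I z := by
  constructor
  · intro hb
    have := (h.balanced hb).reindex e.symm
    simpa [← preimage_comp] using this
  · intro hb
    exact h.symm.balanced (hb.reindex e)

theorem SameFrames.unimodular_iff {ι κ : Type*} {w : ι → Fin n → E} {w' : κ → Fin n → E}
    (e : ι ≃ κ) (h : SameFrames w fun i => w' (e i)) (V : Submodule ℝ E) :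
    Unimodular w V ↔ Unimodular w' V := by
  constructor
  · intro hb
    have := (h.unimodular hb).reindex e.symm
    simpa using this
  · intro hb
    exact h.symm.unimodular (hb.reindex e)

/-- The properties of the centroids of the faces in the flags of a represented Hanner polytope from
which the invariance of the volumes follows. -/
structure CentroidsBalanced (R : HannerRep H) (n : ℕ) : Prop where
  finite : Finite (FaceFlag H n)
  unimodular : Unimodular (centroidFrame : FaceFlag H n → Fin n → E) (Submodule.span ℝ H)
  balanced : ∀ G : Face H, ∀ a ∈ affineSpace R G.1, ∀ b ∈ affineSpace R G.1,
    Balanced (centroidFrame : FaceFlag H n → Fin n → E) (flagsThrough n G) (a - b)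

theorem IsFace.neg (hH : IsSymmBody H) {F : Set E} (hF : IsFace H F) : IsFace H (-F) := by
  rw [isFace_iff hH] at hF ⊢
  obtain ⟨hne, l, hl, rfl⟩ := hF
  refine ⟨hne.neg, -l, fun x hx => ?_, ?_⟩
  · simpa using hl _ (hH.neg_mem hx)
  · ext x
    constructor
    · intro hx
      have hx : -x ∈ {x ∈ H | l x = 1} := hx
      exact ⟨by simpa using hH.neg_mem hx.1, by simpa using hx.2⟩
    · intro hx
      exact ⟨hH.neg_mem hx.1, by simpa using hx.2⟩

/-- The opposite flag. -/
def FaceFlag.neg (hH : IsSymmBody H) (𝔽 : FaceFlag H n) : FaceFlag H n where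
  face k := ⟨-(𝔽.face k).1, (𝔽.face k).2.neg hH⟩
  dim_face k := by rw [← 𝔽.dim_face k]; exact setDim_neg
  mono _ _ hkl := neg_subset_neg.2 (𝔽.mono hkl)

theorem FaceFlag.neg_neg (hH : IsSymmBody H) (𝔽 : FaceFlag H n) : (𝔽.neg hH).neg hH = 𝔽 :=
  FaceFlag.ext_face fun k => by simp [FaceFlag.neg]

theorem centroidFrame_neg (hH : IsSymmBody H) (𝔽 : FaceFlag H n) (k : Fin n) :
    centroidFrame (𝔽.neg hH) k = -centroidFrame 𝔽 k :=
  centroid_neg (𝔽.face k).2.2.1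

/-- The frame of the opposite flag is the negative one. Averaging the expansion of z in a frame with
the one from the opposite flag gives coefficients that are odd under 𝔽 ↦ -𝔽, so they sum to zero
over all flags. -/
theorem balanced_univ_of_unimodular (hH : IsSymmBody H) [Finite (FaceFlag H n)]
    (hu : Unimodular (centroidFrame : FaceFlag H n → Fin n → E) (Submodule.span ℝ H)) {z : E}
    (hz : z ∈ Submodule.span ℝ H) :
    Balanced (centroidFrame : FaceFlag H n → Fin n → E) univ z := by
  cases nonempty_fintype (FaceFlag H n)
  have h : ∀ 𝔽 : FaceFlag H n, ∃ x : Fin n → ℝ, ∑ k, x k • centroidFrame 𝔽 k = z := fun 𝔽 =>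
    (Submodule.mem_span_range_iff_exists_fun ℝ).1 (by rw [hu.span_eq]; exact hz)
  choose x hx using h
  let e : FaceFlag H n ≃ FaceFlag H n :=
    ⟨FaceFlag.neg hH, FaceFlag.neg hH, FaceFlag.neg_neg hH, FaceFlag.neg_neg hH⟩
  refine ⟨fun 𝔽 k => (1 / 2 : ℝ) * (x 𝔽 k - x (e 𝔽) k), fun 𝔽 _ => ?_, by simp, fun k => ?_⟩
  · have h1 := hx 𝔽
    have h2 : ∑ k, x (e 𝔽) k • -centroidFrame 𝔽 k = z := by
      rw [← hx (e 𝔽)]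
      exact Finset.sum_congr rfl fun k _ => by rw [← centroidFrame_neg hH]; rfl
    have h3 : ∀ k, ((1 / 2 : ℝ) * (x 𝔽 k - x (e 𝔽) k)) • centroidFrame 𝔽 k
        = (1 / 2 : ℝ) • (x 𝔽 k • centroidFrame 𝔽 k + x (e 𝔽) k • -centroidFrame 𝔽 k) := by
      intro k
      module
    rw [Finset.sum_congr rfl fun k _ => h3 k, ← Finset.smul_sum, Finset.sum_add_distrib, h1, h2]
    module
  · rw [finsum_eq_sum_of_fintype, ← Finset.mul_sum, Finset.sum_sub_distrib,
      e.sum_comp (fun 𝔽 => x 𝔽 k), sub_self, mul_zero]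

section Forms

variable {R : HannerRep H}

theorem CentroidsBalanced.balanced_lo (h : CentroidsBalanced R n)
    (hn : finrank ℝ (Submodule.span ℝ H) = n) (F : LoFace H) (hne : F.1.Nonempty) {a b : E}
    (ha : a ∈ affineSpace R F.1) (hb : b ∈ affineSpace R F.1) :
    Balanced (chainFrame loVec : RankedChain loRank n → Fin n → E) (through F) (a - b) := by
  have := h.finite
  have hH := R.isSymmBody
  let G : Face H := ⟨F.1, (isFace_iff hH).2 ⟨hne, F.2⟩⟩
  have := h.balanced G a ha b hb
  rwa [flagsThrough_eq_lo hH hn, (sameFrames_lo hH n).balanced_iff] at this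

/-- Every flag passes through the empty face, so the balance over all flags applies. It accounts for
the spans of `H₁` and `H₂` in the spaces A_F of ℓ₁-sums. -/
theorem CentroidsBalanced.balanced_lo_empty (h : CentroidsBalanced R n)
    (F : LoFace H) (he : F.1 = ∅) {z : E} (hz : z ∈ Submodule.span ℝ H) :
    Balanced (chainFrame loVec : RankedChain loRank n → Fin n → E) (through F) z := by
  have := h.finite
  have hH := R.isSymmBody
  rw [← (sameFrames_lo hH n).balanced_iff]
  have hF : F = LoFace.bot H := Subtype.ext he
  convert balanced_univ_of_unimodular hH h.unimodular hz using 1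
  refine eq_univ_of_forall fun 𝔽 => ?_
  change (loFlagEquiv hH n 𝔽).1 (loRank F) = F
  rw [hF, loRank_bot]
  exact Subtype.ext (loRank_eq_zero (by rw [(loFlagEquiv hH n 𝔽).2.2]; simp))

theorem CentroidsBalanced.balanced_up (h : CentroidsBalanced R n)
    (hn : finrank ℝ (Submodule.span ℝ H) = n) (F : UpFace H) (hne : F.1 ≠ H) {a b : E}
    (ha : a ∈ affineSpace R F.1) (hb : b ∈ affineSpace R F.1) :
    Balanced (chainFrame upVec : RankedChain upRank n → Fin n → E) (through F) (a - b) := by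
  have := h.finite
  have hH := R.isSymmBody
  let G : Face H := ⟨F.1, fun _ => F.2, F.nonempty hH, hne⟩
  have := h.balanced G a ha b hb
  rwa [flagsThrough_eq_up hH hn, (sameFrames_up hH hn).balanced_iff] at this

theorem CentroidsBalanced.unimodular_lo (h : CentroidsBalanced R n) :
    Unimodular (chainFrame loVec : RankedChain (loRank : LoFace H → ℕ) n → Fin n → E)
      (Submodule.span ℝ H) :=
  ((sameFrames_lo R.isSymmBody n).unimodular_iff _ _).1 h.unimodular

theorem CentroidsBalanced.unimodular_up (h : CentroidsBalanced R n)
    (hn : finrank ℝ (Submodule.span ℝ H) = n) :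
    Unimodular (chainFrame upVec : RankedChain (upRank : UpFace H → ℕ) n → Fin n → E)
      (Submodule.span ℝ H) :=
  ((sameFrames_up R.isSymmBody hn).unimodular_iff _ _).1 h.unimodular

theorem CentroidsBalanced.finite_lo (h : CentroidsBalanced R n) :
    Finite (RankedChain (loRank : LoFace H → ℕ) n) :=
  have := h.finite
  Finite.of_equiv _ (loFlagEquiv R.isSymmBody n)

theorem CentroidsBalanced.finite_up (h : CentroidsBalanced R n)
    (hn : finrank ℝ (Submodule.span ℝ H) = n) :
    Finite (RankedChain (upRank : UpFace H → ℕ) n) :=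
  have := h.finite
  Finite.of_equiv _ (upFlagEquiv R.isSymmBody hn)

end Forms

theorem isFace_segment {v : E} {F : Set E} (hF : IsFace (segment ℝ (-v) v) F) :
    F = {v} ∨ F = {-v} := by
  obtain ⟨hne, l, hl, rfl⟩ := (isFace_iff (IsSymmBody.segment v)).1 hF
  have hmem : ∀ x ∈ segment ℝ (-v) v, ∃ s : ℝ, -1 ≤ s ∧ s ≤ 1 ∧ x = s • v := by
    rintro x ⟨a, b, ha, hb, hab, rfl⟩
    exact ⟨b - a, by linarith, by linarith, by module⟩
  have hv : v ∈ segment ℝ (-v) v := right_mem_segment _ _ _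
  have hv' : -v ∈ segment ℝ (-v) v := left_mem_segment _ _ _
  have h1 := hl v hv
  have h2 := hl (-v) hv'
  rw [map_neg] at h2
  obtain ⟨p, hp, hp1⟩ := hne
  obtain ⟨s, hs1, hs2, rfl⟩ := hmem p hp
  rw [map_smul, smul_eq_mul] at hp1
  have h3 : l v = 1 ∨ l v = -1 := by
    rcases le_total 0 s with h | h
    · left; nlinarith
    · right; nlinarith
  rcases h3 with h3 | h3
  · left
    ext x
    constructor
    · rintro ⟨hx, hx1⟩
      obtain ⟨t, -, -, rfl⟩ := hmem x hx
      rw [map_smul, h3, smul_eq_mul, mul_one] at hx1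
      simp [hx1]
    · rintro rfl
      exact ⟨hv, h3⟩
  · right
    ext x
    constructor
    · rintro ⟨hx, hx1⟩
      obtain ⟨t, -, -, rfl⟩ := hmem x hx
      rw [map_smul, h3, smul_eq_mul] at hx1
      have : t = -1 := by linarith
      simp [this]
    · rintro rfl
      exact ⟨hv', by simp [h3]⟩

theorem span_segment_neg (v : E) : Submodule.span ℝ (segment ℝ (-v) v) = Submodule.span ℝ {v} := by
  refine le_antisymm (Submodule.span_le.2 ?_)
    (Submodule.span_mono (by simpa using right_mem_segment ℝ (-v) v))
  rintro x ⟨a, b, ha, hb, hab, rfl⟩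
  exact Submodule.mem_span_singleton.2 ⟨b - a, by module⟩

/-- Each A_F is a single end point, so only z = 0 must be balanced, and the frames are ±v. -/
theorem centroidsBalanced_interval (v : E) (hv : v ≠ 0)
    (hn : finrank ℝ (Submodule.span ℝ (segment ℝ (-v) v)) = n) :
    CentroidsBalanced (HannerRep.interval v hv) n := by
  have hn1 : n = 1 := by rw [← hn, span_segment_neg, finrank_span_singleton hv]
  subst hn1
  have hc : ∀ (𝔽 : FaceFlag (segment ℝ (-v) v) 1) (k : Fin 1),
      centroidFrame 𝔽 k = v ∨ centroidFrame 𝔽 k = -v := by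
    intro 𝔽 k
    rw [centroidFrame]
    rcases isFace_segment (𝔽.face k).2 with h | h
    · left; rw [h, centroid_singleton]
    · right; rw [h, centroid_singleton]
  refine ⟨?_, ⟨fun 𝔽 => ?_, fun 𝔽 𝔾 => ?_⟩, fun G a ha b hb => ?_⟩
  · have hfin : Finite (Face (segment ℝ (-v) v)) :=
      Set.Finite.to_subtype (Set.Finite.subset (Set.toFinite {{v}, {-v}}) fun F hF =>
        isFace_segment hF)
    exact Finite.of_injective (fun 𝔽 : FaceFlag (segment ℝ (-v) v) 1 => 𝔽.face) fun 𝔽 𝔾 h =>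
      FaceFlag.ext_face fun k => congrArg Subtype.val (congrFun h k)
  · rw [span_segment_neg, range_unique]
    rcases hc 𝔽 default with h | h
    · rw [h]
    · rw [h, ← neg_singleton, Submodule.span_neg]
  · have h : ∃ ε : ℝ, |ε| = 1 ∧ ∀ k, centroidFrame 𝔾 k = ε • centroidFrame 𝔽 0 := by
      rcases hc 𝔽 0 with h1 | h1 <;> rcases hc 𝔾 0 with h2 | h2
      · exact ⟨1, by simp, fun k => by rw [Subsingleton.elim k 0, h1, h2, one_smul]⟩
      · exact ⟨-1, by simp, fun k => by rw [Subsingleton.elim k 0, h1, h2]; simp⟩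
      · exact ⟨-1, by simp, fun k => by rw [Subsingleton.elim k 0, h1, h2]; simp⟩
      · exact ⟨1, by simp, fun k => by rw [Subsingleton.elim k 0, h1, h2, one_smul]⟩
    obtain ⟨ε, hε, h⟩ := h
    refine ⟨Matrix.of fun _ _ => ε, by simpa using hε, fun k => ?_⟩
    rw [h]
    simp
  · have h0 : a - b = 0 := by
      rw [affineSpace] at ha hb
      rcases isFace_segment G.2 with h | h
      · rw [h, mem_singleton_iff] at ha hb
        rw [ha, hb, sub_self]
      · rw [h, mem_singleton_iff] at ha hb
        rw [ha, hb, sub_self]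
    rw [h0]
    exact Balanced.zero _ _

/-- A difference of two points of A_F splits into one part per factor. A part is balanced by
induction when the face of that factor is non-empty, and by central symmetry when it is empty. -/
theorem centroidsBalanced_sumOne {H₁ H₂ : Set E} {R₁ : HannerRep H₁} {R₂ : HannerRep H₂}
    (hd : Disjoint (Submodule.span ℝ H₁) (Submodule.span ℝ H₂))
    (ih₁ : CentroidsBalanced R₁ (finrank ℝ (Submodule.span ℝ H₁)))
    (ih₂ : CentroidsBalanced R₂ (finrank ℝ (Submodule.span ℝ H₂))) :
    CentroidsBalanced (HannerRep.sumOne R₁ R₂ hd)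
      (finrank ℝ (Submodule.span ℝ H₁) + finrank ℝ (Submodule.span ℝ H₂)) := by
  have h₁ := R₁.isSymmBody
  have h₂ := R₂.isSymmBody
  have hH := h₁.lOneSum h₂
  have hn : finrank ℝ (Submodule.span ℝ (lOneSum H₁ H₂))
      = finrank ℝ (Submodule.span ℝ H₁) + finrank ℝ (Submodule.span ℝ H₂) := by
    rw [span_lOneSum, finrank_sup_of_disjoint hd]
  let D := loProduct h₁ h₂ hd
  have := ih₁.finite_lo
  have := ih₂.finite_lo
  have := D.finite
  have hfin := Finite.of_equiv _ (loFlagEquiv hH (finrank ℝ (Submodule.span ℝ H₁) +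
    finrank ℝ (Submodule.span ℝ H₂))).symm
  refine ⟨hfin, ?_, fun G a ha b hb => ?_⟩
  · rw [(sameFrames_lo hH _).unimodular_iff, span_lOneSum]
    exact D.unimodular ih₁.unimodular_lo ih₂.unimodular_lo
  · rw [flagsThrough_eq_lo hH hn, (sameFrames_lo hH _).balanced_iff]
    have e1 : G.1 ∩ H₁ = (D.e (G.lo hH)).1.1 := rfl
    have e2 : G.1 ∩ H₂ = (D.e (G.lo hH)).2.1 := rfl
    have hG : G.1 = lOneSum (D.e (G.lo hH)).1.1 (D.e (G.lo hH)).2.1 :=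
      (G.lo hH).eq_lOneSum h₁ h₂ hd
    rw [affineSpace] at ha hb
    simp only [e1, e2] at ha hb
    split_ifs at ha hb with hF₂ hF₁
    -- Both parts cannot be empty, since `G` is non-empty.
    · have hne : (D.e (G.lo hH)).1.1.Nonempty := by
        rw [nonempty_iff_ne_empty]
        intro hF₁
        rw [hF₁, hF₂, lOneSum_empty_left convex_empty] at hG
        exact G.2.2.1.ne_empty hG
      obtain ⟨a₁, ha₁, a₂, ha₂, rfl⟩ := ha
      obtain ⟨b₁, hb₁, b₂, hb₂, rfl⟩ := hb
      rw [add_sub_add_comm]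
      exact D.balanced _ (ih₁.balanced_lo rfl _ hne ha₁ hb₁)
        (ih₂.balanced_lo_empty _ hF₂ (sub_mem ha₂ hb₂))
    · obtain ⟨a₁, ha₁, a₂, ha₂, rfl⟩ := ha
      obtain ⟨b₁, hb₁, b₂, hb₂, rfl⟩ := hb
      rw [add_sub_add_comm]
      exact D.balanced _ (ih₁.balanced_lo_empty _ hF₁ (sub_mem ha₁ hb₁))
        (ih₂.balanced_lo rfl _ (nonempty_iff_ne_empty.2 hF₂) ha₂ hb₂)
    · obtain ⟨_, ⟨a₁, ha₁, rfl⟩, _, ⟨a₂, ha₂, rfl⟩, rfl⟩ := ha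
      obtain ⟨_, ⟨b₁, hb₁, rfl⟩, _, ⟨b₂, hb₂, rfl⟩, rfl⟩ := hb
      rw [add_sub_add_comm]
      simp only [← smul_sub]
      exact D.balanced _ ((ih₁.balanced_lo rfl _ (nonempty_iff_ne_empty.2 hF₁) ha₁ hb₁).smul _)
        ((ih₂.balanced_lo rfl _ (nonempty_iff_ne_empty.2 hF₂) ha₂ hb₂).smul _)

/-- A factor whose face is the whole body contributes the zero vector. If both faces are proper, the
difference has parts balanced by induction and a multiple of the extra direction, which is balanced
by averaging over shuffles. -/
theorem centroidsBalanced_sumInf {H₁ H₂ : Set E} {R₁ : HannerRep H₁} {R₂ : HannerRep H₂}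
    (hd : Disjoint (Submodule.span ℝ H₁) (Submodule.span ℝ H₂))
    (ih₁ : CentroidsBalanced R₁ (finrank ℝ (Submodule.span ℝ H₁)))
    (ih₂ : CentroidsBalanced R₂ (finrank ℝ (Submodule.span ℝ H₂))) :
    CentroidsBalanced (HannerRep.sumInf R₁ R₂ hd)
      (finrank ℝ (Submodule.span ℝ H₁) + finrank ℝ (Submodule.span ℝ H₂)) := by
  have h₁ := R₁.isSymmBody
  have h₂ := R₂.isSymmBody
  have hH := h₁.add h₂
  have hn : finrank ℝ (Submodule.span ℝ (H₁ + H₂))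
      = finrank ℝ (Submodule.span ℝ H₁) + finrank ℝ (Submodule.span ℝ H₂) := by
    rw [span_add h₁ h₂, finrank_sup_of_disjoint hd]
  let D := upProduct h₁ h₂ hd
  have := ih₁.finite_up rfl
  have := ih₂.finite_up rfl
  have := D.finite
  have hfin := Finite.of_equiv _ (upFlagEquiv hH hn).symm
  refine ⟨hfin, ?_, fun G a ha b hb => ?_⟩
  · rw [(sameFrames_up hH hn).unimodular_iff, span_add h₁ h₂]
    exact D.unimodular (ih₁.unimodular_up rfl) (ih₂.unimodular_up rfl)
  · rw [flagsThrough_eq_up hH hn, (sameFrames_up hH hn).balanced_iff]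
    have e1 : leftSummand H₁ H₂ G.1 = (D.e G.up).1.1 := rfl
    have e2 : rightSummand H₁ H₂ G.1 = (D.e G.up).2.1 := rfl
    have hG : G.1 = (D.e G.up).1.1 + (D.e G.up).2.1 := G.up.eq_add h₁ h₂ hd
    rw [affineSpace] at ha hb
    simp only [e1, e2] at ha hb
    split_ifs at ha hb with hF₂ hF₁
    · have hne : (D.e G.up).1.1 ≠ H₁ := by
        intro hF₁
        rw [hF₁, hF₂] at hG
        exact G.2.2.2 hG
      rw [← add_zero (a - b)]
      exact D.balanced _ (ih₁.balanced_up rfl _ hne ha hb) (Balanced.zero _ _)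
    · rw [← zero_add (a - b)]
      exact D.balanced _ (Balanced.zero _ _) (ih₂.balanced_up rfl _ hF₂ ha hb)
    · obtain ⟨_, ⟨a₁, ha₁, a₂, ha₂, rfl⟩, s, hs, rfl⟩ := ha
      obtain ⟨_, ⟨b₁, hb₁, b₂, hb₂, rfl⟩, t, ht, rfl⟩ := hb
      obtain ⟨s, rfl⟩ := Submodule.mem_span_singleton.1 hs
      obtain ⟨t, rfl⟩ := Submodule.mem_span_singleton.1 ht
      simp only
      rw [add_sub_add_comm, add_sub_add_comm a₁, ← sub_smul]
      refine (D.balanced _ (ih₁.balanced_up rfl _ hF₁ ha₁ hb₁)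
        (ih₂.balanced_up rfl _ hF₂ ha₂ hb₂)).add (Balanced.smul ?_ _)
      -- The dimensions of `H₁`, `H₂` become the top ranks, so that the extra direction takes the
      -- form in `RankedProduct.balanced_of_lt`.
      rw [setDim_eq h₁, setDim_eq h₂]
      refine D.balanced_of_lt (upVec_eq_zero h₁) (upVec_eq_zero h₂) G.up ?_ ?_
      · exact lt_of_le_of_ne (upRank_le _) fun h => hF₁ (upRank_eq_top h₁ h)
      · exact lt_of_le_of_ne (upRank_le _) fun h => hF₂ (upRank_eq_top h₂ h)

theorem centroidsBalanced (R : HannerRep H) :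
    CentroidsBalanced R (finrank ℝ (Submodule.span ℝ H)) := by
  induction R with
  | interval v hv => exact centroidsBalanced_interval v hv rfl
  | sumOne R₁ R₂ h ih₁ ih₂ =>
    rw [span_lOneSum, finrank_sup_of_disjoint h]
    exact centroidsBalanced_sumOne h ih₁ ih₂
  | sumInf R₁ R₂ h ih₁ ih₂ =>
    rw [span_add R₁.isSymmBody R₂.isSymmBody, finrank_sup_of_disjoint h]
    exact centroidsBalanced_sumInf h ih₁ ih₂

end Induction
end Hanner

namespace Hanner
open Module Set

/-! ### Simplex volumes as determinants, and the variation of the volume sums. -/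

section Volume

variable {n : ℕ}

/-- The matrix whose rows are the given vectors. -/
def rowMatrix (z : Fin n → EuclideanSpace ℝ (Fin n)) : Matrix (Fin n) (Fin n) ℝ :=
  Matrix.of fun k i => z k i

theorem rowMatrix_sum_smul (M : Matrix (Fin n) (Fin n) ℝ) (z : Fin n → EuclideanSpace ℝ (Fin n)) :
    rowMatrix (fun k => ∑ l, M k l • z l) = M * rowMatrix z := by
  ext k i
  simp [rowMatrix, Matrix.mul_apply]

/-- The volume of the standard simplex. -/
noncomputable def stdSimplexVolume (n : ℕ) : ℝ :=
  MeasureTheory.volume.real (convexHull ℝ (insert (0 : EuclideanSpace ℝ (Fin n))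
    (Set.range (EuclideanSpace.basisFun (Fin n) ℝ))))

theorem volume_convexHull_insert_zero (z : Fin n → EuclideanSpace ℝ (Fin n)) :
    MeasureTheory.volume.real (convexHull ℝ (insert (0 : EuclideanSpace ℝ (Fin n)) (Set.range z)))
      = stdSimplexVolume n * |(rowMatrix z).det| := by
  let b := (EuclideanSpace.basisFun (Fin n) ℝ).toBasis
  let L : EuclideanSpace ℝ (Fin n) →ₗ[ℝ] EuclideanSpace ℝ (Fin n) := b.constr ℝ z
  have hL : ∀ k, L (EuclideanSpace.basisFun (Fin n) ℝ k) = z k := fun k => by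
    have := b.constr_basis ℝ z k
    rwa [OrthonormalBasis.coe_toBasis] at this
  have h1 : convexHull ℝ (insert (0 : EuclideanSpace ℝ (Fin n)) (Set.range z))
      = L '' convexHull ℝ (insert (0 : EuclideanSpace ℝ (Fin n))
        (Set.range (EuclideanSpace.basisFun (Fin n) ℝ))) := by
    rw [L.image_convexHull, image_insert_eq, map_zero, ← range_comp]
    congr 3
    ext1 k
    exact (hL k).symm
  have h2 : LinearMap.det L = (rowMatrix z).det := by
    rw [← LinearMap.det_toMatrix b, ← Matrix.det_transpose]
    congr 1
    ext i k
    have h := hL i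
    rw [EuclideanSpace.basisFun_apply] at h
    simp [LinearMap.toMatrix_apply, rowMatrix, b, h]
  rw [h1, MeasureTheory.measureReal_def, MeasureTheory.Measure.addHaar_image_linearMap,
    ENNReal.toReal_mul, h2, ENNReal.toReal_ofReal (abs_nonneg _), mul_comm]
  rfl

theorem det_one_add_vecMulVec (u v : Fin n → ℝ) :
    (1 + Matrix.of fun k l => u k * v l : Matrix (Fin n) (Fin n) ℝ).det = 1 + ∑ k, u k * v k := by
  have h := Matrix.det_one_add_replicateCol_mul_replicateRow (ι := Unit) u v
  have e : Matrix.replicateCol Unit u * Matrix.replicateRow Unit v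
      = Matrix.of fun k l => u k * v l := by
    ext k l
    simp [Matrix.mul_apply]
  rw [e] at h
  rw [h, dotProduct]
  simp [mul_comm]

theorem hasDerivAt_abs_det_one_add_smul (X : Matrix (Fin n) (Fin n) ℝ) :
    HasDerivAt (fun t : ℝ => |(1 + t • X).det|) X.trace 0 := by
  have h : HasDerivAt (fun t : ℝ => (1 + t • X).det) X.trace 0 := by
    let p := (Matrix.det (1 + (Polynomial.X : Polynomial ℝ) • X.map Polynomial.C)).divX.divX
    have e : (fun t : ℝ => (1 + t • X).det) = fun t => 1 + X.trace * t + p.eval t * t ^ 2 :=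
      funext fun t => Matrix.det_one_add_smul t X
    rw [e]
    have h1 := ((hasDerivAt_id (0 : ℝ)).const_mul X.trace).const_add 1
    have h2 := (p.hasDerivAt 0).mul ((hasDerivAt_id (0 : ℝ)).pow 2)
    refine (h1.add h2).congr_deriv ?_
    simp
  have hpos : (0 : ℝ) < (1 + (0 : ℝ) • X).det := by simp
  -- The determinant is 1 at t = 0, so the absolute value is differentiable there with derivative 1.
  have := (hasDerivAt_abs_pos hpos).comp (0 : ℝ) h
  simpa [Function.comp_def] using this

variable {H : Set (EuclideanSpace ℝ (Fin n))}

theorem simplexVolume_eq (Z : Face H → EuclideanSpace ℝ (Fin n)) (𝔽 : FaceFlag H n) :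
    simplexVolume Z 𝔽 = stdSimplexVolume n * |(rowMatrix fun k => Z (𝔽.face k)).det| :=
  volume_convexHull_insert_zero _

theorem exists_abs_det_eq {V : Submodule ℝ (EuclideanSpace ℝ (Fin n))}
    (hu : Unimodular (centroidFrame : FaceFlag H n → Fin n → EuclideanSpace ℝ (Fin n)) V) :
    ∃ δ : ℝ, ∀ 𝔽 : FaceFlag H n, |(rowMatrix (centroidFrame 𝔽)).det| = δ := by
  rcases isEmpty_or_nonempty (FaceFlag H n) with he | ⟨⟨𝔾⟩⟩
  · exact ⟨0, fun 𝔽 => he.elim 𝔽⟩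
  · refine ⟨|(rowMatrix (centroidFrame 𝔾)).det|, fun 𝔽 => ?_⟩
    obtain ⟨M, hM, h⟩ := hu.transition 𝔾 𝔽
    rw [funext h, rowMatrix_sum_smul, Matrix.det_mul, abs_mul, hM, one_mul]

/-- Every face of a flag through `G` is comparable with `G`, so every row moves along z. In the
frame of centroids this is multiplication by the identity plus a rank-one matrix. -/
theorem simplexVolume_add_perturbation {𝔽 : FaceFlag H n} {G : Face H}
    (h𝔽 : 𝔽 ∈ flagsThrough n G) (ξ : ℕ → ℝ) {x : Fin n → ℝ} {z : EuclideanSpace ℝ (Fin n)}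
    (hx : ∑ k, x k • centroidFrame 𝔽 k = z) :
    simplexVolume (centroids H + perturbation G ξ z) 𝔽
      = stdSimplexVolume n * (|(rowMatrix (centroidFrame 𝔽)).det| *
        |1 + ∑ k : Fin n, ξ (k + 1) * x k|) := by
  have hp : ∀ k, perturbation G ξ z (𝔽.face k) = ξ (k + 1) • z := by
    intro k
    obtain ⟨j, rfl⟩ := h𝔽
    rw [perturbation, if_pos, 𝔽.dim_face]
    exact (le_total j k).imp (fun h => 𝔽.mono h) (fun h => 𝔽.mono h)
  have h : (fun k => (centroids H + perturbation G ξ z) (𝔽.face k)) = fun k =>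
      ∑ l, (1 + Matrix.of fun k l : Fin n => ξ (k + 1) * x l : Matrix (Fin n) (Fin n) ℝ) k l •
        centroidFrame 𝔽 l := by
    ext1 k
    rw [Pi.add_apply, hp, ← hx]
    simp only [Matrix.add_apply, Matrix.of_apply, add_smul, Finset.sum_add_distrib, mul_smul,
      ← Finset.smul_sum]
    congr 1
    simp [Matrix.one_apply, centroids, centroidFrame]
  rw [simplexVolume_eq, h, rowMatrix_sum_smul, Matrix.det_mul, abs_mul,
    det_one_add_vecMulVec (fun k : Fin n => ξ (k + 1)) x, mul_comm |1 + _|]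

theorem simplexVolume_centroids (𝔽 : FaceFlag H n) : simplexVolume (centroids H) 𝔽
    = stdSimplexVolume n * |(rowMatrix (centroidFrame 𝔽)).det| :=
  simplexVolume_eq _ _

/-- All simplices have the same volume, so the change of the sum is that constant times ∑_k ξ_{k+1}
∑_𝔽 x_k(𝔽), and the inner sums vanish by balance. -/
theorem volumeThrough_add_perturbation [Finite (FaceFlag H n)]
    {V : Submodule ℝ (EuclideanSpace ℝ (Fin n))}
    (hu : Unimodular (centroidFrame : FaceFlag H n → Fin n → EuclideanSpace ℝ (Fin n)) V)
    {G : Face H} {z : EuclideanSpace ℝ (Fin n)}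
    (hb : Balanced (centroidFrame : FaceFlag H n → Fin n → EuclideanSpace ℝ (Fin n))
      (flagsThrough n G) z) :
    ∃ ε : ℝ, 0 < ε ∧ ∀ ξ : ℕ → ℝ, (∀ k ∈ Finset.Icc 1 n, |ξ k| < ε) →
      volumeThrough G (centroids H + perturbation G ξ z) = volumeThrough G (centroids H) := by
  classical
  cases nonempty_fintype (FaceFlag H n)
  obtain ⟨δ, hδ⟩ := exists_abs_det_eq hu
  obtain ⟨x, hx, hx', hx0⟩ := hb
  have hS : 0 ≤ ∑ 𝔽, ∑ k, |x 𝔽 k| :=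
    Finset.sum_nonneg fun _ _ => Finset.sum_nonneg fun _ _ => abs_nonneg _
  -- This bound makes |∑ ξ_{k+1} x_k(𝔽)| ≤ 1 for every flag, so the absolute value can be dropped;
  -- the summand 1 avoids inverting zero.
  refine ⟨(1 + ∑ 𝔽, ∑ k, |x 𝔽 k|)⁻¹, by positivity, fun ξ hξ => ?_⟩
  have habs : ∀ 𝔽 : FaceFlag H n, |1 + ∑ k : Fin n, ξ (k + 1) * x 𝔽 k|
      = 1 + ∑ k : Fin n, ξ (k + 1) * x 𝔽 k := by
    intro 𝔽
    refine abs_of_nonneg ?_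
    have h1 : |∑ k : Fin n, ξ (k + 1) * x 𝔽 k| ≤ 1 := by
      calc |∑ k : Fin n, ξ (k + 1) * x 𝔽 k| ≤ ∑ k : Fin n, |ξ (k + 1) * x 𝔽 k| :=
            Finset.abs_sum_le_sum_abs _ _
        _ ≤ ∑ k : Fin n, (1 + ∑ 𝔽, ∑ k, |x 𝔽 k|)⁻¹ * |x 𝔽 k| := by
            refine Finset.sum_le_sum fun k _ => ?_
            rw [abs_mul]
            refine mul_le_mul_of_nonneg_right (hξ _ ?_).le (abs_nonneg _)
            rw [Finset.mem_Icc]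
            omega
        _ = (1 + ∑ 𝔽, ∑ k, |x 𝔽 k|)⁻¹ * ∑ k : Fin n, |x 𝔽 k| := by rw [Finset.mul_sum]
        _ ≤ 1 := by
            rw [inv_mul_le_iff₀ (by positivity), mul_one]
            have := Finset.single_le_sum (f := fun 𝔽 => ∑ k, |x 𝔽 k|)
              (fun _ _ => Finset.sum_nonneg fun _ _ => abs_nonneg _) (Finset.mem_univ 𝔽)
            linarith
    linarith [(abs_le.1 h1).1]
  -- The coefficients vanish off the flags through `G`, so the balanced sum over all flags is the
  -- sum over these.
  have hsub : ∀ k, ∑ 𝔽 : {𝔽 : FaceFlag H n // ∃ k, 𝔽.face k = G}, x 𝔽.1 k = 0 := by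
    intro k
    have h1 := Fintype.sum_subtype_add_sum_subtype (fun 𝔽 : FaceFlag H n => ∃ k, 𝔽.face k = G)
      (fun 𝔽 => x 𝔽 k)
    have h2 := hx0 k
    rw [finsum_eq_sum_of_fintype] at h2
    rw [h2, Finset.sum_eq_zero (s := (Finset.univ :
      Finset {𝔽 : FaceFlag H n // ¬∃ k, 𝔽.face k = G})) (fun 𝔽 _ => by
        rw [hx' 𝔽.1 𝔽.2]; rfl), add_zero] at h1
    exact h1
  rw [volumeThrough, volumeThrough, finsum_eq_sum_of_fintype, finsum_eq_sum_of_fintype]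
  have h1 : ∀ 𝔽 : {𝔽 : FaceFlag H n // ∃ k, 𝔽.face k = G},
      simplexVolume (centroids H + perturbation G ξ z) 𝔽.1 = simplexVolume (centroids H) 𝔽.1
        + stdSimplexVolume n * δ * ∑ k : Fin n, ξ (k + 1) * x 𝔽.1 k := by
    intro 𝔽
    rw [simplexVolume_add_perturbation 𝔽.2 ξ (hx 𝔽.1 𝔽.2), simplexVolume_centroids, habs, hδ]
    ring
  rw [Finset.sum_congr rfl fun 𝔽 _ => h1 𝔽, Finset.sum_add_distrib, ← Finset.mul_sum,
    Finset.sum_comm]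
  simp only [← Finset.mul_sum, hsub]
  simp

/-- Row k of `X 𝔽` holds the coefficients of `Z` at the k-th face of 𝔽 in the frame of 𝔽. The
derivative is a constant times the sum of the traces, and only the balance of slot dim G of each `Z
G` enters. -/
theorem hasLineDerivAt_totalVolume [Finite (FaceFlag H n)]
    {V : Submodule ℝ (EuclideanSpace ℝ (Fin n))}
    (hu : Unimodular (centroidFrame : FaceFlag H n → Fin n → EuclideanSpace ℝ (Fin n)) V)
    {Z : Face H → EuclideanSpace ℝ (Fin n)}
    (hb : ∀ G, Balanced (centroidFrame : FaceFlag H n → Fin n → EuclideanSpace ℝ (Fin n))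
      (flagsThrough n G) (Z G)) :
    HasLineDerivAt ℝ (totalVolume (P := H)) 0 (centroids H) Z := by
  classical
  cases nonempty_fintype (FaceFlag H n)
  obtain ⟨δ, hδ⟩ := exists_abs_det_eq hu
  choose x hx hx' hx0 using hb
  let X : FaceFlag H n → Matrix (Fin n) (Fin n) ℝ := fun 𝔽 => Matrix.of fun k l => x (𝔽.face k) 𝔽 l
  have hvol : ∀ (t : ℝ) (𝔽 : FaceFlag H n), simplexVolume (centroids H + t • Z) 𝔽
      = stdSimplexVolume n * δ * |(1 + t • X 𝔽).det| := by
    intro t 𝔽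
    have h : (fun k => (centroids H + t • Z) (𝔽.face k)) = fun k =>
        ∑ l, (1 + t • X 𝔽) k l • centroidFrame 𝔽 l := by
      ext1 k
      rw [Pi.add_apply, Pi.smul_apply, ← hx (𝔽.face k) 𝔽 ⟨k, rfl⟩]
      simp only [Matrix.add_apply, Matrix.smul_apply, smul_eq_mul, add_smul,
        Finset.sum_add_distrib, mul_smul, ← Finset.smul_sum]
      congr 1
      simp [Matrix.one_apply, centroids, centroidFrame]
    rw [simplexVolume_eq, h, rowMatrix_sum_smul, Matrix.det_mul, abs_mul, hδ]
    ring
  have htr : ∑ 𝔽, (X 𝔽).trace = 0 := by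
    simp only [Matrix.trace, Matrix.diag_apply, X, Matrix.of_apply]
    rw [Finset.sum_comm]
    refine Finset.sum_eq_zero fun k _ => ?_
    -- Group the flags by their k-th face G; each group contributes the balanced sum of slot k for
    -- `Z G`.
    rw [← Finset.sum_fiberwise_of_maps_to (t := Finset.univ.image fun 𝔽 : FaceFlag H n => 𝔽.face k)
      (g := fun 𝔽 => 𝔽.face k) (fun 𝔽 h => Finset.mem_image_of_mem _ h)]
    refine Finset.sum_eq_zero fun G hG => ?_
    obtain ⟨𝔾, -, rfl⟩ := Finset.mem_image.1 hG
    have h0 := hx0 (𝔾.face k) k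
    rw [finsum_eq_sum_of_fintype] at h0
    rw [← h0, Finset.sum_filter]
    refine Finset.sum_congr rfl fun 𝔽 _ => ?_
    split_ifs with h
    · rw [h]
    -- A flag with another k-th face does not contain G at all, since by dimension G could only be
    -- at position k.
    · rw [hx' (𝔾.face k) 𝔽 ?_]
      · rfl
      · rintro ⟨j, hj⟩
        have h1 := 𝔽.dim_face j
        rw [hj, 𝔾.dim_face] at h1
        rw [← Fin.ext h1] at hj
        exact h hj
  have hd : HasDerivAt (fun t : ℝ => ∑ 𝔽, stdSimplexVolume n * δ * |(1 + t • X 𝔽).det|)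
      (∑ 𝔽, stdSimplexVolume n * δ * (X 𝔽).trace) 0 :=
    HasDerivAt.fun_sum fun 𝔽 _ => (hasDerivAt_abs_det_one_add_smul (X 𝔽)).const_mul _
  rw [← Finset.mul_sum, htr, mul_zero] at hd
  have he : (fun t : ℝ => totalVolume (centroids H + t • Z))
      = fun t : ℝ => ∑ 𝔽, stdSimplexVolume n * δ * |(1 + t • X 𝔽).det| := by
    ext1 t
    rw [totalVolume, finsum_eq_sum_of_fintype]
    exact Finset.sum_congr rfl fun 𝔽 _ => hvol t 𝔽
  rw [HasLineDerivAt, he]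
  exact hd

end Volume
end Hanner

theorem mainTheorem3 (n : ℕ) (H : Set (EuclideanSpace ℝ (Fin n))) (R : Hanner.HannerRep H)
    (hH : Submodule.span ℝ H = ⊤) :
    (∀ (G : Hanner.Face H) (z : EuclideanSpace ℝ (Fin n)),
      z ∈ Hanner.affineSpace R G.1 - Hanner.affineSpace R G.1 →
        ∃ ε : ℝ, 0 < ε ∧ ∀ ξ : ℕ → ℝ, (∀ k ∈ Finset.Icc 1 n, |ξ k| < ε) →
          Hanner.volumeThrough G (Hanner.centroids H + Hanner.perturbation G ξ z)
            = Hanner.volumeThrough G (Hanner.centroids H)) ∧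
    (∀ Z : Hanner.Face H → EuclideanSpace ℝ (Fin n),
      (∀ F : Hanner.Face H,
        Z F ∈ Hanner.affineSpace R F.1 - Hanner.affineSpace R F.1) →
        HasLineDerivAt ℝ (Hanner.totalVolume (P := H)) 0 (Hanner.centroids H) Z) := by
  have hn : Module.finrank ℝ (Submodule.span ℝ H) = n := by
    rw [hH, finrank_top, finrank_euclideanSpace_fin]
  have h := Hanner.centroidsBalanced R
  rw [hn] at h
  -- Finiteness of the set of flags turns the `finsum`s in the volumes into genuine finite sums.
  have := h.finite
  constructor
  · rintro G z ⟨a, ha, b, hb, rfl⟩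
    exact Hanner.volumeThrough_add_perturbation h.unimodular (h.balanced G a ha b hb)
  · intro Z hZ
    refine Hanner.hasLineDerivAt_totalVolume h.unimodular fun G => ?_
    obtain ⟨a, ha, b, hb, hab⟩ := hZ G
    rw [← hab]
    exact h.balanced G a ha b hb
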